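/- Let $n,d$ be natural numbers, $Y=(0,1)^d$. Let $a\in L^\infty(\mathbb R^d;L(\mathbb C^{n\times d}))$ and $s\in L^\infty(\mathbb R^d;L(\mathbb C^n))$ be $\mathbb Z^d$-periodic and coercive, i.e. for some $\nu>0$ and almost every $x\in\mathbb R^d$, $\operatorname{Re}\langle a(x)X,X\rangle\ge\nu|X|^2$ for all $X\in\mathbb C^{n\times d}$ and $\operatorname{Re}\langle s(x)v,v\rangle\ge\nu|v|^2$ for all $v\in\mathbb C^{n}$. Let $\operatorname{grad}:[H^1(\mathbb R^d)]^n\subseteq[L^2(\mathbb R^d)]^n\to[L^2(\mathbb R^d)]^{n\times d}$, $(\operatorname{grad}u)_{ij}=\partial_ju_i$, and $\operatorname{div}=-\operatorname{grad}^*$; the operators below carry their natural domains. Let $H^1_\#(Y)$ be the closure in $H^1(Y)$ of the smooth $\mathbb Z^d$-periodic functions. For all $r\in\{1,\dots,n\}$ and $q\in\{1,\dots,d\}$ there is exactly one $N^{(rq)}\in[H^1_\#(Y)]^n$ with $\int_YN^{(rq)}=0$ such that $$\int_Y\big\langle a\,(\nabla N^{(rq)}+e_r\otimes e_q),\nabla\phi\big\rangle\,dy=0\qquad\text{for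 all }\phi\in[H^1_\#(Y)]^n\text{ with }\int_Y\phi=0 .$$ Define the constant linear maps $a^{\rm hom}(0)\in L(\mathbb C^{n\times d})$ and $\mathrm m(s)\in L(\mathbb C^n)$ by $$a^{\rm hom}(0)\,(e_r\otimes e_q)=\int_Ya(y)\big(\nabla N^{(rq)}(y)+e_r\otimes e_q\big)\,dy,\qquad \mathrm m(s)=\int_Ys(y)\,dy .$$ Then $a^{\rm hom}(0)$ and $\mathrm m(s)$ are again coercive, the operator $-\operatorname{div}a^{\rm hom}(0)\operatorname{grad}+\mathrm m(s)$ and, for every $\varepsilon>0$, the operator $-\operatorname{div}a(\cdot/\varepsilon)\operatorname{grad}+s(\cdot/\varepsilon)$ have bounded everywhere defined inverses on $[L^2(\mathbb R^d)]^n$, and there is a constant $\kappa>0$ such that for all $\varepsilon>0$ $$\Big\|\big(-\operatorname{div}a(\tfrac{\cdot}{\varepsilon})\operatorname{grad}+s(\tfrac{\cdot}{\varepsilon})\big)^{-1}-\big(-\operatorname{div}a^{\rm hom}(0)\operatorname{grad}+\mathrm m(s)\big)^{-1}\Big\|\le\kappa\,\varepsilon .$$ -/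

import Mathlib

open MeasureTheory
open scoped ContDiff

noncomputable section

namespace FibreHom

/-- Euclidean space `ℝ^d`. -/
abbrev Space (d : ℕ) : Type := EuclideanSpace ℝ (Fin d)

/-- `ℂ^n` with its Hermitian norm. -/
abbrev Vec (n : ℕ) : Type := EuclideanSpace ℂ (Fin n)

/-- `ℂ^(n × d)` with the Frobenius inner product. -/
abbrev Mat (n d : ℕ) : Type := EuclideanSpace ℂ (Fin n × Fin d)

/-- The `j`-th Euclidean basis vector of `ℝ^d`. -/
def basisVec {d : ℕ} (j : Fin d) : Space d := EuclideanSpace.single j 1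

/-- The lattice point of `ℝ^d` with integer coordinates `k`. -/
def latticePt {d : ℕ} (k : Fin d → ℤ) : Space d := WithLp.toLp 2 fun i => (k i : ℝ)

/-- The open unit cell `Y = (0,1)^d`. -/
def cell (d : ℕ) : Set (Space d) := {y | ∀ i, 0 < y i ∧ y i < 1}

/-- Lebesgue measure on the unit cell. -/
abbrev cellMeasure (d : ℕ) : Measure (Space d) := (volume : Measure (Space d)).restrict (cell d)

/-- `[L²(ℝ^d)]^n`. -/
abbrev L2Vec (n d : ℕ) : Type := Lp (Vec n) 2 (volume : Measure (Space d))

/-- `[L²(ℝ^d)]^(n × d)`. -/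
abbrev L2Mat (n d : ℕ) : Type := Lp (Mat n d) 2 (volume : Measure (Space d))

/-- `[L²(Y)]^n`. -/
abbrev L2VecCell (n d : ℕ) : Type := Lp (Vec n) 2 (cellMeasure d)

/-- `[L²(Y)]^(n × d)`. -/
abbrev L2MatCell (n d : ℕ) : Type := Lp (Mat n d) 2 (cellMeasure d)

/-- The class of `ℤ^d`-periodic functions in `L^∞(ℝ^d; L(V))` whose real part is bounded below by
some `ν > 0`. With `V = Mat n d` these are the coefficients `a`, with `V = Vec n` the
coefficients `s`. The form `Re ⟨a v, v⟩` is the quadratic form of `(a + a*) / 2`. -/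
structure IsPeriodicCoercive {d : ℕ} {V : Type} [NormedAddCommGroup V] [InnerProductSpace ℂ V]
    (a : Space d → V →L[ℂ] V) : Prop where
  memLp_top : MemLp a ⊤ (volume : Measure (Space d))
  periodic : ∀ k : Fin d → ℤ, ∀ᵐ x : Space d, a (x + latticePt k) = a x
  coercive : ∃ ν : ℝ, 0 < ν ∧ ∀ᵐ x : Space d, ∀ v : V, ν * ‖v‖ ^ 2 ≤ (inner ℂ v (a x v)).re

/-! The operators on the whole space. -/

/-- `g` is the weak gradient of `u`: the entry `(i, j)` of `g` is the weak derivative `∂_j u_i`. -/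
def IsWeakGrad {n d : ℕ} (u : L2Vec n d) (g : L2Mat n d) : Prop :=
  ∀ φ : Space d → ℝ, ContDiff ℝ ∞ φ → HasCompactSupport φ → ∀ (i : Fin n) (j : Fin d),
    ∫ x, fderiv ℝ φ x (basisVec j) • u x i = -∫ x, φ x • g x (i, j)

theorem locallyIntegrable_coord {d : ℕ} {ι : Type} [Fintype ι]
    (f : Lp (EuclideanSpace ℂ ι) 2 (volume : Measure (Space d))) (i : ι) :
    LocallyIntegrable (fun x => f x i) volume :=
  ((EuclideanSpace.proj i : EuclideanSpace ℂ ι →L[ℂ] ℂ).comp_memLp' (Lp.memLp f)).locallyIntegrable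
    (by norm_num)

theorem integrable_smul_coord {d : ℕ} {ι : Type} [Fintype ι] {φ : Space d → ℝ}
    (hφ : Continuous φ) (hc : HasCompactSupport φ)
    (f : Lp (EuclideanSpace ℂ ι) 2 (volume : Measure (Space d))) (i : ι) :
    Integrable (fun x => φ x • f x i) volume :=
  (locallyIntegrable_coord f i).integrable_smul_left_of_hasCompactSupport hφ hc

theorem integral_smul_coord_add {d : ℕ} {ι : Type} [Fintype ι] {φ : Space d → ℝ}
    (hφ : Continuous φ) (hc : HasCompactSupport φ)
    (f g : Lp (EuclideanSpace ℂ ι) 2 (volume : Measure (Space d))) (i : ι) :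
    ∫ x, φ x • (f + g) x i = (∫ x, φ x • f x i) + ∫ x, φ x • g x i := by
  rw [← integral_add (integrable_smul_coord hφ hc f i) (integrable_smul_coord hφ hc g i)]
  refine integral_congr_ae ?_
  filter_upwards [Lp.coeFn_add f g] with x hx
  simp only [hx, Pi.add_apply, PiLp.add_apply, smul_add]

theorem integral_smul_coord_smul {d : ℕ} {ι : Type} [Fintype ι] (φ : Space d → ℝ) (c : ℂ)
    (f : Lp (EuclideanSpace ℂ ι) 2 (volume : Measure (Space d))) (i : ι) :
    ∫ x, φ x • (c • f) x i = c * ∫ x, φ x • f x i := by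
  rw [← integral_const_mul]
  refine integral_congr_ae ?_
  filter_upwards [Lp.coeFn_smul c f] with x hx
  simp only [hx, Pi.smul_apply, PiLp.smul_apply, smul_eq_mul, Complex.real_smul]
  ring

theorem continuous_partial {d : ℕ} {φ : Space d → ℝ} (h : ContDiff ℝ ∞ φ) (j : Fin d) :
    Continuous fun x => fderiv ℝ φ x (basisVec j) :=
  (h.continuous_fderiv (by simp)).clm_apply continuous_const

/-- The graph of the weak gradient. -/
def gradGraph (n d : ℕ) : Submodule ℂ (L2Vec n d × L2Mat n d) where
  carrier := {p | IsWeakGrad p.1 p.2}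
  zero_mem' := by
    intro φ _ _ i j
    have h1 := integral_smul_coord_smul (fun x => fderiv ℝ φ x (basisVec j)) 0 (0 : L2Vec n d) i
    have h2 := integral_smul_coord_smul φ 0 (0 : L2Mat n d) (i, j)
    rw [zero_smul, zero_mul] at h1 h2
    simpa only [Prod.fst_zero, Prod.snd_zero, h2, neg_zero] using h1
  add_mem' := by
    intro p q hp hq φ h hc i j
    have hd : HasCompactSupport fun x => fderiv ℝ φ x (basisVec j) :=
      hc.fderiv_apply ℝ (basisVec j)
    rw [Prod.fst_add, Prod.snd_add, integral_smul_coord_add (continuous_partial h j) hd,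
      integral_smul_coord_add h.continuous hc, hp φ h hc i j, hq φ h hc i j]
    ring
  smul_mem' := by
    intro c p hp φ h hc i j
    rw [Prod.smul_fst, Prod.smul_snd,
      integral_smul_coord_smul (fun x => fderiv ℝ φ x (basisVec j)),
      integral_smul_coord_smul, hp φ h hc i j]
    ring

/-- Weak gradients are unique. -/
theorem gradGraph_functional {n d : ℕ} (p : L2Vec n d × L2Mat n d) (hp : p ∈ gradGraph n d)
    (h0 : p.1 = 0) : p.2 = 0 := by
  have key : ∀ ij : Fin n × Fin d, ∀ᵐ x : Space d, p.2 x ij = 0 := by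
    rintro ⟨i, j⟩
    refine ae_eq_zero_of_integral_contDiff_smul_eq_zero (locallyIntegrable_coord p.2 (i, j)) ?_
    intro φ h hc
    have h1 := hp φ h hc i j
    have h2 := integral_smul_coord_smul (fun x => fderiv ℝ φ x (basisVec j)) 0 (0 : L2Vec n d) i
    rw [zero_smul, zero_mul] at h2
    rw [h0, h2] at h1
    exact neg_eq_zero.mp h1.symm
  rw [Lp.eq_zero_iff_ae_eq_zero]
  filter_upwards [ae_all_iff.mpr key] with x hx
  ext ij
  exact hx ij

/-- `grad : [H¹(ℝ^d)]^n ⊆ [L²(ℝ^d)]^n → [L²(ℝ^d)]^(n × d)`, with domain `[H¹(ℝ^d)]^n`. -/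
def gradOp (n d : ℕ) : L2Vec n d →ₗ.[ℂ] L2Mat n d := (gradGraph n d).toLinearPMap

/-- The graph of `gradOp` consists exactly of the pairs `(u, g)` with weak gradient `g` of `u`. -/
theorem mem_graph_gradOp {n d : ℕ} (u : L2Vec n d) (g : L2Mat n d) :
    (u, g) ∈ (gradOp n d).graph ↔ IsWeakGrad u g := by
  rw [gradOp, Submodule.toLinearPMap_graph_eq _ gradGraph_functional]
  rfl

/-- `div = -grad*`. -/
def divOp (n d : ℕ) : L2Mat n d →ₗ.[ℂ] L2Vec n d := -(gradOp n d).adjoint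

/-- The maximal domain `{g ∈ L² : A g ∈ L²}` of the operator of multiplication by `A`. -/
def mulDomain {d : ℕ} {V : Type} [NormedAddCommGroup V] [NormedSpace ℂ V]
    (A : Space d → V →L[ℂ] V) : Submodule ℂ (Lp V 2 (volume : Measure (Space d))) where
  carrier := {g | MemLp (fun x => A x (g x)) 2 volume}
  zero_mem' := by
    refine (memLp_congr_ae ?_).mpr (MemLp.zero (ε := V) (p := 2) (μ := volume))
    filter_upwards [Lp.coeFn_zero V 2 (volume : Measure (Space d))] with x hx
    simp only [hx, Pi.zero_apply, map_zero]
  add_mem' := by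
    intro f g hf hg
    refine (memLp_congr_ae ?_).mpr (MemLp.add hf hg)
    filter_upwards [Lp.coeFn_add f g] with x hx
    simp only [hx, Pi.add_apply, map_add]
  smul_mem' := by
    intro c f hf
    refine (memLp_congr_ae ?_).mpr (MemLp.const_smul hf c)
    filter_upwards [Lp.coeFn_smul c f] with x hx
    simp only [hx, Pi.smul_apply, map_smul]

theorem memLp_of_mem_mulDomain {d : ℕ} {V : Type} [NormedAddCommGroup V] [NormedSpace ℂ V]
    {A : Space d → V →L[ℂ] V} (g : mulDomain A) :
    MemLp (fun x => A x ((g : Lp V 2 (volume : Measure (Space d))) x)) 2 volume :=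
  g.2

/-- The maximal operator of multiplication by `A`. Its domain is everything when `A` is measurable
and essentially bounded. -/
def mulOp {d : ℕ} {V : Type} [NormedAddCommGroup V] [NormedSpace ℂ V]
    (A : Space d → V →L[ℂ] V) :
    Lp V 2 (volume : Measure (Space d)) →ₗ.[ℂ] Lp V 2 (volume : Measure (Space d)) where
  domain := mulDomain A
  toFun :=
    { toFun := fun g => (memLp_of_mem_mulDomain g).toLp
      map_add' := by
        intro f g
        refine Lp.ext ?_
        filter_upwards [Lp.coeFn_add (f : Lp V 2 (volume : Measure (Space d))) g,
          Lp.coeFn_add (memLp_of_mem_mulDomain f).toLp (memLp_of_mem_mulDomain g).toLp,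
          (memLp_of_mem_mulDomain f).coeFn_toLp, (memLp_of_mem_mulDomain g).coeFn_toLp,
          (memLp_of_mem_mulDomain (f + g)).coeFn_toLp] with x h1 h2 h3 h4 h5
        rw [h5, h2, Pi.add_apply, h3, h4, Submodule.coe_add, h1, Pi.add_apply, map_add]
      map_smul' := by
        intro c f
        refine Lp.ext ?_
        filter_upwards [Lp.coeFn_smul c (f : Lp V 2 (volume : Measure (Space d))),
          Lp.coeFn_smul c (memLp_of_mem_mulDomain f).toLp,
          (memLp_of_mem_mulDomain f).coeFn_toLp,
          (memLp_of_mem_mulDomain (c • f)).coeFn_toLp] with x h1 h2 h3 h4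
        rw [h4, RingHom.id_apply, h2, Pi.smul_apply, h3, Submodule.coe_smul, h1, Pi.smul_apply,
          map_smul] }

/-- Composition `g ∘ f` of unbounded operators, with domain `{x ∈ dom f : f x ∈ dom g}`. -/
def pcomp {E F G : Type} [AddCommGroup E] [Module ℂ E] [AddCommGroup F] [Module ℂ F]
    [AddCommGroup G] [Module ℂ G] (g : F →ₗ.[ℂ] G) (f : E →ₗ.[ℂ] F) : E →ₗ.[ℂ] G :=
  g.comp (f.domRestrict ((g.domain.comap f.toFun).map f.domain.subtype)) (by
    rintro ⟨x, hx⟩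
    obtain ⟨z, hz, hzx⟩ := hx.1
    have h := LinearPMap.domRestrict_apply (f := f) (x := ⟨x, hx⟩) (y := z) hzx.symm
    exact h ▸ hz)

/-- The unbounded operator `-div A grad + S` on `[L²(ℝ^d)]^n`, with its natural domain. -/
def ellipticOp {n d : ℕ} (A : Space d → Mat n d →L[ℂ] Mat n d) (S : Space d → Vec n →L[ℂ] Vec n) :
    L2Vec n d →ₗ.[ℂ] L2Vec n d :=
  -pcomp (divOp n d) (pcomp (mulOp A) (gradOp n d)) + mulOp S

/-- The bounded, everywhere defined operator `R` is the two-sided inverse of the unbounded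
operator `T`. -/
def IsBoundedInverse {H : Type} [NormedAddCommGroup H] [NormedSpace ℂ H]
    (T : H →ₗ.[ℂ] H) (R : H →L[ℂ] H) : Prop :=
  (∀ f : H, ∃ h : R f ∈ T.domain, T ⟨R f, h⟩ = f) ∧ ∀ u : T.domain, R (T u) = u

/-! The homogenised coefficients. -/

/-- The plane wave `y ↦ exp (i θ · y)`. -/
def planeWave {d : ℕ} (θ y : Space d) : ℂ := Complex.exp (Complex.I * (inner ℝ θ y : ℝ))

/-- The classical gradient `(∂_j φ_i)` of a differentiable function. -/
def classicalGrad {n d : ℕ} (φ : Space d → Vec n) (y : Space d) : Mat n d :=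
  WithLp.toLp 2 fun ij => fderiv ℝ φ y (basisVec ij.2) ij.1

/-- The pairs `(φ, ∇φ)` restricted to `Y`, for smooth `θ`-quasi-periodic `φ`. -/
def smoothQuasiPeriodicPairs (n : ℕ) {d : ℕ} (θ : Space d) :
    Set (L2VecCell n d × L2MatCell n d) :=
  {p | ∃ φ : Space d → Vec n, ContDiff ℝ ∞ φ ∧
    (∀ (k : Fin d → ℤ) (y : Space d), φ (y + latticePt k) = planeWave θ (latticePt k) • φ y) ∧
    p.1 =ᵐ[cellMeasure d] φ ∧ p.2 =ᵐ[cellMeasure d] classicalGrad φ}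

/-- The pairs `(u, grad_θ u)` with `u ∈ [H¹_θ(Y)]^n`, where `H¹_θ(Y)` is the closure of the smooth
`θ`-quasi-periodic functions in the `H¹(Y)` norm, that is, in the norm of `(u, ∇u)` in `L²(Y)`. -/
def quasiPeriodicH1 (n : ℕ) {d : ℕ} (θ : Space d) : Set (L2VecCell n d × L2MatCell n d) :=
  closure (smoothQuasiPeriodicPairs n θ)

/-- The pairs `(u, grad_θ u)` with `u ∈ [H¹_θ(Y) ⟂ exp (i θ ·)]^n`. -/
def quasiPeriodicH1Perp (n : ℕ) {d : ℕ} (θ : Space d) : Set (L2VecCell n d × L2MatCell n d) :=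
  {p | p ∈ quasiPeriodicH1 n θ ∧ ∀ i : Fin n,
    ∫ y in cell d, star (planeWave θ y) * p.1 y i = 0}

/-- The matrix `e_r ⊗ e_s`, for `rs = (r, s)`. -/
def unitMat {n d : ℕ} (rs : Fin n × Fin d) : Mat n d := EuclideanSpace.single rs 1

/-- The field `G + exp (i θ ·) e_r ⊗ e_s`. -/
def correctedField {n d : ℕ} (θ : Space d) (rs : Fin n × Fin d) (G : L2MatCell n d)
    (y : Space d) : Mat n d :=
  G y + planeWave θ y • unitMat rs

/-- `p = (N, grad_θ N)` where `N ∈ [H¹_θ(Y) ⟂ exp (i θ ·)]^n` solves the cell problem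
`⟨a (grad_θ N + exp (i θ ·) e_r ⊗ e_s), grad_θ φ⟩ = 0` for all `φ ∈ [H¹_θ(Y) ⟂ exp (i θ ·)]^n`. -/
def IsCellSolution {n d : ℕ} (a : Space d → Mat n d →L[ℂ] Mat n d) (θ : Space d)
    (rs : Fin n × Fin d) (p : L2VecCell n d × L2MatCell n d) : Prop :=
  p ∈ quasiPeriodicH1Perp n θ ∧ ∀ q ∈ quasiPeriodicH1Perp n θ,
    ∫ y in cell d, inner ℂ (q.2 y) (a y (correctedField θ rs p.2 y)) = 0

/-- The solution of the cell problem (meaningful when it exists and is unique). -/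
def cellSolution {n d : ℕ} (a : Space d → Mat n d →L[ℂ] Mat n d) (θ : Space d)
    (rs : Fin n × Fin d) : L2VecCell n d × L2MatCell n d :=
  Classical.epsilon (IsCellSolution a θ rs)

/-- The fibre-homogenised tensor `a^hom(θ)`, acting on `ℂ^(n × d)`. Its matrix entry with output
index `ij` and input index `rs` is the `ij` entry of
`∫_Y a (grad_θ N^(rs) + exp (i θ ·) e_r ⊗ e_s) exp (-i θ ·)`. -/
def aHom {n d : ℕ} (a : Space d → Mat n d →L[ℂ] Mat n d) (θ : Space d) :
    Mat n d →L[ℂ] Mat n d :=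
  Matrix.toEuclideanCLM (n := Fin n × Fin d) (𝕜 := ℂ) (Matrix.of fun ij rs =>
    ∫ y in cell d,
      a y (correctedField θ rs (cellSolution a θ rs).2 y) ij * star (planeWave θ y))

/-- The mean `m(s) = ∫_Y s`, with entries `∫_Y s_ij`. -/
def cellMean {n d : ℕ} (s : Space d → Vec n →L[ℂ] Vec n) : Vec n →L[ℂ] Vec n :=
  Matrix.toEuclideanCLM (n := Fin n) (𝕜 := ℂ) (Matrix.of fun i j =>
    ∫ y in cell d, s y (EuclideanSpace.single j 1) i)

end FibreHom

end

open MeasureTheory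
open scoped ContDiff

noncomputable section

namespace FibreHom

section

/-! ### The Lax–Milgram lemma on a closed subspace -/

/-! The proof is a two-scale expansion made rigorous by smoothing. If `u₀` solves the homogenised
problem and `p = ∇u₀`, the formal expansion is `u_ε ≈ u₀ + ε ∑ p_rq N^(rq)(x/ε)`. For systems with
merely bounded coefficients the correctors `N^(rq)` need not be bounded, so the products `p_rq
N^(rq)(x/ε)` need not lie in `L²`.

The remedy is to mollify the slow factor with a smooth kernel `k` at scale `ε` whose `ε
ℤ^d`-periodisation is constant (`OscKernel`). For periodic `F` this gives exactly `∫ k(x - y) F(x/ε)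
dx = ∫_Y F`, for every `y`. Two consequences carry the argument. First, `‖(k * f) G(x/ε)‖ ≤ ‖f‖ ‖G‖`
for every `G` in `L²(Y)` (`lintegral_mul_moll_le`, `norm_oscMul_le`), so all products make sense.
Second, if `h` has mean zero, then pairing `(k * q) h(x/ε)` with `z` costs only differences `z(x) -
z(y)` over distances of order `ε`, hence is `O(ε) ‖q‖ ‖h‖ ‖∇z‖` (`norm_inner_oscMul_le`).

Smoothing `p` changes it by `O(ε) ‖f‖` because translates of `p` depend on the shift in a Lipschitz
way: the homogenised problem commutes with translations, so second differences of `u₀` are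
admissible test functions (`IsWeakSolution.norm_translate_sub_le`).

Inserting the smoothed expansion into the equation leaves a residual with three kinds of terms
(`flux_sub_eq`, `potential_sub_eq`): smoothing errors; terms carrying an explicit factor `ε` from
differentiating the slow factor; and slow factors times the mean-free oscillations `a (∇N + E) -
a^hom E` and `s v - m(s) v`. The second of these oscillations is directly of the type just
described. The first is paired with `∇z`, but by the cell problem it is orthogonal to all periodic
gradients, which unfolds to the whole space and moves the derivative onto the slow factor
(`inner_oscMul_flux`); it is then again a mean-free function paired with `z`. No flux potential is
needed. So the residual is `O(ε) ‖f‖` in the dual of `H¹`, and coercivity of the oscillating problem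
bounds the error (`norm_sub_le_of_corrector`).

Solvability, for the two whole-space problems as for the cell problem, is the Lax–Milgram lemma; on
the cell it rests on the Poincaré inequality. Coercivity of `a^hom` follows from testing the cell
problem with its own solutions. -/

theorem eq_zero_of_coercive {H : Type*} [NormedAddCommGroup H] [InnerProductSpace ℂ H]
    {V : Submodule ℂ H} {B : H →L[ℂ] H} {c : ℝ} (hc : 0 < c)
    (hB : ∀ x ∈ V, c * ‖x‖ ^ 2 ≤ (inner ℂ x (B x)).re) {x : H} (hx : x ∈ V)
    (h0 : ∀ y ∈ V, inner ℂ y (B x) = 0) : x = 0 := by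
  have h := hB x hx
  rw [h0 x hx, Complex.zero_re] at h
  have h2 : ‖x‖ ^ 2 ≤ 0 := by nlinarith [sq_nonneg ‖x‖]
  have h3 : ‖x‖ ^ 2 = 0 := le_antisymm h2 (sq_nonneg _)
  exact norm_eq_zero.mp (pow_eq_zero_iff (two_ne_zero) |>.mp h3)

/-- Coercivity is demanded only on `V`, since the form of the cell problem controls only gradients
and is coercive by virtue of the Poincaré inequality on the subspace. The compression of `B` to `V`
is bounded below, hence injective with closed range, and a vector of `V` orthogonal to the range
vanishes by coercivity. -/
theorem exists_laxMilgram {H : Type*} [NormedAddCommGroup H] [InnerProductSpace ℂ H]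
    [CompleteSpace H] (V : Submodule ℂ H) (hV : IsClosed (V : Set H)) (B : H →L[ℂ] H) {c : ℝ}
    (hc : 0 < c) (hB : ∀ x ∈ V, c * ‖x‖ ^ 2 ≤ (inner ℂ x (B x)).re) :
    ∃ S : H →L[ℂ] H, ∀ F, S F ∈ V ∧ ∀ y ∈ V, inner ℂ y (B (S F)) = inner ℂ y F := by
  have : CompleteSpace V := hV.completeSpace_coe
  set T : V →L[ℂ] V := V.orthogonalProjectionOnto ∘L B ∘L V.subtypeL with hT
  have hin : ∀ x y : V, inner ℂ y (T x) = inner ℂ (y : H) (B x) := by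
    intro x y
    rw [hT]
    simp only [ContinuousLinearMap.comp_apply, Submodule.subtypeL_apply]
    rw [Submodule.coe_inner]
    change inner ℂ (y : H) (V.starProjection (B x)) = _
    rw [← Submodule.inner_starProjection_left_eq_right,
      Submodule.starProjection_eq_self_iff.mpr y.2]
  have hbd : ∀ x : V, c * ‖x‖ ≤ ‖T x‖ := by
    intro x
    by_cases hx : ‖x‖ = 0
    · rw [hx]; simp
    have hx' : 0 < ‖x‖ := lt_of_le_of_ne (norm_nonneg _) (Ne.symm hx)
    have h1 := hB x x.2
    rw [← hin x x] at h1
    have h2 : (inner ℂ x (T x)).re ≤ ‖x‖ * ‖T x‖ := re_inner_le_norm (𝕜 := ℂ) x (T x)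
    have h3 : ‖(x : H)‖ = ‖x‖ := rfl
    rw [h3] at h1
    nlinarith
  have hanti : AntilipschitzWith (c⁻¹).toNNReal T := by
    refine ContinuousLinearMap.antilipschitz_of_bound T fun x => ?_
    rw [Real.coe_toNNReal _ (inv_pos.mpr hc).le, inv_mul_eq_div, le_div_iff₀ hc]
    linarith [hbd x]
  have hker : T.ker = ⊥ := LinearMap.ker_eq_bot.mpr hanti.injective
  have hcl : IsClosed (T.range : Set V) := hanti.isClosed_range T.uniformContinuous
  have hrange : T.range = ⊤ := by
    have := hcl.completeSpace_coe
    rw [← T.range.orthogonal_orthogonal, Submodule.eq_top_iff']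
    intro v w hw
    have hw0 : (w : H) = 0 := by
      have h1 := hB w w.2
      rw [← hin w w, ← inner_conj_symm, hw (T w) ⟨w, rfl⟩] at h1
      have h2 : ‖(w : H)‖ ^ 2 ≤ 0 := by
        simp only [map_zero, Complex.zero_re] at h1
        nlinarith [sq_nonneg ‖(w : H)‖]
      exact norm_eq_zero.mp ((pow_eq_zero_iff two_ne_zero).mp (le_antisymm h2 (sq_nonneg _)))
    rw [show w = 0 from Subtype.ext hw0, inner_zero_left]
  let e : V ≃L[ℂ] V := ContinuousLinearEquiv.ofBijective T hker hrange
  -- Projecting `F` onto `V` does not change its pairings with elements of `V`, so `F` itself may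
  -- stand on the right-hand side.
  refine ⟨V.subtypeL ∘L (e.symm : V →L[ℂ] V) ∘L V.orthogonalProjectionOnto, fun F => ⟨?_, ?_⟩⟩
  · exact (e.symm (V.orthogonalProjectionOnto F)).2
  · intro y hy
    have h1 := hin (e.symm (V.orthogonalProjectionOnto F)) ⟨y, hy⟩
    have h2 : T (e.symm (V.orthogonalProjectionOnto F)) = V.orthogonalProjectionOnto F :=
      e.apply_symm_apply _
    rw [h2] at h1
    simp only [ContinuousLinearMap.comp_apply, Submodule.subtypeL_apply]
    refine h1.symm.trans ?_
    rw [Submodule.coe_inner]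
    change inner ℂ y (V.starProjection F) = _
    rw [← Submodule.inner_starProjection_left_eq_right,
      Submodule.starProjection_eq_self_iff.mpr hy]

/-! ### Multiplication by bounded coefficients -/

section Mul

variable {α : Type} [MeasurableSpace α] {μ : Measure α} {V : Type} [NormedAddCommGroup V]
  [InnerProductSpace ℂ V]

/-- Multiplication by an essentially bounded coefficient, as a bounded operator on `L²`. -/
def mulCLM (A : α → V →L[ℂ] V) (hA : MemLp A ⊤ μ) : Lp V 2 μ →L[ℂ] Lp V 2 μ :=
  (ContinuousLinearMap.id ℂ (V →L[ℂ] V)).holderL μ ⊤ 2 2 (hA.toLp A)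

theorem coeFn_mulCLM (A : α → V →L[ℂ] V) (hA : MemLp A ⊤ μ) (g : Lp V 2 μ) :
    mulCLM A hA g =ᵐ[μ] fun x => A x (g x) := by
  have h := (ContinuousLinearMap.id ℂ (V →L[ℂ] V)).coeFn_holder (r := 2) (hA.toLp A) g
  filter_upwards [h, hA.coeFn_toLp] with x h1 h2
  change ((ContinuousLinearMap.id ℂ (V →L[ℂ] V)).holder 2 (hA.toLp A) g : α → V) x = _
  rw [h1, h2]
  rfl

theorem norm_mulCLM_le (A : α → V →L[ℂ] V) (hA : MemLp A ⊤ μ) (g : Lp V 2 μ) :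
    ‖mulCLM A hA g‖ ≤ (eLpNorm A ⊤ μ).toReal * ‖g‖ := by
  have h := (ContinuousLinearMap.id ℂ (V →L[ℂ] V)).norm_holder_apply_apply_le (r := 2)
    (hA.toLp A) g
  refine h.trans ?_
  rw [Lp.norm_toLp]
  gcongr
  calc _ ≤ 1 * (eLpNorm A ⊤ μ).toReal := by
        gcongr; exact ContinuousLinearMap.norm_id_le
    _ = _ := one_mul _

theorem memLp_mul_apply {A : α → V →L[ℂ] V} (hA : MemLp A ⊤ μ) {g : α → V} (hg : MemLp g 2 μ) :
    MemLp (fun x => A x (g x)) 2 μ := by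
  refine (memLp_congr_ae ?_).mp (Lp.memLp (mulCLM A hA (hg.toLp g)))
  filter_upwards [coeFn_mulCLM A hA (hg.toLp g), hg.coeFn_toLp] with x h1 h2
  rw [h1, h2]

theorem re_inner_mulCLM_ge (A : α → V →L[ℂ] V) (hA : MemLp A ⊤ μ) {ν : ℝ}
    (hν : ∀ᵐ x ∂μ, ∀ v : V, ν * ‖v‖ ^ 2 ≤ (inner ℂ v (A x v)).re) (g : Lp V 2 μ) :
    ν * ‖g‖ ^ 2 ≤ (inner ℂ g (mulCLM A hA g)).re := by
  have h1 : (‖g‖ : ℝ) ^ 2 = (inner ℂ g g).re := by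
    rw [inner_self_eq_norm_sq_to_K]; norm_cast
  rw [h1, L2.inner_def, L2.inner_def]
  change ν * RCLike.re (∫ a, inner ℂ (g a) (g a) ∂μ) ≤
    RCLike.re (∫ a, inner ℂ (g a) (mulCLM A hA g a) ∂μ)
  rw [← integral_re (L2.integrable_inner g g), ← integral_re (L2.integrable_inner g _),
    ← integral_const_mul]
  refine integral_mono_ae ((L2.integrable_inner (𝕜 := ℂ) g g).re.const_mul ν)
    (L2.integrable_inner (𝕜 := ℂ) g _).re ?_
  filter_upwards [hν, coeFn_mulCLM A hA g] with x h1 h2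
  rw [h2]
  refine le_trans (le_of_eq ?_) (h1 (g x))
  rw [inner_self_eq_norm_sq_to_K]
  norm_cast

end Mul

end

section

/-! ### Weak form of the elliptic operators -/

theorem pcomp_eq_iff {E F G : Type} [AddCommGroup E] [Module ℂ E] [AddCommGroup F] [Module ℂ F]
    [AddCommGroup G] [Module ℂ G] (g : F →ₗ.[ℂ] G) (f : E →ₗ.[ℂ] F) (x : E) (z : G) :
    (∃ h : x ∈ (pcomp g f).domain, pcomp g f ⟨x, h⟩ = z) ↔
      ∃ y, (∃ h : x ∈ f.domain, f ⟨x, h⟩ = y) ∧ ∃ h : y ∈ g.domain, g ⟨y, h⟩ = z := by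
  constructor
  · rintro ⟨hx, rfl⟩
    obtain ⟨w, hw, hwx⟩ := hx.1
    obtain rfl : (w : E) = x := hwx
    exact ⟨f w, ⟨w.2, rfl⟩, hw, rfl⟩
  · rintro ⟨y, ⟨h, rfl⟩, hg, rfl⟩
    exact ⟨⟨⟨⟨x, h⟩, hg, rfl⟩, h⟩, rfl⟩

theorem neg_add_eq_iff {E F : Type} [AddCommGroup E] [Module ℂ E] [AddCommGroup F] [Module ℂ F]
    (S T : E →ₗ.[ℂ] F) (x : E) (z : F) :
    (∃ h : x ∈ (-S + T).domain, (-S + T) ⟨x, h⟩ = z) ↔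
      ∃ y w, (∃ h : x ∈ S.domain, S ⟨x, h⟩ = y) ∧ (∃ h : x ∈ T.domain, T ⟨x, h⟩ = w) ∧
        -y + w = z := by
  constructor
  · rintro ⟨hx, rfl⟩
    exact ⟨S ⟨x, hx.1⟩, T ⟨x, hx.2⟩, ⟨hx.1, rfl⟩, ⟨hx.2, rfl⟩, rfl⟩
  · rintro ⟨y, w, ⟨h, rfl⟩, ⟨h', rfl⟩, rfl⟩
    exact ⟨⟨h, h'⟩, rfl⟩

variable {n d : ℕ}

theorem isWeakGrad_of_contDiff {u : L2Vec n d} {g : L2Mat n d} {ψ : Space d → Vec n}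
    (hψ : ContDiff ℝ 1 ψ) (hu : u =ᵐ[volume] ψ) (hg : g =ᵐ[volume] classicalGrad ψ) :
    IsWeakGrad u g := by
  intro φ hφ hc i j
  have hψi : ContDiff ℝ 1 fun x => ψ x i :=
    ((EuclideanSpace.proj i : Vec n →L[ℂ] ℂ).restrictScalars ℝ).contDiff.comp hψ
  have hd : ∀ x, fderiv ℝ (fun x => ψ x i) x (basisVec j) = classicalGrad ψ x (i, j) := by
    intro x
    have := ((((EuclideanSpace.proj i : Vec n →L[ℂ] ℂ).restrictScalars ℝ).hasFDerivAt).comp x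
      ((hψ.differentiable one_ne_zero) x).hasFDerivAt).fderiv
    change fderiv ℝ (fun x => ψ x i) x = _ at this
    rw [this]
    rfl
  have hcont : Continuous fun x => fderiv ℝ (fun x => ψ x i) x (basisVec j) :=
    (hψi.continuous_fderiv one_ne_zero).clm_apply continuous_const
  have h1 := integral_smul_fderiv_eq_neg_fderiv_smul_of_integrable (μ := (volume : Measure (Space d)))
    (f := φ) (g := fun x => ψ x i) (v := basisVec j) (𝕜 := ℝ)
    (((continuous_partial hφ j).smul hψi.continuous).integrable_of_hasCompactSupport
      ((hc.fderiv_apply ℝ (basisVec j)).smul_right))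
    ((hφ.continuous.smul hcont).integrable_of_hasCompactSupport hc.smul_right)
    ((hφ.continuous.smul hψi.continuous).integrable_of_hasCompactSupport hc.smul_right)
    (fun x _ => (hφ.differentiable (by simp)) x) (fun x _ => (hψi.differentiable one_ne_zero) x)
  have h2 : ∫ x, φ x • g x (i, j) = ∫ x, φ x • fderiv ℝ (fun x => ψ x i) x (basisVec j) := by
    refine integral_congr_ae ?_
    filter_upwards [hg] with x hx
    rw [hx, hd]
  have h3 : ∫ x, fderiv ℝ φ x (basisVec j) • u x i =
      ∫ x, fderiv ℝ φ x (basisVec j) • ψ x i := by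
    refine integral_congr_ae ?_
    filter_upwards [hu] with x hx
    rw [hx]
  rw [h2, h3, h1, neg_neg]

theorem continuous_classicalGrad {ψ : Space d → Vec n} (hψ : ContDiff ℝ 1 ψ) :
    Continuous (classicalGrad ψ) := by
  refine (PiLp.continuous_toLp 2 _).comp (continuous_pi fun ij => ?_)
  exact ((EuclideanSpace.proj ij.1 : Vec n →L[ℂ] ℂ).continuous).comp
    ((hψ.continuous_fderiv one_ne_zero).clm_apply continuous_const)

theorem hasCompactSupport_classicalGrad {ψ : Space d → Vec n} (hc : HasCompactSupport ψ) :
    HasCompactSupport (classicalGrad ψ) := by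
  refine (hc.fderiv ℝ).mono fun x hx => ?_
  contrapose! hx
  simp only [Function.notMem_support] at hx ⊢
  ext ij
  simp [classicalGrad, hx]

theorem mem_domain_gradOp {u : L2Vec n d} : u ∈ (gradOp n d).domain ↔ ∃ g, IsWeakGrad u g := by
  simp_rw [← mem_graph_gradOp]
  exact LinearPMap.mem_domain_iff

theorem isWeakGrad_iff {u : L2Vec n d} {g : L2Mat n d} :
    IsWeakGrad u g ↔ ∃ h : u ∈ (gradOp n d).domain, gradOp n d ⟨u, h⟩ = g := by
  rw [← mem_graph_gradOp, LinearPMap.mem_graph_iff]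
  constructor
  · rintro ⟨y, hy, h⟩
    simp only at hy h
    subst hy
    exact ⟨y.2, h⟩
  · rintro ⟨h, h'⟩
    exact ⟨⟨u, h⟩, rfl, h'⟩

/-- Density is what allows the adjoint, and with it `divOp`, to be identified by its duality
relation. -/
theorem dense_domain_gradOp : Dense ((gradOp n d).domain : Set (L2Vec n d)) := by
  refine (Lp.dense_hasCompactSupport_contDiff (F := Vec n)
    (μ := (volume : Measure (Space d))) (p := 2) (by norm_num)).mono ?_
  rintro u ⟨ψ, hu, hc, hψ⟩
  have h1 : ContDiff ℝ 1 ψ := hψ.of_le (by simp)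
  have hm : MemLp (classicalGrad ψ) 2 (volume : Measure (Space d)) :=
    (continuous_classicalGrad h1).memLp_of_hasCompactSupport (hasCompactSupport_classicalGrad hc)
  exact mem_domain_gradOp.mpr ⟨hm.toLp _, isWeakGrad_of_contDiff h1 hu hm.coeFn_toLp⟩

theorem mem_domain_divOp_iff {w : L2Mat n d} {v : L2Vec n d} :
    (∃ h : w ∈ (divOp n d).domain, divOp n d ⟨w, h⟩ = v) ↔
      ∀ φ Φ, IsWeakGrad φ Φ → inner ℂ Φ w = -inner ℂ φ v := by
  constructor
  · rintro ⟨h, hv⟩ φ Φ hφ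
    obtain ⟨hd, rfl⟩ := isWeakGrad_iff.mp hφ
    have h1 : w ∈ (gradOp n d).adjoint.domain := h
    have h2 := (LinearPMap.adjoint_isFormalAdjoint (dense_domain_gradOp (n := n) (d := d)))
      ⟨w, h1⟩ ⟨φ, hd⟩
    have h3 : v = -(gradOp n d).adjoint ⟨w, h1⟩ := hv.symm
    have h4 := congrArg (starRingEnd ℂ) h2
    rw [inner_conj_symm, inner_conj_symm] at h4
    rw [h3, inner_neg_right, neg_neg]
    exact h4.symm
  · intro h
    have hx : ∀ x : (gradOp n d).domain,
        inner ℂ (-v) (x : L2Vec n d) = inner ℂ w (gradOp n d x) := by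
      intro x
      have h1 := h x (gradOp n d x) (isWeakGrad_iff.mpr ⟨x.2, rfl⟩)
      have h4 := congrArg (starRingEnd ℂ) h1
      rw [map_neg, inner_conj_symm, inner_conj_symm] at h4
      rw [inner_neg_left, h4]
    have h1 : w ∈ (gradOp n d).adjoint.domain :=
      LinearPMap.mem_adjoint_domain_of_exists _ ⟨-v, hx⟩
    refine ⟨h1, ?_⟩
    have h2 := LinearPMap.adjoint_apply_eq (dense_domain_gradOp (n := n) (d := d)) ⟨w, h1⟩ hx
    change -(gradOp n d).adjoint ⟨w, h1⟩ = v
    rw [h2, neg_neg]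

theorem mulOp_eq_iff {V : Type} [NormedAddCommGroup V] [InnerProductSpace ℂ V]
    {A : Space d → V →L[ℂ] V} (hA : MemLp A ⊤ (volume : Measure (Space d)))
    (g w : Lp V 2 (volume : Measure (Space d))) :
    (∃ h : g ∈ (mulOp A).domain, mulOp A ⟨g, h⟩ = w) ↔ mulCLM A hA g = w := by
  have h : g ∈ (mulOp A).domain := memLp_mul_apply hA (Lp.memLp g)
  have he : mulOp A ⟨g, h⟩ = mulCLM A hA g := by
    refine Lp.ext ?_
    filter_upwards [coeFn_mulCLM A hA g,
      (memLp_of_mem_mulDomain (A := A) ⟨g, h⟩).coeFn_toLp] with x h1 h2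
    rw [h1]
    exact h2
  rw [← he]
  exact ⟨fun h => h.2, fun h' => ⟨h, h'⟩⟩

/-- `u` is a weak solution of `-div A grad u + S u = f`, with weak gradient `g`. -/
def IsWeakSolution (A : L2Mat n d →L[ℂ] L2Mat n d) (S : L2Vec n d →L[ℂ] L2Vec n d)
    (f u : L2Vec n d) (g : L2Mat n d) : Prop :=
  IsWeakGrad u g ∧
    ∀ φ Φ, IsWeakGrad φ Φ → inner ℂ Φ (A g) + inner ℂ φ (S u) = inner ℂ φ f

theorem ellipticOp_eq_iff {A : Space d → Mat n d →L[ℂ] Mat n d} {S : Space d → Vec n →L[ℂ] Vec n}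
    (hA : MemLp A ⊤ (volume : Measure (Space d))) (hS : MemLp S ⊤ (volume : Measure (Space d)))
    (u f : L2Vec n d) :
    (∃ h : u ∈ (ellipticOp A S).domain, ellipticOp A S ⟨u, h⟩ = f) ↔
      ∃ g, IsWeakSolution (mulCLM A hA) (mulCLM S hS) f u g := by
  rw [ellipticOp, neg_add_eq_iff]
  simp only [pcomp_eq_iff, mulOp_eq_iff hA, mulOp_eq_iff hS, ← isWeakGrad_iff,
    mem_domain_divOp_iff]
  constructor
  · rintro ⟨y, w, ⟨_, ⟨g, hg, rfl⟩, hw⟩, rfl, rfl⟩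
    refine ⟨g, hg, fun φ Φ hφ => ?_⟩
    rw [hw φ Φ hφ, inner_add_right, inner_neg_right]
  · rintro ⟨g, hg, hw⟩
    -- The equation forces the divergence of `A g` to be `S u - f`.
    refine ⟨mulCLM S hS u - f, _, ⟨_, ⟨g, hg, rfl⟩, fun φ Φ hφ => ?_⟩, rfl, by abel⟩
    rw [inner_sub_right, ← hw φ Φ hφ]
    ring

/-- The Hilbert space `[L²]^n × [L²]^(n × d)`. -/
abbrev L2Pair (n d : ℕ) : Type := WithLp 2 (L2Vec n d × L2Mat n d)

/-- `[H¹(ℝ^d)]^n` as a subspace of `[L²]^n × [L²]^(n × d)`. -/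
def sobolev (n d : ℕ) : Submodule ℂ (L2Pair n d) :=
  (gradGraph n d).comap (WithLp.prodContinuousLinearEquiv 2 ℂ (L2Vec n d) (L2Mat n d)).toLinearMap

/-- The functional is the inner product with the fixed `L²` function `φ e_i`. It makes each
condition defining a weak gradient closed. -/
theorem continuous_integral_smul_coord {ι : Type} [Fintype ι] [DecidableEq ι] {φ : Space d → ℝ}
    (hφ : Continuous φ) (hc : HasCompactSupport φ) (i : ι) :
    Continuous fun f : Lp (EuclideanSpace ℂ ι) 2 (volume : Measure (Space d)) =>
      ∫ x, φ x • f x i := by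
  have hm : MemLp (fun x => (φ x : ℂ) • (EuclideanSpace.single i (1 : ℂ))) 2
      (volume : Measure (Space d)) := by
    refine Continuous.memLp_of_hasCompactSupport (by fun_prop) ?_
    refine hc.mono fun x hx => ?_
    contrapose! hx
    simp only [Function.notMem_support] at hx ⊢
    simp [hx]
  have h : (fun f : Lp (EuclideanSpace ℂ ι) 2 (volume : Measure (Space d)) =>
      ∫ x, φ x • f x i) = fun f => inner ℂ (hm.toLp _) f := by
    funext f
    rw [L2.inner_def]
    refine integral_congr_ae ?_
    filter_upwards [hm.coeFn_toLp] with x hx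
    rw [hx, inner_smul_left, EuclideanSpace.inner_single_left]
    simp
  rw [h]
  fun_prop

theorem isClosed_gradGraph : IsClosed (gradGraph n d : Set (L2Vec n d × L2Mat n d)) := by
  have h : (gradGraph n d : Set (L2Vec n d × L2Mat n d)) =
      ⋂ (φ : Space d → ℝ) (_ : ContDiff ℝ ∞ φ) (_ : HasCompactSupport φ) (i : Fin n) (j : Fin d),
        {p | ∫ x, fderiv ℝ φ x (basisVec j) • p.1 x i = -∫ x, φ x • p.2 x (i, j)} := by
    ext p
    simp only [Set.mem_iInter]
    rfl
  rw [h]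
  refine isClosed_iInter fun φ => isClosed_iInter fun hφ => isClosed_iInter fun hc =>
    isClosed_iInter fun i => isClosed_iInter fun j => isClosed_eq ?_ ?_
  · exact (continuous_integral_smul_coord (continuous_partial hφ j)
      (hc.fderiv_apply ℝ (basisVec j)) i).comp continuous_fst
  · exact ((continuous_integral_smul_coord hφ.continuous hc (i, j)).comp continuous_snd).neg

theorem isClosed_sobolev : IsClosed (sobolev n d : Set (L2Pair n d)) :=
  isClosed_gradGraph.preimage (WithLp.prodContinuousLinearEquiv 2 ℂ _ _).continuous

/-- The bounded operator `(u, g) ↦ (S u, A g)`. -/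
def pairMap {E F : Type} [NormedAddCommGroup E] [InnerProductSpace ℂ E] [NormedAddCommGroup F]
    [InnerProductSpace ℂ F] (S : E →L[ℂ] E) (A : F →L[ℂ] F) :
        WithLp 2 (E × F) →L[ℂ] WithLp 2 (E × F) :=
  (WithLp.prodContinuousLinearEquiv 2 ℂ E F).symm.toContinuousLinearMap ∘L (S.prodMap A) ∘L
    (WithLp.prodContinuousLinearEquiv 2 ℂ E F).toContinuousLinearMap

theorem inner_pairMap {E F : Type} [NormedAddCommGroup E] [InnerProductSpace ℂ E]
    [NormedAddCommGroup F] [InnerProductSpace ℂ F] (S : E →L[ℂ] E) (A : F →L[ℂ] F)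
    (x y : WithLp 2 (E × F)) :
    inner ℂ y (pairMap S A x) = inner ℂ y.fst (S x.fst) + inner ℂ y.snd (A x.snd) := by
  rw [WithLp.prod_inner_apply]
  rfl

/-- Lax–Milgram on the graph of the gradient: the coercivity norm there is the full graph norm, so
no Poincaré inequality is needed. The uniqueness clause is what later gives the left-inverse half of
`IsBoundedInverse`. -/
theorem exists_solution_operator (A : L2Mat n d →L[ℂ] L2Mat n d) (S : L2Vec n d →L[ℂ] L2Vec n d)
    {c : ℝ} (hc : 0 < c) (hA : ∀ g, c * ‖g‖ ^ 2 ≤ (inner ℂ g (A g)).re)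
    (hS : ∀ u, c * ‖u‖ ^ 2 ≤ (inner ℂ u (S u)).re) :
    ∃ R : L2Vec n d →L[ℂ] L2Vec n d,
      (∀ f, ∃ g, IsWeakSolution A S f (R f) g) ∧
      ∀ f u g, IsWeakSolution A S f u g → R f = u := by
  have hB : ∀ x ∈ sobolev n d, c * ‖x‖ ^ 2 ≤ (inner ℂ x (pairMap S A x)).re := by
    intro x _
    rw [inner_pairMap, WithLp.prod_norm_sq_eq_of_L2, Complex.add_re]
    linarith [hA x.snd, hS x.fst]
  obtain ⟨T, hT⟩ := exists_laxMilgram (sobolev n d) isClosed_sobolev (pairMap S A) hc hB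
  let ι : L2Vec n d →L[ℂ] L2Pair n d :=
    (WithLp.prodContinuousLinearEquiv 2 ℂ _ _).symm.toContinuousLinearMap ∘L
      ContinuousLinearMap.inl ℂ _ _
  let π : L2Pair n d →L[ℂ] L2Vec n d :=
    ContinuousLinearMap.fst ℂ _ _ ∘L
      (WithLp.prodContinuousLinearEquiv 2 ℂ (L2Vec n d) (L2Mat n d)).toContinuousLinearMap
  have hι : ∀ (y : L2Pair n d) f, inner ℂ y (ι f) = inner ℂ y.fst f := by
    intro y f
    rw [WithLp.prod_inner_apply]
    change inner ℂ y.fst f + inner ℂ y.snd (0 : L2Mat n d) = _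
    rw [inner_zero_right, add_zero]
  have hsol : ∀ f, IsWeakSolution A S f (T (ι f)).fst (T (ι f)).snd := by
    intro f
    refine ⟨(hT (ι f)).1, fun φ Φ hφ => ?_⟩
    have h := (hT (ι f)).2 (WithLp.toLp 2 (φ, Φ)) hφ
    rw [inner_pairMap, hι] at h
    rw [add_comm]
    exact h
  refine ⟨π ∘L T ∘L ι, fun f => ⟨(T (ι f)).snd, hsol f⟩, fun f u g hu => ?_⟩
  have h0 : T (ι f) - WithLp.toLp 2 (u, g) = 0 := by
    refine eq_zero_of_coercive hc hB (Submodule.sub_mem _ (hT (ι f)).1 hu.1) fun y hy => ?_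
    have h1 := hu.2 y.fst y.snd hy
    rw [map_sub, inner_sub_right, (hT (ι f)).2 y hy, hι, inner_pairMap, ← h1]
    change _ - (inner ℂ y.fst (S u) + inner ℂ y.snd (A g)) = 0
    ring
  rw [sub_eq_zero] at h0
  change (T (ι f)).fst = u
  rw [h0]
  rfl

theorem isBoundedInverse_of_weakSolution {A : Space d → Mat n d →L[ℂ] Mat n d}
    {S : Space d → Vec n →L[ℂ] Vec n} (hA : MemLp A ⊤ (volume : Measure (Space d)))
    (hS : MemLp S ⊤ (volume : Measure (Space d))) {R : L2Vec n d →L[ℂ] L2Vec n d}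
    (h1 : ∀ f, ∃ g, IsWeakSolution (mulCLM A hA) (mulCLM S hS) f (R f) g)
    (h2 : ∀ f u g, IsWeakSolution (mulCLM A hA) (mulCLM S hS) f u g → R f = u) :
    IsBoundedInverse (ellipticOp A S) R := by
  refine ⟨fun f => (ellipticOp_eq_iff hA hS _ _).mpr (h1 f), fun u => ?_⟩
  obtain ⟨g, hg⟩ := (ellipticOp_eq_iff hA hS (u : L2Vec n d) (ellipticOp A S u)).mp ⟨u.2, rfl⟩
  exact h2 _ _ g hg

end

section

/-! ### The unit cell and reduction modulo the lattice -/

variable {n d : ℕ}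

/-- Coordinatewise fractional part. -/
def cellFract (x : Space d) : Space d := WithLp.toLp 2 fun i => Int.fract (x i)

/-- Coordinatewise integer part. -/
def cellFloor (x : Space d) : Fin d → ℤ := fun i => ⌊x i⌋

theorem cellFract_add_cellFloor (x : Space d) : cellFract x + latticePt (cellFloor x) = x := by
  ext i
  simp [cellFract, latticePt, cellFloor]

theorem cellFract_add_latticePt (x : Space d) (k : Fin d → ℤ) :
    cellFract (x + latticePt k) = cellFract x := by
  ext i
  simp [cellFract, latticePt]

theorem cellFract_eq_self {x : Space d} (hx : x ∈ cell d) : cellFract x = x := by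
  ext i
  exact Int.fract_eq_self.mpr ⟨(hx i).1.le, (hx i).2⟩

@[fun_prop]
theorem measurable_cellFract : Measurable (cellFract : Space d → Space d) := by
  refine (WithLp.measurable_toLp 2 _).comp (measurable_pi_lambda _ fun i => ?_)
  exact measurable_fract.comp ((EuclideanSpace.proj i : Space d →L[ℝ] ℝ).continuous.measurable)

theorem measurable_cellFloor : Measurable (cellFloor : Space d → Fin d → ℤ) := by
  refine measurable_pi_lambda _ fun i => ?_
  exact Int.measurable_floor.comp ((EuclideanSpace.proj i : Space d →L[ℝ] ℝ).continuous.measurable)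

theorem cell_eq_preimage : cell d = (MeasurableEquiv.toLp 2 (Fin d → ℝ)).symm ⁻¹'
    (Set.univ.pi fun _ => Set.Ioo 0 1) := by
  ext x
  simp [cell, Set.mem_pi]

theorem measurableSet_cell : MeasurableSet (cell d) := by
  rw [cell_eq_preimage]
  exact (MeasurableEquiv.measurable _) (MeasurableSet.univ_pi fun _ => measurableSet_Ioo)

theorem measurePreserving_cellMeasure : MeasurePreserving (MeasurableEquiv.toLp 2 (Fin d → ℝ)).symm
    (cellMeasure d) (Measure.pi fun _ => volume.restrict (Set.Ioo 0 1)) := by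
  rw [← Measure.restrict_pi_pi, cellMeasure, cell_eq_preimage]
  exact (EuclideanSpace.volume_preserving_symm_measurableEquiv_toLp (Fin d)).restrict_preimage
    (MeasurableSet.univ_pi fun _ => measurableSet_Ioo)

instance : IsProbabilityMeasure (cellMeasure d) := by
  constructor
  have : IsProbabilityMeasure ((volume : Measure ℝ).restrict (Set.Ioo 0 1)) := ⟨by simp⟩
  rw [← Set.preimage_univ (f := (MeasurableEquiv.toLp 2 (Fin d → ℝ)).symm),
    measurePreserving_cellMeasure.measure_preimage MeasurableSet.univ.nullMeasurableSet]
  exact measure_univ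

/-- The intervals `(0, 1]` and `(c, c + 1]` are both fundamental domains for `ℤ` acting on the line,
so they meet the invariant set `Int.fract ⁻¹' s` in equal measure. -/
theorem measurePreserving_fract_add (c : ℝ) : MeasurePreserving (fun t : ℝ => Int.fract (t + c))
    (volume.restrict (Set.Ioo 0 1)) (volume.restrict (Set.Ioo 0 1)) := by
  rw [Measure.restrict_congr_set (Ioo_ae_eq_Ioc (μ := (volume : Measure ℝ)) (a := 0) (b := 1))]
  have hm : Measurable fun t : ℝ => Int.fract (t + c) :=
    measurable_fract.comp (measurable_id.add_const c)
  refine ⟨hm, ?_⟩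
  ext s hs
  have hA : MeasurableSet (Int.fract ⁻¹' s : Set ℝ) := measurable_fract hs
  have hinv : ∀ g : AddSubgroup.zmultiples (1 : ℝ),
      (fun x => g +ᵥ x) ⁻¹' (Int.fract ⁻¹' s : Set ℝ) = Int.fract ⁻¹' s := by
    rintro ⟨g, k, rfl⟩
    ext x
    simp [AddSubgroup.vadd_def]
  have h1 := (isAddFundamentalDomain_Ioc one_pos 0 (volume : Measure ℝ)).measure_set_eq
    (isAddFundamentalDomain_Ioc one_pos c volume) hA hinv
  rw [Measure.map_apply hm hs, Measure.restrict_apply (hm hs)]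
  have h2 : (fun t : ℝ => Int.fract (t + c)) ⁻¹' s ∩ Set.Ioc 0 1 =
      (fun t => t + c) ⁻¹' (Int.fract ⁻¹' s ∩ Set.Ioc c (c + 1)) := by
    ext t
    simp only [Set.mem_inter_iff, Set.mem_preimage, Set.mem_Ioc]
    constructor
    · rintro ⟨h, h', h''⟩
      exact ⟨h, by linarith, by linarith⟩
    · rintro ⟨h, h', h''⟩
      exact ⟨h, by linarith, by linarith⟩
  rw [h2, measure_preimage_add_right, ← h1, zero_add, Measure.restrict_apply hs]
  refine measure_congr ?_
  -- `Int.fract` is the identity on `[0, 1)` but not at `1`; the closed end is exchanged at the cost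
  -- of a null set.
  have h3 : (Set.Ioc 0 1 : Set ℝ) =ᵐ[volume] Set.Ico 0 1 := Ico_ae_eq_Ioc.symm
  refine ((Filter.EventuallyEq.refl _ _).inter h3).trans
    (Filter.EventuallyEq.trans ?_ ((Filter.EventuallyEq.refl _ _).inter h3).symm)
  refine Filter.Eventually.of_forall fun t => propext ?_
  change t ∈ Int.fract ⁻¹' s ∩ Set.Ico 0 1 ↔ t ∈ s ∩ Set.Ico 0 1
  simp only [Set.mem_inter_iff, Set.mem_preimage, Set.mem_Ico]
  refine and_congr_left fun h => ?_
  rw [Int.fract_eq_self.mpr h]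

theorem measurePreserving_cellFract_add (c : Space d) :
    MeasurePreserving (fun x => cellFract (x + c)) (cellMeasure d) (cellMeasure d) := by
  have h1 := measurePreserving_pi (fun _ : Fin d => (volume : Measure ℝ).restrict (Set.Ioo 0 1))
    (fun _ => volume.restrict (Set.Ioo 0 1)) fun i => measurePreserving_fract_add (c i)
  have h2 := (measurePreserving_cellMeasure (d := d)).symm
  exact h2.comp (h1.comp measurePreserving_cellMeasure)

theorem cellFloor_eq_iff {x : Space d} {k : Fin d → ℤ} :
    cellFloor x = k ↔ cellFloor (x - latticePt k) = 0 := by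
  simp only [funext_iff, cellFloor, latticePt, PiLp.sub_apply, Int.floor_sub_intCast,
    Pi.zero_apply, sub_eq_zero]

theorem cell_ae_eq : (cellFloor ⁻¹' {0} : Set (Space d)) =ᵐ[volume] cell d := by
  have h1 : (cellFloor ⁻¹' {0} : Set (Space d)) = (MeasurableEquiv.toLp 2 (Fin d → ℝ)).symm ⁻¹'
      (Set.univ.pi fun _ => Set.Ico 0 1) := by
    ext x
    simp only [Set.mem_preimage, Set.mem_singleton_iff, funext_iff, cellFloor, Pi.zero_apply,
      Int.floor_eq_zero_iff, Set.mem_pi, Set.mem_univ, true_imp_iff]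
    rfl
  rw [h1, cell_eq_preimage]
  refine (EuclideanSpace.volume_preserving_symm_measurableEquiv_toLp
    (Fin d)).quasiMeasurePreserving.preimage_ae_eq ?_
  exact (Measure.univ_pi_Ico_ae_eq_Icc).trans (Measure.univ_pi_Ioo_ae_eq_Icc).symm

/-- The translated cells tile the space up to their null faces. Stated as an equality of measures,
this transfers null sets and integrals alike. -/
theorem volume_eq_sum_cellMeasure : (volume : Measure (Space d)) =
    Measure.sum fun k : Fin d → ℤ => (cellMeasure d).map fun x => x + latticePt k := by
  have h1 : (volume : Measure (Space d)) = volume.restrict (⋃ k, cellFloor ⁻¹' {k}) := by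
    rw [← Set.preimage_iUnion, Set.iUnion_of_singleton, Set.preimage_univ, Measure.restrict_univ]
  conv_lhs => rw [h1]
  rw [Measure.restrict_iUnion]
  · congr 1
    funext k
    have h2 : (cellFloor ⁻¹' {k} : Set (Space d)) =
        (fun x => x - latticePt k) ⁻¹' (cellFloor ⁻¹' {0}) := by
      ext x
      simp only [Set.mem_preimage, Set.mem_singleton_iff]
      exact cellFloor_eq_iff
    have h3 := (measurePreserving_sub_right (volume : Measure (Space d))
      (latticePt k)).restrict_preimage (measurable_cellFloor (measurableSet_singleton 0))
    rw [← h2, Measure.restrict_congr_set cell_ae_eq] at h3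
    rw [cellMeasure, ← h3.map_eq, Measure.map_map (by fun_prop) (by fun_prop)]
    have h4 : ((fun x : Space d => x + latticePt k) ∘ fun x => x - latticePt k) = id := by
      funext x
      simp
    rw [h4, Measure.map_id]
  · intro i j hij
    refine Set.disjoint_left.mpr fun x hx hx' => hij ?_
    exact hx.symm.trans hx'
  · exact fun k => measurable_cellFloor (measurableSet_singleton k)

/-- Needed so that almost-everywhere classes on the cell can be extended periodically. -/
theorem quasiMeasurePreserving_cellFract :
    Measure.QuasiMeasurePreserving (cellFract : Space d → Space d) volume (cellMeasure d) := by
  refine ⟨measurable_cellFract, ?_⟩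
  refine Measure.AbsolutelyContinuous.mk fun s hs h0 => ?_
  rw [Measure.map_apply measurable_cellFract hs, volume_eq_sum_cellMeasure,
    Measure.sum_apply _ (measurable_cellFract hs), ENNReal.tsum_eq_zero]
  intro k
  rw [Measure.map_apply (by fun_prop) (measurable_cellFract hs)]
  have := (measurePreserving_cellFract_add (latticePt k : Space d)).measure_preimage
    hs.nullMeasurableSet
  rw [← h0, ← this]
  rfl

theorem quasiMeasurePreserving_smul {ε : ℝ} (hε : ε ≠ 0) :
    Measure.QuasiMeasurePreserving (fun x : Space d => ε • x) volume volume := by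
  refine ⟨by fun_prop, ?_⟩
  rw [Measure.map_addHaar_smul _ hε]
  exact Measure.smul_absolutelyContinuous

theorem quasiMeasurePreserving_cellFract_smul {ε : ℝ} (hε : ε ≠ 0) :
    Measure.QuasiMeasurePreserving (fun x : Space d => cellFract (ε • x)) volume (cellMeasure d) :=
  quasiMeasurePreserving_cellFract.comp (quasiMeasurePreserving_smul hε)

theorem integral_eq_tsum_cell {E : Type*} [NormedAddCommGroup E] [NormedSpace ℝ E]
    {F : Space d → E} (hF : Integrable F) :
    ∫ x, F x = ∑' k : Fin d → ℤ, ∫ x in cell d, F (x + latticePt k) := by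
  have h := hF
  rw [volume_eq_sum_cellMeasure] at h
  conv_lhs => rw [volume_eq_sum_cellMeasure]
  rw [integral_sum_measure h]
  congr 1
  funext k
  exact integral_map_equiv (MeasurableEquiv.addRight (latticePt k)) F

/-- Each lattice vector has its own exceptional null set; since the lattice is countable, the vector
may depend on the point. -/
theorem ae_eq_comp_cellFract {E : Type*} {a : Space d → E}
    (ha : ∀ k : Fin d → ℤ, ∀ᵐ x : Space d, a (x + latticePt k) = a x) :
    ∀ᵐ x : Space d, a (cellFract x) = a x := by
  filter_upwards [ae_all_iff.mpr ha] with x hx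
  have h := hx (-cellFloor x)
  rw [← h]
  congr 1
  ext i
  simp [cellFract, latticePt, cellFloor, sub_eq_add_neg, Int.fract]

end

section

/-! ### Mollification with a kernel whose periodisation is constant -/

variable {d : ℕ}

/-- `k` is a smooth nonnegative kernel, concentrated at scale `ε`, whose `ε ℤ^d`-periodisation is
the constant `ε ^ (-d)`. -/
structure OscKernel (ρ C ε : ℝ) (k : Space d → ℝ) : Prop where
  contDiff : ContDiff ℝ ∞ k
  hasCompactSupport : HasCompactSupport k
  nonneg : ∀ x, 0 ≤ k x
  support : ∀ x, ρ * ε < ‖x‖ → k x = 0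
  lintegral : ∀ F : Space d → ENNReal, Measurable F → ∀ y,
    ∫⁻ x, ENNReal.ofReal (k (x - y)) * F (cellFract (ε⁻¹ • x)) = ∫⁻ x in cell d, F x
  lintegral_partial : ∀ j, ∫⁻ x, ‖fderiv ℝ k x (basisVec j)‖ₑ ≤ ENNReal.ofReal (C / ε)

/-- The kernel is `η * 1_Y` with `η` a bump of mass one. The lattice translates of `1_Y` sum to `1`
almost everywhere, a property that survives averaging against `η`, while `η` supplies the
smoothness. -/
theorem exists_unit_kernel (d : ℕ) : ∃ χ : Space d → ℝ, ContDiff ℝ ∞ χ ∧ HasCompactSupport χ ∧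
    (∀ x, 0 ≤ χ x) ∧ ∀ F : Space d → ENNReal, Measurable F → ∀ y,
      ∫⁻ x, ENNReal.ofReal (χ (x - y)) * F (cellFract x) = ∫⁻ x in cell d, F x := by
  let b : ContDiffBump (0 : Space d) := ⟨1, 2, one_pos, one_lt_two⟩
  set η : Space d → ℝ := b.normed volume with hη
  set I : Space d → ℝ := (cell d).indicator fun _ => 1 with hI
  have hIm : Measurable I := measurable_const.indicator measurableSet_cell
  have hIint : Integrable I := by
    refine (integrable_indicator_iff measurableSet_cell).mpr (integrableOn_const ?_)
    have : cellMeasure d Set.univ = 1 := measure_univ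
    rw [Measure.restrict_apply_univ] at this
    simp [this]
  have hIc : HasCompactSupport I := by
    refine HasCompactSupport.of_support_subset_isCompact
      (isCompact_closedBall (0 : Space d) (Real.sqrt d)) fun x hx => ?_
    have hxc : x ∈ cell d := by
      by_contra h
      exact hx (Set.indicator_of_notMem h _)
    rw [mem_closedBall_zero_iff, EuclideanSpace.norm_eq]
    refine Real.sqrt_le_sqrt ?_
    calc ∑ i, ‖x i‖ ^ 2 ≤ ∑ _i : Fin d, (1 : ℝ) := by
          refine Finset.sum_le_sum fun i _ => ?_
          have := hxc i
          rw [Real.norm_eq_abs, abs_of_pos this.1]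
          nlinarith [this.1, this.2]
      _ = d := by simp
  have hηc : HasCompactSupport η := b.hasCompactSupport_normed
  have hηs : ContDiff ℝ ∞ η := b.contDiff_normed
  have hη0 : ∀ x, 0 ≤ η x := fun x => b.nonneg_normed x
  have hI0 : ∀ x, 0 ≤ I x := fun x => Set.indicator_nonneg (fun _ _ => zero_le_one) x
  have hη1 : ∫⁻ x, ENNReal.ofReal (η x) = 1 := by
    rw [← ofReal_integral_eq_lintegral_ofReal b.integrable_normed (Filter.Eventually.of_forall hη0),
      b.integral_normed, ENNReal.ofReal_one]
  have hex : ConvolutionExists η I (ContinuousLinearMap.lsmul ℝ ℝ) volume :=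
    hηc.convolutionExists_left _ hηs.continuous hIint.locallyIntegrable
  refine ⟨convolution η I (ContinuousLinearMap.lsmul ℝ ℝ) volume, ?_, ?_, ?_, ?_⟩
  · exact hηc.contDiff_convolution_left _ hηs hIint.locallyIntegrable
  · exact hηc.convolution _ hIc
  · intro x
    exact integral_nonneg fun t => mul_nonneg (hη0 t) (hI0 _)
  · intro F hF y
    have hFm : Measurable fun x : Space d => F (cellFract x) := hF.comp measurable_cellFract
    have h1 : ∀ x, ENNReal.ofReal (convolution η I (ContinuousLinearMap.lsmul ℝ ℝ) volume (x - y)) *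
        F (cellFract x) = ∫⁻ t, ENNReal.ofReal (η t) *
          (ENNReal.ofReal (I (x - (y + t))) * F (cellFract x)) := by
      intro x
      rw [convolution_def, ofReal_integral_eq_lintegral_ofReal (hex (x - y))
        (Filter.Eventually.of_forall fun t => mul_nonneg (hη0 t) (hI0 _)),
        ← lintegral_mul_const]
      · refine lintegral_congr fun t => ?_
        simp only [ContinuousLinearMap.lsmul_apply, smul_eq_mul]
        rw [ENNReal.ofReal_mul (hη0 t), mul_assoc, sub_sub]
      · have := hηs.continuous.measurable
        simp only [ContinuousLinearMap.lsmul_apply, smul_eq_mul]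
        fun_prop
    simp_rw [h1]
    rw [lintegral_lintegral_swap (by
      have := hηs.continuous.measurable
      exact Measurable.aemeasurable (by fun_prop))]
    have h2 : ∀ t, ∫⁻ x, ENNReal.ofReal (η t) * (ENNReal.ofReal (I (x - (y + t))) *
        F (cellFract x)) = ENNReal.ofReal (η t) * ∫⁻ x in cell d, F x := by
      intro t
      rw [lintegral_const_mul _ (by fun_prop)]
      congr 1
      -- The shift turns the indicator into that of `Y` and translates the argument of `F` modulo
      -- the lattice, which preserves the cell measure.
      rw [← lintegral_add_right_eq_self _ (y + t)]
      simp only [add_sub_cancel_right]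
      have h3 := (measurePreserving_cellFract_add (y + t)).lintegral_comp hF
      rw [← h3, ← lintegral_indicator measurableSet_cell]
      refine lintegral_congr fun x => ?_
      by_cases hx : x ∈ cell d
      · simp [hI, hx]
      · simp [hI, hx]
    simp_rw [h2]
    rw [lintegral_mul_const _ (by
      have := hηs.continuous.measurable
      fun_prop), hη1, one_mul]

/-- The unit kernel is rescaled to `ε ^ (-d) χ (x / ε)`: the mass is preserved, the support has
radius of order `ε`, and each derivative contributes a factor `ε⁻¹` to the `L¹` norm. The constants
`ρ` and `C` do not depend on `ε`. -/
theorem exists_oscKernel (d : ℕ) : ∃ ρ C : ℝ, 0 < ρ ∧ 0 < C ∧ ∀ ε : ℝ, 0 < ε →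
    ∃ k : Space d → ℝ, OscKernel ρ C ε k := by
  obtain ⟨χ, hs, hc, h0, hF⟩ := exists_unit_kernel d
  obtain ⟨r, hr⟩ := hc.isCompact.isBounded.subset_closedBall (0 : Space d)
  have hint : ∀ j : Fin d, Integrable fun x => fderiv ℝ χ x (basisVec j) := fun j =>
    (continuous_partial hs j).integrable_of_hasCompactSupport (hc.fderiv_apply ℝ _)
  -- `ρ` bounds the support radius of `χ` and `C` dominates the `L¹` norms of all its partial
  -- derivatives; the extra `1`s only ensure positivity.
  refine ⟨max r 1, 1 + ∑ j : Fin d, ∫ x, ‖fderiv ℝ χ x (basisVec j)‖, by positivity,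
    by positivity, fun ε hε => ⟨fun x => (ε⁻¹) ^ d * χ (ε⁻¹ • x), ?_⟩⟩
  have hε' : (0 : ℝ) < ε⁻¹ := inv_pos.mpr hε
  have hscale : ∀ G : Space d → ENNReal,
      ∫⁻ x, ENNReal.ofReal ((ε⁻¹) ^ d) * G (ε⁻¹ • x) = ∫⁻ x, G x := by
    intro G
    have h := lintegral_map_equiv (μ := (volume : Measure (Space d))) G
      (Homeomorph.smulOfNeZero ε⁻¹ hε'.ne').toMeasurableEquiv
    change ∫⁻ x, G x ∂Measure.map (fun x => ε⁻¹ • x) volume = ∫⁻ x, G (ε⁻¹ • x) at h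
    rw [lintegral_const_mul' _ _ ENNReal.ofReal_ne_top, ← h, Measure.map_addHaar_smul _ hε'.ne',
      lintegral_smul_measure, smul_eq_mul, ← mul_assoc, finrank_euclideanSpace_fin, abs_inv,
      abs_of_pos (by positivity), ← ENNReal.ofReal_mul (by positivity),
      mul_inv_cancel₀ (by positivity), ENNReal.ofReal_one, one_mul]
  have hder : ∀ x (v : Space d), fderiv ℝ (fun x => (ε⁻¹) ^ d * χ (ε⁻¹ • x)) x v =
      (ε⁻¹) ^ d * (ε⁻¹ * fderiv ℝ χ (ε⁻¹ • x) v) := by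
    intro x v
    have h1 : HasFDerivAt (fun x : Space d => (ε⁻¹) ^ d * χ (ε⁻¹ • x))
        ((ε⁻¹) ^ d • (fderiv ℝ χ (ε⁻¹ • x)).comp (ε⁻¹ • ContinuousLinearMap.id ℝ (Space d))) x :=
      (((hs.differentiable (by simp)) (ε⁻¹ • x)).hasFDerivAt.comp x
        ((hasFDerivAt_id x).const_smul ε⁻¹)).const_mul _
    rw [h1.fderiv]
    simp
  constructor
  · exact contDiff_const.mul (hs.comp (contDiff_const_smul _))
  · exact (hc.comp_smul hε'.ne').mul_left
  · exact fun x => mul_nonneg (by positivity) (h0 _)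
  · intro x hx
    have : ε⁻¹ • x ∉ tsupport χ := by
      intro h
      have h2 := hr h
      rw [mem_closedBall_zero_iff, norm_smul, Real.norm_of_nonneg hε'.le, inv_mul_le_iff₀ hε] at h2
      have := le_max_left r 1
      nlinarith
    rw [image_eq_zero_of_notMem_tsupport this, mul_zero]
  · intro F hFm y
    rw [← hF F hFm (ε⁻¹ • y),
      ← hscale fun x => ENNReal.ofReal (χ (x - ε⁻¹ • y)) * F (cellFract x)]
    refine lintegral_congr fun x => ?_
    rw [ENNReal.ofReal_mul (by positivity), mul_assoc, smul_sub]
  · intro j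
    have h1 : ∀ x, ‖fderiv ℝ (fun x => (ε⁻¹) ^ d * χ (ε⁻¹ • x)) x (basisVec j)‖ₑ =
        ENNReal.ofReal ((ε⁻¹) ^ d) *
          (ENNReal.ofReal ε⁻¹ * ‖fderiv ℝ χ (ε⁻¹ • x) (basisVec j)‖ₑ) := by
      intro x
      rw [hder, enorm_mul, enorm_mul, Real.enorm_of_nonneg (by positivity),
        Real.enorm_of_nonneg hε'.le]
    simp_rw [h1]
    rw [hscale fun x => ENNReal.ofReal ε⁻¹ * ‖fderiv ℝ χ x (basisVec j)‖ₑ,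
      lintegral_const_mul' _ _ ENNReal.ofReal_ne_top,
      ← ofReal_integral_norm_eq_lintegral_enorm (hint j), ← ENNReal.ofReal_mul hε'.le]
    refine ENNReal.ofReal_le_ofReal ?_
    rw [div_eq_inv_mul]
    gcongr
    have := Finset.single_le_sum (f := fun j : Fin d => ∫ x, ‖fderiv ℝ χ x (basisVec j)‖)
      (fun i _ => integral_nonneg fun x => norm_nonneg _) (Finset.mem_univ j)
    linarith

end

section

/-! ### Cauchy–Schwarz inequalities for lower integrals -/

theorem lintegral_mul_sq_le {α : Type*} [MeasurableSpace α] {μ : Measure α} {f g : α → ENNReal}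
    (hf : AEMeasurable f μ) (hg : AEMeasurable g μ) :
    (∫⁻ x, f x * g x ∂μ) ^ 2 ≤ (∫⁻ x, f x ^ 2 ∂μ) * ∫⁻ x, g x ^ 2 ∂μ := by
  have h := ENNReal.lintegral_mul_le_Lp_mul_Lq μ Real.HolderConjugate.two_two hf hg
  simp only [Pi.mul_apply, ENNReal.rpow_two] at h
  calc _ ≤ ((∫⁻ x, f x ^ 2 ∂μ) ^ (1 / 2 : ℝ) * (∫⁻ x, g x ^ 2 ∂μ) ^ (1 / 2 : ℝ)) ^ 2 := by gcongr
    _ = _ := by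
      rw [mul_pow, ← ENNReal.rpow_two, ← ENNReal.rpow_two, ← ENNReal.rpow_mul, ← ENNReal.rpow_mul]
      norm_num

theorem lintegral_weight_mul_sq_le {α : Type*} [MeasurableSpace α] {μ : Measure α}
    {w f : α → ENNReal} (hw : AEMeasurable w μ) (hf : AEMeasurable f μ) :
    (∫⁻ x, w x * f x ∂μ) ^ 2 ≤ (∫⁻ x, w x ∂μ) * ∫⁻ x, w x * f x ^ 2 ∂μ := by
  have hs : ∀ a : ENNReal, (a ^ (1 / 2 : ℝ)) ^ 2 = a := by
    intro a
    rw [← ENNReal.rpow_two, ← ENNReal.rpow_mul]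
    norm_num
  have h := lintegral_mul_sq_le (μ := μ) (f := fun x => w x ^ (1 / 2 : ℝ))
    (g := fun x => w x ^ (1 / 2 : ℝ) * f x) (hw.pow_const _) ((hw.pow_const _).mul hf)
  simp_rw [mul_pow, ← mul_assoc, ← pow_two, hs] at h
  exact h

theorem enorm_integral_smul_sq_le {α : Type*} [MeasurableSpace α] {μ : Measure α} {V : Type*}
    [NormedAddCommGroup V] [NormedSpace ℝ V] {w : α → ℝ} {f : α → V} (hw : AEMeasurable w μ)
    (hf : AEStronglyMeasurable f μ) :
    ‖∫ x, w x • f x ∂μ‖ₑ ^ 2 ≤ (∫⁻ x, ‖w x‖ₑ ∂μ) * ∫⁻ x, ‖w x‖ₑ * ‖f x‖ₑ ^ 2 ∂μ := by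
  refine le_trans ?_ (lintegral_weight_mul_sq_le hw.enorm hf.enorm)
  gcongr
  refine (enorm_integral_le_lintegral_enorm _).trans (le_of_eq ?_)
  simp_rw [enorm_smul]

/-! ### Mollification -/

section Moll

variable {d : ℕ} {V : Type*} [NormedAddCommGroup V] [NormedSpace ℝ V]

/-- The convolution of the kernel `k` with `f`. -/
def moll (k : Space d → ℝ) (f : Space d → V) (x : Space d) : V := ∫ y, k (x - y) • f y

theorem moll_eq_convolution (k : Space d → ℝ) (f : Space d → V) :
    moll k f = convolution k f (ContinuousLinearMap.lsmul ℝ ℝ) volume := by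
  funext x
  rw [convolution_lsmul_swap]
  rfl

theorem integrable_moll {k : Space d → ℝ} (hk : Continuous k) (hc : HasCompactSupport k)
    {f : Space d → V} (hf : LocallyIntegrable f) (x : Space d) :
    Integrable fun y => k (x - y) • f y := by
  refine hf.integrable_smul_left_of_hasCompactSupport (hk.comp (continuous_const.sub continuous_id)) ?_
  exact hc.comp_homeomorph (Homeomorph.subLeft x)

theorem contDiff_moll {k : Space d → ℝ} (hk : ContDiff ℝ ∞ k) (hc : HasCompactSupport k)
    {f : Space d → V} (hf : LocallyIntegrable f) : ContDiff ℝ ∞ (moll k f) := by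
  rw [moll_eq_convolution]
  exact hc.contDiff_convolution_left _ hk hf

theorem fderiv_moll [CompleteSpace V] {k : Space d → ℝ} (hk : ContDiff ℝ ∞ k)
    (hc : HasCompactSupport k)
    {f : Space d → V} (hf : LocallyIntegrable f) (x v : Space d) :
    fderiv ℝ (moll k f) x v = moll (fun y => fderiv ℝ k y v) f x := by
  rw [moll_eq_convolution]
  have h := hc.hasFDerivAt_convolution_left (ContinuousLinearMap.lsmul ℝ ℝ : ℝ →L[ℝ] V →L[ℝ] V)
    (hk.of_le (by simp)) hf x (μ := volume)
  rw [h.fderiv, moll_eq_convolution, convolution_def, convolution_def,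
    ContinuousLinearMap.integral_apply]
  · rfl
  · exact (hc.fderiv ℝ).convolutionExists_left _ (hk.continuous_fderiv (by simp)) hf x

/-- The weak derivative is tested against `y ↦ k (x - y)`; the reflection supplies the sign that
cancels the one in the integration by parts. -/
theorem moll_fderiv_eq [CompleteSpace V] {k : Space d → ℝ} (hk : ContDiff ℝ ∞ k)
    (hc : HasCompactSupport k) {f g : Space d → V} {j : Fin d}
    (hfg : ∀ φ : Space d → ℝ, ContDiff ℝ ∞ φ → HasCompactSupport φ →
      ∫ x, fderiv ℝ φ x (basisVec j) • f x = -∫ x, φ x • g x) (x : Space d) :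
    moll (fun y => fderiv ℝ k y (basisVec j)) f x = moll k g x := by
  have h := hfg (fun y => k (x - y)) (hk.comp (contDiff_const.sub contDiff_id))
    (hc.comp_homeomorph (Homeomorph.subLeft x))
  have hd : ∀ y, fderiv ℝ (fun y => k (x - y)) y (basisVec j) =
      -fderiv ℝ k (x - y) (basisVec j) := by
    intro y
    have h1 : HasFDerivAt (fun y => k (x - y))
        ((fderiv ℝ k (x - y)).comp (-ContinuousLinearMap.id ℝ (Space d))) y :=
      ((hk.differentiable (by simp)) (x - y)).hasFDerivAt.comp y
        ((hasFDerivAt_id y).const_sub x)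
    rw [h1.fderiv]
    simp
  simp_rw [hd, neg_smul] at h
  rw [integral_neg, neg_inj] at h
  exact h

theorem aestronglyMeasurable_moll {k : Space d → ℝ} (hk : ContDiff ℝ ∞ k)
    (hc : HasCompactSupport k) {f : Space d → V} (hf : LocallyIntegrable f) :
    AEStronglyMeasurable (moll k f) volume :=
  (contDiff_moll hk hc hf).continuous.aestronglyMeasurable

/-- Translation estimates give approximation by mollification. -/
theorem lintegral_moll_sub_le [CompleteSpace V] {k : Space d → ℝ} (hk : Continuous k)
    (hc : HasCompactSupport k)
    {r : ℝ} (hr : ∀ x, r < ‖x‖ → k x = 0) {f : Space d → V} (hf : LocallyIntegrable f)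
    {D : ENNReal} (hD : ∀ h, ‖h‖ ≤ r → ∫⁻ x, ‖f (x + h) - f x‖ₑ ^ 2 ≤ D) :
    ∫⁻ x, ‖moll k f x - (∫ y, k y) • f x‖ₑ ^ 2 ≤ (∫⁻ y, ‖k y‖ₑ) ^ 2 * D := by
  have hfm : AEStronglyMeasurable f volume := hf.aestronglyMeasurable
  have hdiff : AEStronglyMeasurable (fun p : Space d × Space d => f (p.1 - p.2) - f p.1)
      (volume.prod volume) := by
    refine AEStronglyMeasurable.sub ?_ hfm.comp_fst
    exact hfm.comp_quasiMeasurePreserving (quasiMeasurePreserving_sub volume volume)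
  have hkint : Integrable k := hk.integrable_of_hasCompactSupport hc
  -- The kernel is not normalised: with `∫ k = 0` the same estimate bounds the convolution with a
  -- derivative of a kernel.
  have h1 : ∀ x, moll k f x - (∫ y, k y) • f x = ∫ h, k h • (f (x - h) - f x) := by
    intro x
    have hi : Integrable fun h => k h • f (x - h) := by
      have := (integrable_moll hk hc hf x).comp_sub_left x
      simpa using this
    simp_rw [smul_sub]
    rw [integral_sub hi (hkint.smul_const _), integral_smul_const]
    congr 1
    rw [moll, ← integral_sub_left_eq_self _ volume x]
    simp
  have h2 : ∀ᵐ x : Space d, ‖moll k f x - (∫ y, k y) • f x‖ₑ ^ 2 ≤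
      (∫⁻ y, ‖k y‖ₑ) * ∫⁻ h, ‖k h‖ₑ * ‖f (x - h) - f x‖ₑ ^ 2 := by
    filter_upwards [hdiff.prodMk_left] with x hx
    rw [h1]
    exact enorm_integral_smul_sq_le hk.measurable.aemeasurable hx
  have hm : AEMeasurable (fun p : Space d × Space d => ‖k p.2‖ₑ * ‖f (p.1 - p.2) - f p.1‖ₑ ^ 2)
      (volume.prod volume) := by
    refine AEMeasurable.mul ?_ (hdiff.enorm.pow_const 2)
    exact ((hk.measurable.comp measurable_snd).enorm).aemeasurable
  calc _ ≤ ∫⁻ x, (∫⁻ y, ‖k y‖ₑ) * ∫⁻ h, ‖k h‖ₑ * ‖f (x - h) - f x‖ₑ ^ 2 := lintegral_mono_ae h2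
    _ = (∫⁻ y, ‖k y‖ₑ) * ∫⁻ x, ∫⁻ h, ‖k h‖ₑ * ‖f (x - h) - f x‖ₑ ^ 2 :=
      lintegral_const_mul'' _ hm.lintegral_prod_right'
    _ = (∫⁻ y, ‖k y‖ₑ) * ∫⁻ h, ‖k h‖ₑ * ∫⁻ x, ‖f (x - h) - f x‖ₑ ^ 2 := by
      rw [lintegral_lintegral_swap hm]
      congr 1
      refine lintegral_congr fun h => ?_
      rw [lintegral_const_mul' _ _ enorm_ne_top]
    _ ≤ (∫⁻ y, ‖k y‖ₑ) * ∫⁻ h, ‖k h‖ₑ * D := by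
      refine mul_le_mul' le_rfl (lintegral_mono fun h => ?_)
      by_cases hh : ‖h‖ ≤ r
      · refine mul_le_mul' le_rfl ?_
        have := hD (-h) (by rwa [norm_neg])
        simpa [sub_eq_add_neg] using this
      · rw [hr h (not_le.mp hh), enorm_zero, zero_mul, zero_mul]
    _ = _ := by
      rw [lintegral_mul_const'' _ hk.measurable.enorm.aemeasurable]
      ring

namespace OscKernel

variable {ρ C ε : ℝ} {k : Space d → ℝ}

theorem enorm_eq (hk : OscKernel ρ C ε k) (x : Space d) : ‖k x‖ₑ = ENNReal.ofReal (k x) :=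
  Real.enorm_of_nonneg (hk.nonneg x)

theorem lintegral_enorm (hk : OscKernel ρ C ε k) : ∫⁻ x, ‖k x‖ₑ = 1 := by
  have h := hk.lintegral (fun _ => 1) measurable_const 0
  simp only [sub_zero, mul_one, lintegral_const, one_mul] at h
  simp_rw [hk.enorm_eq]
  rw [h]
  exact measure_univ

theorem integrable (hk : OscKernel ρ C ε k) : Integrable k :=
  hk.contDiff.continuous.integrable_of_hasCompactSupport hk.hasCompactSupport

theorem integral_eq_one (hk : OscKernel ρ C ε k) : ∫ x, k x = 1 := by
  have h := ofReal_integral_eq_lintegral_ofReal hk.integrable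
    (Filter.Eventually.of_forall hk.nonneg)
  simp_rw [← hk.enorm_eq] at h
  rw [hk.lintegral_enorm, ENNReal.ofReal_eq_one] at h
  exact h

theorem integral_partial (hk : OscKernel ρ C ε k) (j : Fin d) :
    ∫ x, fderiv ℝ k x (basisVec j) = 0 := by
  have hc := hk.hasCompactSupport
  have hp := continuous_partial hk.contDiff j
  have h := integral_smul_fderiv_eq_neg_fderiv_smul_of_integrable
    (μ := (volume : Measure (Space d))) (f := fun _ => (1 : ℝ)) (g := k) (v := basisVec j) (𝕜 := ℝ)
    (by simp) (by
      simpa using hp.integrable_of_hasCompactSupport (hc.fderiv_apply ℝ _))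
    (by simpa using hk.integrable) (fun x _ => differentiableAt_const _)
    (fun x _ => (hk.contDiff.differentiable (by simp)) x)
  simpa using h

/-- Products of oscillating functions with mollified functions are bounded in `L²`. -/
theorem lintegral_mul_moll_le (hk : OscKernel ρ C ε k) {F : Space d → ENNReal} (hF : Measurable F)
    {f : Space d → V} (hf : AEStronglyMeasurable f volume) :
    ∫⁻ x, F (cellFract (ε⁻¹ • x)) * ‖moll k f x‖ₑ ^ 2 ≤
      (∫⁻ x in cell d, F x) * ∫⁻ x, ‖f x‖ₑ ^ 2 := by
  have hFm : Measurable fun x : Space d => F (cellFract (ε⁻¹ • x)) := by fun_prop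
  have hkm : Measurable k := hk.contDiff.continuous.measurable
  -- Jensen's inequality for the probability density `y ↦ k (x - y)`.
  have h1 : ∀ x, ‖moll k f x‖ₑ ^ 2 ≤ ∫⁻ y, ‖k (x - y)‖ₑ * ‖f y‖ₑ ^ 2 := by
    intro x
    have h := enorm_integral_smul_sq_le (μ := (volume : Measure (Space d)))
      (w := fun y => k (x - y)) (f := f) (by fun_prop) hf
    rwa [lintegral_sub_left_eq_self (fun y => ‖k y‖ₑ) x, hk.lintegral_enorm, one_mul] at h
  have hm : AEMeasurable (fun p : Space d × Space d =>
      F (cellFract (ε⁻¹ • p.1)) * (‖k (p.1 - p.2)‖ₑ * ‖f p.2‖ₑ ^ 2)) (volume.prod volume) := by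
    have h2 : AEMeasurable (fun p : Space d × Space d => ‖k (p.1 - p.2)‖ₑ) (volume.prod volume) := by
      fun_prop
    have h3 : AEMeasurable (fun p : Space d × Space d => F (cellFract (ε⁻¹ • p.1)))
        (volume.prod volume) := by fun_prop
    exact h3.mul (h2.mul ((hf.comp_snd.enorm).pow_const 2))
  calc _ ≤ ∫⁻ x, ∫⁻ y, F (cellFract (ε⁻¹ • x)) * (‖k (x - y)‖ₑ * ‖f y‖ₑ ^ 2) := by
        refine lintegral_mono fun x => ?_
        have hkx : AEMeasurable (fun y => ‖k (x - y)‖ₑ) volume := by fun_prop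
        have hkf : AEMeasurable (fun y => ‖k (x - y)‖ₑ * ‖f y‖ₑ ^ 2) volume :=
          hkx.mul (hf.enorm.pow_const 2)
        rw [lintegral_const_mul'' _ hkf]
        exact mul_le_mul' le_rfl (h1 x)
    _ = ∫⁻ y, ∫⁻ x, F (cellFract (ε⁻¹ • x)) * (‖k (x - y)‖ₑ * ‖f y‖ₑ ^ 2) :=
        lintegral_lintegral_swap hm
    -- Here the constant periodisation enters: for each fixed `y` the `x`-integral is exactly the
    -- cell integral of `F`, so no pointwise bound on `F` is needed.
    _ = ∫⁻ y, (∫⁻ x in cell d, F x) * ‖f y‖ₑ ^ 2 := by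
        refine lintegral_congr fun y => ?_
        rw [← hk.lintegral F hF y, ← lintegral_mul_const]
        · refine lintegral_congr fun x => ?_
          rw [hk.enorm_eq]
          ring
        · fun_prop
    _ = _ := lintegral_const_mul'' _ (hf.enorm.pow_const 2)

end OscKernel

end Moll

end

section

/-! ### `L²` norms and translations -/

section L2Norm

variable {α : Type*} [MeasurableSpace α] {μ : Measure α} {V : Type*} [NormedAddCommGroup V]

theorem lintegral_enorm_sq (f : Lp V 2 μ) : ∫⁻ x, ‖f x‖ₑ ^ 2 ∂μ = ‖f‖ₑ ^ 2 := by
  have h := eLpNorm_nnreal_pow_eq_lintegral (f := f) (μ := μ) (p := 2) two_ne_zero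
  rw [Lp.enorm_def]
  simp only [NNReal.coe_ofNat, ENNReal.rpow_ofNat, ENNReal.coe_ofNat] at h
  exact h.symm

theorem lintegral_enorm_sq_toLp {f : α → V} (hf : MemLp f 2 μ) :
    ‖hf.toLp f‖ₑ ^ 2 = ∫⁻ x, ‖f x‖ₑ ^ 2 ∂μ := by
  rw [← lintegral_enorm_sq]
  refine lintegral_congr_ae ?_
  filter_upwards [hf.coeFn_toLp] with x hx
  rw [hx]

theorem memLp_two_of_lintegral_lt_top {f : α → V} (hf : AEStronglyMeasurable f μ)
    (h : ∫⁻ x, ‖f x‖ₑ ^ 2 ∂μ < ⊤) : MemLp f 2 μ := by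
  refine ⟨hf, ?_⟩
  have h1 := eLpNorm_nnreal_pow_eq_lintegral (f := f) (μ := μ) (p := 2) two_ne_zero
  simp only [NNReal.coe_ofNat, ENNReal.rpow_ofNat, ENNReal.coe_ofNat] at h1
  rw [← h1] at h
  by_contra h2
  rw [not_lt, top_le_iff] at h2
  rw [h2] at h
  simp at h

theorem norm_le_of_enorm_sq_le {E : Type*} [NormedAddCommGroup E] {x : E} {c : ℝ} (hc : 0 ≤ c)
    (h : ‖x‖ₑ ^ 2 ≤ ENNReal.ofReal c ^ 2) : ‖x‖ ≤ c := by
  have h1 : ‖x‖ₑ ≤ ENNReal.ofReal c := by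
    by_contra hlt
    exact absurd h (not_le.mpr (ENNReal.pow_lt_pow_left two_ne_zero (not_le.mp hlt)))
  rw [← ofReal_norm] at h1
  exact (ENNReal.ofReal_le_ofReal_iff hc).mp h1

theorem tendsto_toLp_of_dominated {F : ℕ → α → V} {f : α → V} {g : α → ℝ}
    (hF : ∀ m, MemLp (F m) 2 μ) (hf : MemLp f 2 μ) (hg : MemLp g 2 μ)
    (hb : ∀ m x, ‖F m x‖ ≤ g x)
        (hlim : ∀ x, Filter.Tendsto (fun m => F m x) Filter.atTop (nhds (f x))) :
    Filter.Tendsto (fun m => (hF m).toLp (F m)) Filter.atTop (nhds (hf.toLp f)) := by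
  have hbf : ∀ x, ‖f x‖ ≤ g x := fun x =>
    le_of_tendsto (hlim x).norm (Filter.Eventually.of_forall fun m => hb m x)
  have h1 : Filter.Tendsto (fun m => ∫⁻ x, ‖F m x - f x‖ₑ ^ 2 ∂μ) Filter.atTop
      (nhds (∫⁻ _, 0 ∂μ)) := by
    refine tendsto_lintegral_of_dominated_convergence' (fun x => ‖(2 : ℝ) * g x‖ₑ ^ 2)
      (fun m => ((hF m).1.sub hf.1).enorm.pow_const 2) ?_ ?_ ?_
    · intro m
      refine Filter.Eventually.of_forall fun x => ?_
      have h2 : ‖F m x - f x‖ ≤ ‖(2 : ℝ) * g x‖ := by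
        have h0 : 0 ≤ g x := (norm_nonneg _).trans (hbf x)
        rw [Real.norm_of_nonneg (by positivity)]
        linarith [norm_sub_le (F m x) (f x), hb m x, hbf x]
      have h3 : ‖F m x - f x‖ₑ ≤ ‖(2 : ℝ) * g x‖ₑ := enorm_le_iff_norm_le.mpr h2
      exact pow_le_pow_left' h3 2
    · have h2 := lintegral_enorm_sq_toLp (hg.const_mul 2)
      rw [← h2]
      exact ENNReal.pow_ne_top enorm_ne_top
    · refine Filter.Eventually.of_forall fun x => ?_
      have h2 : Filter.Tendsto (fun m => ‖F m x - f x‖ₑ ^ 2) Filter.atTop (nhds (‖f x - f x‖ₑ ^ 2)) :=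
        ((ENNReal.continuous_pow 2).tendsto _).comp
          ((continuous_enorm.tendsto _).comp ((hlim x).sub_const (f x)))
      simpa using h2
  rw [lintegral_zero] at h1
  rw [tendsto_iff_edist_tendsto_0]
  have h2 : ∀ m, edist ((hF m).toLp (F m)) (hf.toLp f) ^ 2 = ∫⁻ x, ‖F m x - f x‖ₑ ^ 2 ∂μ := by
    intro m
    rw [edist_eq_enorm_sub, ← MemLp.toLp_sub, lintegral_enorm_sq_toLp]
    rfl
  simp_rw [← h2] at h1
  have h3 := ((ENNReal.continuous_rpow_const (y := (1 / 2 : ℝ))).tendsto _).comp h1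
  refine (h3.congr fun m => ?_).trans (by norm_num)
  rw [Function.comp_apply, ← ENNReal.rpow_two, ← ENNReal.rpow_mul]
  norm_num

end L2Norm

variable {n d : ℕ}

section Translate

variable {V : Type} [NormedAddCommGroup V] [NormedSpace ℂ V]

/-- Translation `u ↦ u (· + h)` on `L²(ℝ^d)`. -/
def translate (h : Space d) : Lp V 2 (volume : Measure (Space d)) →ₗᵢ[ℂ]
    Lp V 2 (volume : Measure (Space d)) :=
  Lp.compMeasurePreservingₗᵢ ℂ (fun x => x + h) (measurePreserving_add_right volume h)

theorem coeFn_translate (h : Space d) (u : Lp V 2 (volume : Measure (Space d))) :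
    translate h u =ᵐ[volume] fun x => u (x + h) :=
  Lp.coeFn_compMeasurePreserving u (measurePreserving_add_right volume h)

theorem lintegral_translate_sub (h : Space d) (u : Lp V 2 (volume : Measure (Space d))) :
    ∫⁻ x, ‖u (x + h) - u x‖ₑ ^ 2 = ‖translate h u - u‖ₑ ^ 2 := by
  rw [← lintegral_enorm_sq]
  refine lintegral_congr_ae ?_
  filter_upwards [Lp.coeFn_sub (translate h u) u, coeFn_translate h u] with x h1 h2
  rw [h1, Pi.sub_apply, h2]

theorem tendsto_translate (u : Lp V 2 (volume : Measure (Space d))) :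
    Filter.Tendsto (fun h => translate h u) (nhds 0) (nhds u) := by
  have h0 : u = Lp.compMeasurePreserving (fun x : Space d => x + 0)
      (measurePreserving_add_right volume 0) u := by
    refine Lp.ext ?_
    filter_upwards [Lp.coeFn_compMeasurePreserving u
      (measurePreserving_add_right (volume : Measure (Space d)) 0)] with x hx
    rw [hx]
    simp
  conv => rhs; rw [h0]
  let g : Space d → C(Space d, Space d) := fun h => ⟨fun x => x + h, by fun_prop⟩
  have hg : Continuous g :=
    ContinuousMap.continuous_of_continuous_uncurry _ (by
      change Continuous fun p : Space d × Space d => p.2 + p.1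
      fun_prop)
  exact Filter.Tendsto.compMeasurePreservingLp (g := g) (g₀ := g 0) tendsto_const_nhds
    (hg.tendsto 0) (fun h => measurePreserving_add_right volume h)
    (measurePreserving_add_right volume 0) (by norm_num)

end Translate

/-! ### Columns of matrices -/

/-- The `j`-th column of a matrix. -/
def col (j : Fin d) : Mat n d →L[ℂ] Vec n :=
  LinearMap.toContinuousLinearMap
    { toFun := fun M => WithLp.toLp 2 fun i => M (i, j)
      map_add' := fun _ _ => rfl
      map_smul' := fun _ _ => rfl }

/-- The matrix `v ⊗ e_j`. -/
def colEmb (j : Fin d) : Vec n →L[ℂ] Mat n d :=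
  LinearMap.toContinuousLinearMap
    { toFun := fun v => WithLp.toLp 2 fun ij => if ij.2 = j then v ij.1 else 0
      map_add' := fun _ _ => by
        ext ij
        simp only [PiLp.add_apply]
        split_ifs <;> simp
      map_smul' := fun _ _ => by
        ext ij
        simp }

@[simp] theorem col_apply (j : Fin d) (M : Mat n d) (i : Fin n) : col j M i = M (i, j) := rfl

@[simp] theorem colEmb_apply (j : Fin d) (v : Vec n) (ij : Fin n × Fin d) :
    colEmb j v ij = if ij.2 = j then v ij.1 else 0 := rfl

theorem norm_sq_eq_sum_col (M : Mat n d) : ‖M‖ ^ 2 = ∑ j, ‖col j M‖ ^ 2 := by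
  simp only [EuclideanSpace.norm_sq_eq, col_apply]
  rw [Fintype.sum_prod_type, Finset.sum_comm]

theorem norm_col_le (j : Fin d) (M : Mat n d) : ‖col j M‖ ≤ ‖M‖ := by
  refine le_of_sq_le_sq ?_ (norm_nonneg _)
  rw [norm_sq_eq_sum_col M]
  exact Finset.single_le_sum (f := fun j => ‖col j M‖ ^ 2) (fun _ _ => sq_nonneg _)
    (Finset.mem_univ j)

theorem norm_colEmb (j : Fin d) (v : Vec n) : ‖colEmb j v‖ = ‖v‖ := by
  refine (sq_eq_sq₀ (norm_nonneg _) (norm_nonneg _)).mp ?_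
  simp only [EuclideanSpace.norm_sq_eq, colEmb_apply]
  rw [Fintype.sum_prod_type]
  refine Finset.sum_congr rfl fun i _ => ?_
  rw [Finset.sum_eq_single j]
  · simp
  · intro b _ hb
    simp [hb]
  · simp

theorem inner_colEmb (j : Fin d) (v : Vec n) (M : Mat n d) :
    inner ℂ (colEmb j v) M = inner ℂ v (col j M) := by
  simp only [PiLp.inner_apply, col_apply, colEmb_apply]
  rw [Fintype.sum_prod_type]
  refine Finset.sum_congr rfl fun i _ => ?_
  rw [Finset.sum_eq_single j]
  · simp
  · intro b _ hb
    simp [hb]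
  · simp

theorem col_classicalGrad (j : Fin d) (ψ : Space d → Vec n) (x : Space d) :
    col j (classicalGrad ψ x) = fderiv ℝ ψ x (basisVec j) := rfl

theorem classicalGrad_smul {c : Space d → ℂ} {ψ : Space d → Vec n} {x : Space d}
    (hc : DifferentiableAt ℝ c x) (hψ : DifferentiableAt ℝ ψ x) :
    classicalGrad (fun y => c y • ψ y) x =
      c x • classicalGrad ψ x + ∑ j, fderiv ℝ c x (basisVec j) • colEmb j (ψ x) := by
  have h : fderiv ℝ (fun y => c y • ψ y) x = c x • fderiv ℝ ψ x +
      (fderiv ℝ c x).smulRight (ψ x) := (hc.hasFDerivAt.smul hψ.hasFDerivAt).fderiv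
  ext ⟨i, j⟩
  simp [classicalGrad, h]

theorem norm_fderiv_apply_le (ψ : Space d → Vec n) (x h : Space d) :
    ‖fderiv ℝ ψ x h‖ ≤ ‖h‖ * ‖classicalGrad ψ x‖ := by
  have h1 : h = ∑ j, h j • (basisVec j : Space d) := by
    ext i
    simp [basisVec, Pi.single_apply]
  conv_lhs => rw [h1]
  rw [map_sum]
  calc _ ≤ ∑ j, ‖h j‖ * ‖col j (classicalGrad ψ x)‖ := by
        refine norm_sum_le_of_le _ fun j _ => ?_
        rw [map_smul, norm_smul, col_classicalGrad]
    _ ≤ √(∑ j, ‖h j‖ ^ 2) * √(∑ j, ‖col j (classicalGrad ψ x)‖ ^ 2) :=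
        Real.sum_mul_le_sqrt_mul_sqrt _ _ _
    _ = _ := by
        rw [← norm_sq_eq_sum_col, ← EuclideanSpace.norm_eq, Real.sqrt_sq (norm_nonneg _)]

/-- The fundamental theorem of calculus along the segment, then Cauchy–Schwarz in `t`. It is kept
pointwise in `x` so that it can be integrated over the whole space for the translation estimate and
over the cell for the Poincaré inequality. -/
theorem enorm_sub_sq_le {ψ : Space d → Vec n} (hψ : ContDiff ℝ 1 ψ) (x h : Space d) :
    ‖ψ (x + h) - ψ x‖ₑ ^ 2 ≤
      ‖h‖ₑ ^ 2 * ∫⁻ t in Set.Ioc (0 : ℝ) 1, ‖classicalGrad ψ (x + t • h)‖ₑ ^ 2 := by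
  have hcg := continuous_classicalGrad hψ
  have h1 : ∫ t in (0 : ℝ)..1, fderiv ℝ ψ (x + t • h) h = ψ (x + h) - ψ x := by
    have hd : ∀ t ∈ Set.uIcc (0 : ℝ) 1,
        HasDerivAt (fun t : ℝ => ψ (x + t • h)) (fderiv ℝ ψ (x + t • h) h) t := by
      intro t _
      have h2 : HasDerivAt (fun t : ℝ => x + t • h) h t := by
        simpa using ((hasDerivAt_id t).smul_const h).const_add x
      exact (hψ.differentiable one_ne_zero _).hasFDerivAt.comp_hasDerivAt t h2
    have h3 := intervalIntegral.integral_eq_sub_of_hasDerivAt hd (by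
      refine Continuous.intervalIntegrable ?_ _ _
      exact ((hψ.continuous_fderiv one_ne_zero).comp (by fun_prop)).clm_apply continuous_const)
    simpa using h3
  rw [← h1, intervalIntegral.integral_of_le zero_le_one]
  have hm : Measurable fun t : ℝ => ‖classicalGrad ψ (x + t • h)‖ₑ :=
    (hcg.comp (by fun_prop : Continuous fun t : ℝ => x + t • h)).measurable.enorm
  calc _ ≤ (∫⁻ t in Set.Ioc (0 : ℝ) 1, ‖h‖ₑ * ‖classicalGrad ψ (x + t • h)‖ₑ) ^ 2 := by
        gcongr
        refine (enorm_integral_le_lintegral_enorm _).trans (lintegral_mono fun t => ?_)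
        rw [← enorm_norm h, ← enorm_norm (classicalGrad _ _), ← enorm_mul]
        refine enorm_le_iff_norm_le.mpr ?_
        rw [Real.norm_of_nonneg (by positivity)]
        exact norm_fderiv_apply_le _ _ _
    _ ≤ (∫⁻ t in Set.Ioc (0 : ℝ) 1, 1 ^ 2) *
          ∫⁻ t in Set.Ioc (0 : ℝ) 1, (‖h‖ₑ * ‖classicalGrad ψ (x + t • h)‖ₑ) ^ 2 := by
        have := lintegral_mul_sq_le (μ := volume.restrict (Set.Ioc (0 : ℝ) 1)) (f := fun _ => 1)
          (g := fun t => ‖h‖ₑ * ‖classicalGrad ψ (x + t • h)‖ₑ) aemeasurable_const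
          (hm.const_mul _).aemeasurable
        simpa only [one_mul] using this
    _ = _ := by
        simp_rw [mul_pow]
        rw [lintegral_const_mul _ (hm.pow_const 2)]
        simp

end

section

/-! ### Density of test functions in `H¹` and translation estimates -/

variable {n d : ℕ}

/-- The pairs `(ψ, ∇ψ)` for smooth, compactly supported `ψ`. -/
def testPairs (n d : ℕ) : Set (L2Vec n d × L2Mat n d) :=
  {p | ∃ ψ : Space d → Vec n, ContDiff ℝ ∞ ψ ∧ HasCompactSupport ψ ∧
    p.1 =ᵐ[volume] ψ ∧ p.2 =ᵐ[volume] classicalGrad ψ}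

/-- Dilations `b (x / (m + 1))` of one bump have uniformly bounded derivatives. Equality with `1`
near each point, not just at it, makes the derivatives of the truncated functions eventually agree
with the original ones. -/
theorem exists_cutoff (d : ℕ) : ∃ (M : ℝ) (c : ℕ → Space d → ℂ), 0 ≤ M ∧
    (∀ m, ContDiff ℝ ∞ (c m)) ∧ (∀ m, HasCompactSupport (c m)) ∧ (∀ m x, ‖c m x‖ ≤ 1) ∧
    (∀ m x j, ‖fderiv ℝ (c m) x (basisVec j)‖ ≤ M) ∧
    ∀ x, ∀ᶠ m in Filter.atTop, ∀ᶠ y in nhds x, c m y = 1 := by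
  let b : ContDiffBump (0 : Space d) := ⟨1, 2, one_pos, one_lt_two⟩
  let B : Space d → ℂ := fun x => (b x : ℂ)
  have hB : ContDiff ℝ ∞ B := Complex.ofRealCLM.contDiff.comp b.contDiff
  have hBc : HasCompactSupport B :=
    b.hasCompactSupport.comp_left (g := fun r : ℝ => (r : ℂ)) Complex.ofReal_zero
  have hm0 : ∀ m : ℕ, (((m : ℝ) + 1)⁻¹) ≠ 0 := fun m => by positivity
  obtain ⟨M, hM⟩ := (hBc.fderiv ℝ).exists_bound_of_continuous (hB.continuous_fderiv (by simp))
  refine ⟨M, fun m x => B (((m : ℝ) + 1)⁻¹ • x), (norm_nonneg _).trans (hM 0),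
    fun m => hB.comp (contDiff_const_smul _), fun m => hBc.comp_smul (hm0 m), ?_, ?_, ?_⟩
  · intro m x
    simp only [B, Complex.norm_real]
    rw [Real.norm_of_nonneg b.nonneg]
    exact b.le_one
  · intro m x j
    have hsm : HasFDerivAt (fun x : Space d => ((m : ℝ) + 1)⁻¹ • x)
        (((m : ℝ) + 1)⁻¹ • ContinuousLinearMap.id ℝ (Space d)) x :=
      (hasFDerivAt_id x).const_smul (((m : ℝ) + 1)⁻¹)
    have h : HasFDerivAt (fun x => B (((m : ℝ) + 1)⁻¹ • x))
        ((fderiv ℝ B (((m : ℝ) + 1)⁻¹ • x)).comp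
          (((m : ℝ) + 1)⁻¹ • ContinuousLinearMap.id ℝ (Space d))) x :=
      ((hB.differentiable (by simp)) _).hasFDerivAt.comp x hsm
    rw [h.fderiv]
    simp only [ContinuousLinearMap.comp_apply, smul_apply,
      ContinuousLinearMap.id_apply, map_smul, norm_smul]
    have h3 : ‖fderiv ℝ B (((m : ℝ) + 1)⁻¹ • x) (basisVec j)‖ ≤ M := by
      refine (ContinuousLinearMap.le_opNorm _ _).trans ?_
      simpa [basisVec] using hM (((m : ℝ) + 1)⁻¹ • x)
    have h4 : ‖((m : ℝ) + 1)⁻¹‖ ≤ 1 := by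
      rw [Real.norm_of_nonneg (by positivity)]
      exact inv_le_one_of_one_le₀ (by linarith [(Nat.cast_nonneg m : (0 : ℝ) ≤ m)])
    calc _ ≤ 1 * M := by gcongr
      _ = M := one_mul M
  · intro x
    obtain ⟨N, hN⟩ := exists_nat_gt ‖x‖
    filter_upwards [Filter.eventually_ge_atTop N] with m hm
    have h3 : ∀ᶠ y in nhds x, ‖y‖ < (m : ℝ) + 1 := by
      refine (continuous_norm.tendsto x).eventually (gt_mem_nhds ?_)
      have : (N : ℝ) ≤ m := by exact_mod_cast hm
      linarith
    filter_upwards [h3] with y hy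
    have hb1 : b (((m : ℝ) + 1)⁻¹ • y) = 1 := by
      refine b.one_of_mem_closedBall ?_
      rw [mem_closedBall_zero_iff, norm_smul, Real.norm_of_nonneg (by positivity),
        inv_mul_le_iff₀ (by positivity)]
      change ‖y‖ ≤ ((m : ℝ) + 1) * 1
      linarith
    simp only [B, hb1, Complex.ofReal_one]

/-- Truncation: the product rule bounds the gradient of `c_m ψ` by `|∇ψ| + d M |ψ|` uniformly in
`m`, so dominated convergence applies to functions and gradients. -/
theorem smooth_mem_closure_testPairs {ψ : Space d → Vec n} (hψ : ContDiff ℝ ∞ ψ)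
    (h1 : MemLp ψ 2 volume) (h2 : MemLp (classicalGrad ψ) 2 volume) :
    (h1.toLp ψ, h2.toLp (classicalGrad ψ)) ∈ closure (testPairs n d) := by
  obtain ⟨M, c, hM0, hc, hcc, hc1, hcd, hce⟩ := exists_cutoff d
  have hF : ∀ m, ContDiff ℝ ∞ fun x => c m x • ψ x := fun m => (hc m).smul hψ
  have hFc : ∀ m, HasCompactSupport fun x => c m x • ψ x := fun m => (hcc m).smul_right
  have hF1 : ∀ m, MemLp (fun x => c m x • ψ x) 2 volume := fun m =>
    (hF m).continuous.memLp_of_hasCompactSupport (hFc m)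
  have hF2 : ∀ m, MemLp (classicalGrad fun x => c m x • ψ x) 2 volume := fun m =>
    (continuous_classicalGrad ((hF m).of_le (by simp))).memLp_of_hasCompactSupport
      (hasCompactSupport_classicalGrad (hFc m))
  have hFev : ∀ x : Space d, ∀ᶠ m in Filter.atTop,
      (fun y => c m y • ψ y) =ᶠ[nhds x] ψ := by
    intro x
    filter_upwards [hce x] with m hm
    filter_upwards [hm] with y hy
    rw [hy, one_smul]
  have ht1 := tendsto_toLp_of_dominated (g := fun x => ‖ψ x‖) hF1 h1 h1.norm (by
      intro m x
      rw [norm_smul]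
      exact mul_le_of_le_one_left (norm_nonneg _) (hc1 m x)) (by
      intro x
      refine tendsto_const_nhds.congr' ?_
      filter_upwards [hFev x] with m hm
      exact hm.self_of_nhds.symm)
  have hg : MemLp (fun x => ‖classicalGrad ψ x‖ + (d * M) * ‖ψ x‖) 2 volume :=
    h2.norm.add (h1.norm.const_mul _)
  have hbd : ∀ m x, ‖classicalGrad (fun x => c m x • ψ x) x‖ ≤
      ‖classicalGrad ψ x‖ + (d * M) * ‖ψ x‖ := by
    intro m x
    rw [classicalGrad_smul ((hc m).differentiable (by simp) x) (hψ.differentiable (by simp) x)]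
    refine (norm_add_le _ _).trans (add_le_add ?_ ?_)
    · rw [norm_smul]
      exact mul_le_of_le_one_left (norm_nonneg _) (hc1 m x)
    · calc _ ≤ ∑ _j : Fin d, M * ‖ψ x‖ := by
            refine norm_sum_le_of_le _ fun j _ => ?_
            rw [norm_smul, norm_colEmb]
            exact mul_le_mul_of_nonneg_right (hcd m x j) (norm_nonneg _)
        _ = _ := by simp [mul_assoc]
  have ht2 := tendsto_toLp_of_dominated hF2 h2 hg hbd (by
      intro x
      refine tendsto_const_nhds.congr' ?_
      filter_upwards [hFev x] with m hm
      simp only [classicalGrad, hm.fderiv_eq])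
  refine mem_closure_of_tendsto (ht1.prodMk_nhds ht2) (Filter.Eventually.of_forall fun m => ?_)
  exact ⟨_, hF m, hFc m, (hF1 m).coeFn_toLp, (hF2 m).coeFn_toLp⟩

theorem moll_clm {V W : Type*} [NormedAddCommGroup V] [NormedSpace ℝ V] [CompleteSpace V]
    [NormedAddCommGroup W] [NormedSpace ℝ W] [CompleteSpace W] {k : Space d → ℝ} (hk : Continuous k)
    (hc : HasCompactSupport k) {f : Space d → V} (hf : LocallyIntegrable f) (L : V →L[ℝ] W)
    (x : Space d) : moll k (fun y => L (f y)) x = L (moll k f x) := by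
  rw [moll, moll, ← L.integral_comp_comm (integrable_moll hk hc hf x)]
  simp_rw [map_smul]

theorem locallyIntegrable_lp {V : Type*} [NormedAddCommGroup V]
    (f : Lp V 2 (volume : Measure (Space d))) :
    LocallyIntegrable f volume :=
  (Lp.memLp f).locallyIntegrable (by norm_num)

theorem classicalGrad_moll {u : L2Vec n d} {g : L2Mat n d} (hug : IsWeakGrad u g)
    {k : Space d → ℝ} (hk : ContDiff ℝ ∞ k) (hc : HasCompactSupport k) :
    classicalGrad (moll k u) = moll k g := by
  funext x
  ext ⟨i, j⟩
  have hu := locallyIntegrable_lp u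
  have hg := locallyIntegrable_lp g
  let Li : Vec n →L[ℝ] ℂ := (EuclideanSpace.proj i : Vec n →L[ℂ] ℂ).restrictScalars ℝ
  let Lij : Mat n d →L[ℝ] ℂ := (EuclideanSpace.proj (i, j) : Mat n d →L[ℂ] ℂ).restrictScalars ℝ
  change Li (fderiv ℝ (moll k u) x (basisVec j)) = Lij (moll k g x)
  rw [fderiv_moll hk hc hu, ← moll_clm (continuous_partial hk j) (hc.fderiv_apply ℝ _) hu,
    ← moll_clm hk.continuous hc hg]
  exact moll_fderiv_eq hk hc (fun φ h1 h2 => hug φ h1 h2 i j) x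

theorem memLp_moll {V : Type} [NormedAddCommGroup V] [NormedSpace ℂ V] [CompleteSpace V]
    {ρ C ε : ℝ} {k : Space d → ℝ} (hk : OscKernel ρ C ε k)
        {f : Space d → V} (hf : MemLp f 2 volume) :
    MemLp (moll k f) 2 volume := by
  refine memLp_two_of_lintegral_lt_top (aestronglyMeasurable_moll hk.contDiff
    hk.hasCompactSupport (hf.locallyIntegrable (by norm_num))) ?_
  have h := hk.lintegral_mul_moll_le (F := fun _ => 1) measurable_const hf.1
  simp only [one_mul, lintegral_const, measure_univ] at h
  refine h.trans_lt ?_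
  rw [← lintegral_enorm_sq_toLp hf]
  exact ENNReal.pow_lt_top enorm_lt_top

theorem norm_moll_sub_le {V : Type} [NormedAddCommGroup V] [NormedSpace ℂ V] [CompleteSpace V]
    {ρ C ε : ℝ} {k : Space d → ℝ} (hk : OscKernel ρ C ε k)
    (f : Lp V 2 (volume : Measure (Space d))) {D : ℝ} (hD0 : 0 ≤ D)
    (hD : ∀ h : Space d, ‖h‖ ≤ ρ * ε → ‖translate h f - f‖ ≤ D) :
    ‖(memLp_moll hk (Lp.memLp f)).toLp _ - f‖ ≤ D := by
  refine norm_le_of_enorm_sq_le hD0 ?_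
  have h := lintegral_moll_sub_le hk.contDiff.continuous hk.hasCompactSupport hk.support
    (locallyIntegrable_lp f) (D := ENNReal.ofReal D ^ 2) (fun h hh => by
      rw [lintegral_translate_sub]
      refine pow_le_pow_left' ?_ 2
      rw [← ofReal_norm]
      exact ENNReal.ofReal_le_ofReal (hD h hh))
  rw [hk.integral_eq_one, hk.lintegral_enorm, one_pow, one_mul] at h
  rw [← lintegral_enorm_sq]
  refine le_trans (le_of_eq (lintegral_congr_ae ?_)) h
  filter_upwards [Lp.coeFn_sub ((memLp_moll hk (Lp.memLp f)).toLp _) f,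
    (memLp_moll hk (Lp.memLp f)).coeFn_toLp] with x h1 h2
  rw [h1, Pi.sub_apply, h2, one_smul]

theorem exists_norm_translate_sub_le {V : Type} [NormedAddCommGroup V] [NormedSpace ℂ V]
    (f : Lp V 2 (volume : Measure (Space d))) {η : ℝ} (hη : 0 < η) :
    ∃ r > 0, ∀ h : Space d, ‖h‖ ≤ r → ‖translate h f - f‖ ≤ η := by
  obtain ⟨r, hr, h⟩ := Metric.eventually_nhds_iff.mp
    ((tendsto_translate f).eventually (Metric.closedBall_mem_nhds f hη))
  refine ⟨r / 2, half_pos hr, fun x hx => ?_⟩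
  rw [← dist_eq_norm]
  refine h ?_
  rw [dist_zero_right]
  linarith

/-- Mollification commutes with the weak gradient and converges in `L²` for both components, because
translation is continuous in `L²`; the smooth approximants are then truncated. -/
theorem gradGraph_subset_closure_testPairs {u : L2Vec n d} {g : L2Mat n d}
    (hug : IsWeakGrad u g) : (u, g) ∈ closure (testPairs n d) := by
  obtain ⟨ρ, C, hρ, _, hk⟩ := exists_oscKernel d
  rw [← closure_closure, Metric.mem_closure_iff]
  intro η hη
  obtain ⟨r₁, hr₁, h₁⟩ := exists_norm_translate_sub_le u (half_pos hη)
  obtain ⟨r₂, hr₂, h₂⟩ := exists_norm_translate_sub_le g (half_pos hη)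
  -- The scale makes the support radius of the kernel equal to `min r₁ r₂`, the shift allowed for
  -- both `u` and `g`.
  obtain ⟨k, hk⟩ := hk (min r₁ r₂ / ρ) (by positivity)
  have he : ρ * (min r₁ r₂ / ρ) = min r₁ r₂ := mul_div_cancel₀ _ hρ.ne'
  have hu := norm_moll_sub_le hk u (half_pos hη).le fun h hh =>
    h₁ h ((he ▸ hh).trans (min_le_left _ _))
  have hg := norm_moll_sub_le hk g (half_pos hη).le fun h hh =>
    h₂ h ((he ▸ hh).trans (min_le_right _ _))
  have hcg := classicalGrad_moll hug hk.contDiff hk.hasCompactSupport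
  have hm : MemLp (classicalGrad (moll k u)) 2 volume := by
    rw [hcg]
    exact memLp_moll hk (Lp.memLp g)
  refine ⟨_, smooth_mem_closure_testPairs (contDiff_moll hk.contDiff hk.hasCompactSupport
    (locallyIntegrable_lp u)) (memLp_moll hk (Lp.memLp u)) hm, ?_⟩
  rw [Prod.dist_eq, max_lt_iff]
  constructor
  · rw [dist_comm, dist_eq_norm]
    exact hu.trans_lt (half_lt_self hη)
  · rw [dist_comm, dist_eq_norm]
    simp only [hcg]
    exact hg.trans_lt (half_lt_self hη)

/-- By density it suffices to treat test functions, for which `enorm_sub_sq_le` is integrated over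
`x`; translation invariance removes the dependence on `t`. -/
theorem norm_translate_sub_le {u : L2Vec n d} {g : L2Mat n d} (hug : IsWeakGrad u g)
    (h : Space d) : ‖translate h u - u‖ ≤ ‖h‖ * ‖g‖ := by
  have hcl : IsClosed {p : L2Vec n d × L2Mat n d | ‖translate h p.1 - p.1‖ ≤ ‖h‖ * ‖p.2‖} := by
    refine isClosed_le ?_ (by fun_prop)
    exact (((translate h).continuous.comp continuous_fst).sub continuous_fst).norm
  suffices hsub : testPairs n d ⊆
      {p : L2Vec n d × L2Mat n d | ‖translate h p.1 - p.1‖ ≤ ‖h‖ * ‖p.2‖} by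
    have hmem : (u, g) ∈ {p : L2Vec n d × L2Mat n d | ‖translate h p.1 - p.1‖ ≤ ‖h‖ * ‖p.2‖} :=
      closure_minimal hsub hcl (gradGraph_subset_closure_testPairs hug)
    exact hmem
  rintro ⟨v, G⟩ ⟨ψ, hψ, hc, hv, hG⟩
  refine norm_le_of_enorm_sq_le (by positivity) ?_
  have hψ1 : ContDiff ℝ 1 ψ := hψ.of_le (by simp)
  have hcg := continuous_classicalGrad hψ1
  rw [ENNReal.ofReal_mul (norm_nonneg _), ofReal_norm, ofReal_norm, mul_pow,
    ← lintegral_translate_sub, ← lintegral_enorm_sq G]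
  have h1 : ∫⁻ x, ‖v (x + h) - v x‖ₑ ^ 2 = ∫⁻ x, ‖ψ (x + h) - ψ x‖ₑ ^ 2 := by
    refine lintegral_congr_ae ?_
    filter_upwards [hv, (measurePreserving_add_right volume h).quasiMeasurePreserving.ae_eq_comp hv]
      with x h1 h2
    simp only [Function.comp_apply] at h2
    rw [h1, h2]
  have h2 : ∫⁻ x, ‖G x‖ₑ ^ 2 = ∫⁻ x, ‖classicalGrad ψ x‖ₑ ^ 2 := by
    refine lintegral_congr_ae ?_
    filter_upwards [hG] with x h1
    rw [h1]
  rw [h1, h2]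
  have hm : Measurable fun p : Space d × ℝ => ‖classicalGrad ψ (p.1 + p.2 • h)‖ₑ ^ 2 :=
    ((hcg.comp (by fun_prop : Continuous fun p : Space d × ℝ => p.1 + p.2 • h)).measurable.enorm).pow_const 2
  calc _ ≤ ∫⁻ x, ‖h‖ₑ ^ 2 * ∫⁻ t in Set.Ioc (0 : ℝ) 1, ‖classicalGrad ψ (x + t • h)‖ₑ ^ 2 :=
        lintegral_mono fun x => enorm_sub_sq_le hψ1 x h
    _ = ‖h‖ₑ ^ 2 * ∫⁻ t in Set.Ioc (0 : ℝ) 1, ∫⁻ x, ‖classicalGrad ψ (x + t • h)‖ₑ ^ 2 := by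
        rw [lintegral_const_mul _ hm.lintegral_prod_right',
          lintegral_lintegral_swap hm.aemeasurable]
    _ = _ := by
        simp_rw [lintegral_add_right_eq_self (fun x => ‖classicalGrad ψ x‖ₑ ^ 2)]
        simp

end

section

/-! ### Averages over the cell -/

variable {n d : ℕ}

section Average

variable {V : Type} [NormedAddCommGroup V] [InnerProductSpace ℂ V]

/-- Constant functions on the cell. -/
def cellConst (d : ℕ) (V : Type) [NormedAddCommGroup V] [InnerProductSpace ℂ V] :
    V →L[ℂ] Lp V 2 (cellMeasure d) :=
  Lp.constL 2 (cellMeasure d) ℂ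

/-- The average over the cell. -/
def cellAvg (d : ℕ) (V : Type) [NormedAddCommGroup V] [InnerProductSpace ℂ V] [CompleteSpace V] :
    Lp V 2 (cellMeasure d) →L[ℂ] V :=
  ContinuousLinearMap.adjoint (cellConst d V)

theorem coeFn_cellConst (v : V) : cellConst d V v =ᵐ[cellMeasure d] fun _ => v :=
  Lp.coeFn_const 2 (cellMeasure d) v

theorem norm_cellConst (v : V) : ‖cellConst d V v‖ = ‖v‖ := by
  have h := Lp.norm_const 2 (cellMeasure d) v two_ne_zero
  change ‖Lp.const 2 (cellMeasure d) v‖ = ‖v‖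
  simpa using h

theorem integrable_cell {V : Type} [NormedAddCommGroup V]
    (u : Lp V 2 (cellMeasure d)) : Integrable u (cellMeasure d) :=
  (Lp.memLp u).integrable (by norm_num)

theorem cellAvg_apply [CompleteSpace V] (u : Lp V 2 (cellMeasure d)) :
    cellAvg d V u = ∫ y in cell d, u y := by
  refine ext_inner_left ℂ fun v => ?_
  rw [cellAvg, ContinuousLinearMap.adjoint_inner_right, L2.inner_def,
    ← integral_inner (integrable_cell u)]
  refine integral_congr_ae ?_
  filter_upwards [coeFn_cellConst (d := d) v] with x hx
  rw [hx]

theorem inner_cellConst [CompleteSpace V] (v : V) (u : Lp V 2 (cellMeasure d)) :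
    inner ℂ (cellConst d V v) u = inner ℂ v (cellAvg d V u) :=
  (ContinuousLinearMap.adjoint_inner_right _ _ _).symm

theorem cellAvg_cellConst [CompleteSpace V] (v : V) : cellAvg d V (cellConst d V v) = v := by
  rw [cellAvg_apply, integral_congr_ae (coeFn_cellConst v), integral_const]
  simp

/-- Averaging a periodic function against a translated kernel gives its cell average. -/
theorem OscKernel.integral_smul {ρ C ε : ℝ} {k : Space d → ℝ} (hk : OscKernel ρ C ε k)
    {f : Space d → V} (hf : AEStronglyMeasurable f (cellMeasure d)) (y : Space d) :
    ∫ x, k (x - y) • f (cellFract (ε⁻¹ • x)) = ∫ x in cell d, f x := by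
  have hkm : Measurable k := hk.contDiff.continuous.measurable
  have hm : Measurable fun x : Space d => ENNReal.ofReal (k (x - y)) := by fun_prop
  have hq : Measurable fun x : Space d => cellFract (ε⁻¹ • x) := by fun_prop
  -- The kernel identity, read on indicators, says that the measure with density `k (x - y)` is
  -- carried to the cell measure by reduction modulo the `ε`-lattice. This gives the Bochner
  -- integral without splitting into positive parts.
  have hmap : Measure.map (fun x : Space d => cellFract (ε⁻¹ • x))
      (volume.withDensity fun x => ENNReal.ofReal (k (x - y))) = cellMeasure d := by
    ext s hs
    rw [Measure.map_apply hq hs, withDensity_apply _ (hq hs), ← lintegral_indicator (hq hs)]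
    have h := hk.lintegral (s.indicator 1) (measurable_one.indicator hs) y
    rw [lintegral_indicator_one hs] at h
    rw [← h]
    refine lintegral_congr fun x => ?_
    by_cases hx : cellFract (ε⁻¹ • x) ∈ s
    · simp [Set.indicator, hx]
    · simp [Set.indicator, hx]
  rw [← hmap] at hf
  conv_rhs => rw [← cellMeasure, ← hmap]
  rw [integral_map hq.aemeasurable hf, integral_withDensity_eq_integral_toReal_smul hm
    (Filter.Eventually.of_forall fun x => ENNReal.ofReal_lt_top)]
  simp_rw [ENNReal.toReal_ofReal (hk.nonneg _)]

end Average

/-! ### Periodic functions -/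

/-- Strict periodicity with respect to the integer lattice. -/
def IsLatticePeriodic {V : Type*} (φ : Space d → V) : Prop :=
  ∀ (k : Fin d → ℤ) (y : Space d), φ (y + latticePt k) = φ y

theorem IsLatticePeriodic.comp_cellFract {V : Type*} {φ : Space d → V} (h : IsLatticePeriodic φ)
    (x : Space d) : φ (cellFract x) = φ x := by
  conv_rhs => rw [← cellFract_add_cellFloor x]
  exact (h _ _).symm

theorem IsLatticePeriodic.classicalGrad {φ : Space d → Vec n} (h : IsLatticePeriodic φ) :
    IsLatticePeriodic (classicalGrad φ) := by
  intro k y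
  have h1 : (fun x => φ (x + latticePt k)) = φ := funext (h k)
  have h2 := fderiv_comp_add_right (𝕜 := ℝ) (f := φ) (x := y) (latticePt k)
  rw [h1] at h2
  simp only [FibreHom.classicalGrad, h2]

theorem mem_smoothPairs_iff {p : L2VecCell n d × L2MatCell n d} :
    p ∈ smoothQuasiPeriodicPairs n 0 ↔ ∃ φ : Space d → Vec n, ContDiff ℝ ∞ φ ∧
      IsLatticePeriodic φ ∧ p.1 =ᵐ[cellMeasure d] φ ∧ p.2 =ᵐ[cellMeasure d] classicalGrad φ := by
  simp [smoothQuasiPeriodicPairs, IsLatticePeriodic, planeWave]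

/-! ### Poincaré inequality and the mean of a periodic gradient -/

theorem lintegral_cell_translate {F : Space d → ENNReal} (hF : Measurable F)
    (hp : IsLatticePeriodic F) (c : Space d) :
    ∫⁻ x in cell d, F (x + c) = ∫⁻ x in cell d, F x := by
  rw [← (measurePreserving_cellFract_add c).lintegral_comp hF]
  simp_rw [hp.comp_cellFract]

theorem norm_le_of_mem_cell {h : Space d} (hh : h ∈ cell d) : ‖h‖ ≤ √d := by
  rw [EuclideanSpace.norm_eq]
  refine Real.sqrt_le_sqrt ?_
  calc ∑ i, ‖h i‖ ^ 2 ≤ ∑ _i : Fin d, (1 : ℝ) := by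
        refine Finset.sum_le_sum fun i _ => ?_
        have := hh i
        rw [Real.norm_eq_abs, abs_of_pos this.1]
        nlinarith [this.1, this.2]
    _ = d := by simp

theorem enorm_sq_le_of_mem_cell {h : Space d} (hh : h ∈ cell d) : ‖h‖ₑ ^ 2 ≤ d := by
  have h1 : ‖h‖ ^ 2 ≤ d :=
    (pow_le_pow_left₀ (norm_nonneg _) (norm_le_of_mem_cell hh) 2).trans_eq
      (Real.sq_sqrt (by positivity))
  rw [← ofReal_norm, ← ENNReal.ofReal_pow (norm_nonneg _), ← ENNReal.ofReal_natCast]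
  exact ENNReal.ofReal_le_ofReal h1

/-- By periodicity the mean of `φ` is also the mean of `φ (x + h)` over `h` in the cell, so the
deviation from the mean is an average of differences `φ x - φ (x + h)`. Jensen's inequality and
`enorm_sub_sq_le` reduce these to the gradient on translated cells, and `|h|² ≤ d` gives the
constant. -/
theorem lintegral_sub_average_le {φ : Space d → Vec n} (hφ : ContDiff ℝ ∞ φ)
    (hp : IsLatticePeriodic φ) :
    ∫⁻ x in cell d, ‖φ x - ∫ y in cell d, φ y‖ₑ ^ 2 ≤
      d * ∫⁻ x in cell d, ‖classicalGrad φ x‖ₑ ^ 2 := by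
  have hφ1 : ContDiff ℝ 1 φ := hφ.of_le (by simp)
  have hcg := continuous_classicalGrad hφ1
  have hbd : ∃ M, ∀ x, ‖φ x‖ ≤ M := by
    obtain ⟨M, hM⟩ := (isCompact_closedBall (0 : Space d) (Real.sqrt d)).exists_bound_of_continuousOn
      hφ.continuous.continuousOn
    refine ⟨M, fun x => ?_⟩
    rw [← hp.comp_cellFract x]
    refine hM _ ?_
    rw [mem_closedBall_zero_iff, EuclideanSpace.norm_eq]
    refine Real.sqrt_le_sqrt ?_
    calc ∑ i, ‖cellFract x i‖ ^ 2 ≤ ∑ _i : Fin d, (1 : ℝ) := by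
          refine Finset.sum_le_sum fun i _ => ?_
          change ‖Int.fract (x i)‖ ^ 2 ≤ 1
          have h1 := Int.fract_nonneg (x i)
          have h2 := Int.fract_lt_one (x i)
          rw [Real.norm_eq_abs, abs_of_nonneg h1]
          nlinarith
      _ = d := by simp
  obtain ⟨M, hM⟩ := hbd
  have hint : ∀ x, Integrable (fun h => φ (x + h)) (cellMeasure d) := fun x =>
    Integrable.of_bound (hφ.continuous.comp (by fun_prop)).aestronglyMeasurable M
      (Filter.Eventually.of_forall fun h => hM _)
  have havg : ∀ x, ∫ y in cell d, φ y = ∫ h in cell d, φ (x + h) := by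
    intro x
    have h1 := measurePreserving_cellFract_add x
    have h2 : ∫ y, φ y ∂(Measure.map (fun y => cellFract (y + x)) (cellMeasure d)) =
        ∫ h in cell d, φ (cellFract (h + x)) :=
      integral_map h1.measurable.aemeasurable hφ.continuous.aestronglyMeasurable
    rw [h1.map_eq] at h2
    rw [h2]
    simp_rw [hp.comp_cellFract, add_comm x]
  have hpt : ∀ x, ‖φ x - ∫ y in cell d, φ y‖ₑ ^ 2 ≤ ∫⁻ h in cell d, ‖φ (x + h) - φ x‖ₑ ^ 2 := by
    intro x
    have h1 : φ x - ∫ y in cell d, φ y = ∫ h in cell d, (1 : ℝ) • (φ x - φ (x + h)) := by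
      simp_rw [one_smul]
      rw [integral_sub (integrable_const _) (hint x), ← havg x, integral_const]
      simp
    rw [h1]
    refine (enorm_integral_smul_sq_le aemeasurable_const
      ((integrable_const _).sub (hint x)).aestronglyMeasurable).trans (le_of_eq ?_)
    simp only [enorm_one, lintegral_const, measure_univ, one_mul]
    exact lintegral_congr fun h => by rw [enorm_sub_rev]; rfl
  have hm1 : Measurable fun p : Space d × Space d => ‖φ (p.1 + p.2) - φ p.1‖ₑ ^ 2 := by
    have : Continuous fun p : Space d × Space d => φ (p.1 + p.2) - φ p.1 :=
      (hφ.continuous.comp (by fun_prop)).sub (hφ.continuous.comp (by fun_prop))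
    exact this.measurable.enorm.pow_const 2
  have hm2 : ∀ h : Space d, Measurable fun p : Space d × ℝ =>
      ‖classicalGrad φ (p.1 + p.2 • h)‖ₑ ^ 2 := fun h =>
    ((hcg.comp (by fun_prop : Continuous fun p : Space d × ℝ =>
      p.1 + p.2 • h)).measurable.enorm).pow_const 2
  calc _ ≤ ∫⁻ x in cell d, ∫⁻ h in cell d, ‖φ (x + h) - φ x‖ₑ ^ 2 := lintegral_mono hpt
    _ = ∫⁻ h in cell d, ∫⁻ x in cell d, ‖φ (x + h) - φ x‖ₑ ^ 2 :=
        lintegral_lintegral_swap hm1.aemeasurable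
    _ ≤ ∫⁻ _h in cell d, d * ∫⁻ x in cell d, ‖classicalGrad φ x‖ₑ ^ 2 := by
        refine setLIntegral_mono measurable_const fun h hh => ?_
        calc _ ≤ ∫⁻ x in cell d, ‖h‖ₑ ^ 2 *
                ∫⁻ t in Set.Ioc (0 : ℝ) 1, ‖classicalGrad φ (x + t • h)‖ₑ ^ 2 :=
              lintegral_mono fun x => enorm_sub_sq_le hφ1 x h
          _ = ‖h‖ₑ ^ 2 * ∫⁻ t in Set.Ioc (0 : ℝ) 1,
                ∫⁻ x in cell d, ‖classicalGrad φ (x + t • h)‖ₑ ^ 2 := by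
              rw [lintegral_const_mul _ (hm2 h).lintegral_prod_right',
                lintegral_lintegral_swap (hm2 h).aemeasurable]
          _ = ‖h‖ₑ ^ 2 * ∫⁻ x in cell d, ‖classicalGrad φ x‖ₑ ^ 2 := by
              congr 1
              have h3 : ∀ t : ℝ, ∫⁻ x in cell d, ‖classicalGrad φ (x + t • h)‖ₑ ^ 2 =
                  ∫⁻ x in cell d, ‖classicalGrad φ x‖ₑ ^ 2 := fun t =>
                lintegral_cell_translate (F := fun x => ‖classicalGrad φ x‖ₑ ^ 2)
                  (hcg.measurable.enorm.pow_const 2)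
                  (fun k y => by simp only [hp.classicalGrad k y]) (t • h)
              simp_rw [h3]
              simp
          _ ≤ _ := mul_le_mul' (enorm_sq_le_of_mem_cell hh) le_rfl
    _ = _ := by
        rw [lintegral_const, measure_univ, mul_one]

/-- Both sides are continuous in the pair, so the smooth case passes to the closure. -/
theorem poincare {p : L2VecCell n d × L2MatCell n d} (hp : p ∈ quasiPeriodicH1 n 0) :
    ‖p.1 - cellConst d (Vec n) (cellAvg d (Vec n) p.1)‖ ≤ √d * ‖p.2‖ := by
  have hcl : IsClosed {p : L2VecCell n d × L2MatCell n d |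
      ‖p.1 - cellConst d (Vec n) (cellAvg d (Vec n) p.1)‖ ≤ √d * ‖p.2‖} :=
    isClosed_le (by fun_prop) (by fun_prop)
  refine closure_minimal ?_ hcl hp
  intro q hq
  obtain ⟨φ, hφ, hper, h1, h2⟩ := mem_smoothPairs_iff.mp hq
  refine norm_le_of_enorm_sq_le (by positivity) ?_
  rw [ENNReal.ofReal_mul (by positivity), mul_pow, ← ENNReal.ofReal_pow (by positivity),
    Real.sq_sqrt (by positivity), ENNReal.ofReal_natCast, ofReal_norm, ← lintegral_enorm_sq,
    ← lintegral_enorm_sq]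
  have h3 : cellAvg d (Vec n) q.1 = ∫ y in cell d, φ y := by
    rw [cellAvg_apply]
    exact integral_congr_ae h1
  have h4 : ∫⁻ x in cell d, ‖q.2 x‖ₑ ^ 2 = ∫⁻ x in cell d, ‖classicalGrad φ x‖ₑ ^ 2 := by
    refine lintegral_congr_ae ?_
    filter_upwards [h2] with x hx
    rw [hx]
  rw [h4]
  refine le_trans (le_of_eq (lintegral_congr_ae ?_)) (lintegral_sub_average_le hφ hper)
  filter_upwards [h1, Lp.coeFn_sub q.1 (cellConst d (Vec n) (cellAvg d (Vec n) q.1)),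
    coeFn_cellConst (d := d) (cellAvg d (Vec n) q.1)] with x hx1 hx2 hx3
  rw [hx2, Pi.sub_apply, hx3, hx1, h3]

/-- For smooth periodic `φ`, convolution with a kernel of constant periodisation returns the mean, a
constant. Its derivative therefore vanishes, yet it equals the same convolution of `∇φ`, which is
the mean of `∇φ`. This avoids boundary terms on the faces of the cell. -/
theorem cellAvg_grad_eq_zero {p : L2VecCell n d × L2MatCell n d} (hp : p ∈ quasiPeriodicH1 n 0) :
    cellAvg d (Mat n d) p.2 = 0 := by
  have hcl : IsClosed {p : L2VecCell n d × L2MatCell n d | cellAvg d (Mat n d) p.2 = 0} :=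
    isClosed_eq (by fun_prop) continuous_const
  refine closure_minimal ?_ hcl hp
  intro q hq
  obtain ⟨φ, hφ, hper, -, h2⟩ := mem_smoothPairs_iff.mp hq
  obtain ⟨ρ, C, -, -, hk⟩ := exists_oscKernel d
  obtain ⟨k, hk⟩ := hk 1 one_pos
  have hφ1 : ContDiff ℝ 1 φ := hφ.of_le (by simp)
  have hcg := continuous_classicalGrad hφ1
  -- The averaging identity has `k (x - y)` integrated in `x`, whereas `moll` evaluates the kernel
  -- at the opposite difference; hence the reflection.
  let k' : Space d → ℝ := fun x => k (-x)
  have hk's : ContDiff ℝ ∞ k' := hk.contDiff.comp contDiff_neg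
  have hk'c : HasCompactSupport k' := hk.hasCompactSupport.comp_homeomorph (Homeomorph.neg _)
  have hmoll : ∀ {V : Type} [NormedAddCommGroup V] [InnerProductSpace ℂ V] [CompleteSpace V]
      (f : Space d → V), Continuous f → IsLatticePeriodic f → ∀ y,
      moll k' f y = ∫ x in cell d, f x := by
    intro V _ _ _ f hf hp y
    rw [← hk.integral_smul hf.aestronglyMeasurable y]
    refine integral_congr_ae (Filter.Eventually.of_forall fun x => ?_)
    simp only [k', neg_sub, inv_one, one_smul, hp.comp_cellFract]
  change cellAvg d (Mat n d) q.2 = 0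
  rw [cellAvg_apply, integral_congr_ae h2, ← hmoll (classicalGrad φ) hcg hper.classicalGrad 0]
  ext ⟨i, j⟩
  have hlφ : LocallyIntegrable φ volume := hφ.continuous.locallyIntegrable
  have hlg : LocallyIntegrable (classicalGrad φ) volume := hcg.locallyIntegrable
  have h3 : fderiv ℝ (moll k' φ) 0 (basisVec j) = 0 := by
    have : moll k' φ = fun _ => ∫ x in cell d, φ x := funext (hmoll φ hφ.continuous hper)
    rw [this]
    simp
  rw [fderiv_moll hk's hk'c hlφ, moll_fderiv_eq hk's hk'c (g := fun x => col j (classicalGrad φ x))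
    ?_ 0] at h3
  · let L : Mat n d →L[ℝ] Vec n := (col j).restrictScalars ℝ
    have h4 := moll_clm hk's.continuous hk'c hlg L 0
    change moll k' (fun x => col j (classicalGrad φ x)) 0 = col j (moll k' (classicalGrad φ) 0) at h4
    rw [h4] at h3
    exact congrArg (fun v : Vec n => v i) h3
  · intro θ hθ hθc
    have h5 := integral_smul_fderiv_eq_neg_fderiv_smul_of_integrable
      (μ := (volume : Measure (Space d))) (f := θ) (g := φ) (v := basisVec j) (𝕜 := ℝ)
      (((continuous_partial hθ j).smul hφ.continuous).integrable_of_hasCompactSupport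
        ((hθc.fderiv_apply ℝ (basisVec j)).smul_right))
      ((hθ.continuous.smul ((col j).continuous.comp hcg)).integrable_of_hasCompactSupport
        hθc.smul_right)
      ((hθ.continuous.smul hφ.continuous).integrable_of_hasCompactSupport hθc.smul_right)
      (fun x _ => (hθ.differentiable (by simp)) x) (fun x _ => (hφ.differentiable (by simp)) x)
    simp_rw [col_classicalGrad]
    rw [h5, neg_neg]

end

section

/-! ### The cell problem and the homogenised coefficients -/

variable {n d : ℕ}

/-- The smooth periodic pairs as a subspace. -/
def smoothPeriodicSubmodule (n d : ℕ) : Submodule ℂ (L2VecCell n d × L2MatCell n d) where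
  carrier := smoothQuasiPeriodicPairs n 0
  zero_mem' := by
    refine mem_smoothPairs_iff.mpr ⟨0, contDiff_const, fun _ _ => rfl, Lp.coeFn_zero _ _ _, ?_⟩
    refine (Lp.coeFn_zero _ _ _).trans (Filter.Eventually.of_forall fun x => ?_)
    ext ij
    simp [classicalGrad]
  add_mem' := by
    intro p q hp hq
    obtain ⟨φ, hφ, hφp, h1, h2⟩ := mem_smoothPairs_iff.mp hp
    obtain ⟨ψ, hψ, hψp, h3, h4⟩ := mem_smoothPairs_iff.mp hq
    refine mem_smoothPairs_iff.mpr ⟨φ + ψ, hφ.add hψ, fun k y => ?_, ?_, ?_⟩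
    · simp only [Pi.add_apply, hφp k y, hψp k y]
    · filter_upwards [Lp.coeFn_add p.1 q.1, h1, h3] with x h5 h6 h7
      rw [Prod.fst_add, h5, Pi.add_apply, h6, h7, Pi.add_apply]
    · filter_upwards [Lp.coeFn_add p.2 q.2, h2, h4] with x h5 h6 h7
      rw [Prod.snd_add, h5, Pi.add_apply, h6, h7]
      ext ij
      simp [classicalGrad, fderiv_add (hφ.differentiable (by simp) x)
        (hψ.differentiable (by simp) x)]
  smul_mem' := by
    intro c p hp
    obtain ⟨φ, hφ, hφp, h1, h2⟩ := mem_smoothPairs_iff.mp hp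
    refine mem_smoothPairs_iff.mpr ⟨c • φ, contDiff_const.smul hφ, fun k y => ?_, ?_, ?_⟩
    · simp only [Pi.smul_apply, hφp k y]
    · filter_upwards [Lp.coeFn_smul c p.1, h1] with x h5 h6
      rw [Prod.smul_fst, h5, Pi.smul_apply, h6, Pi.smul_apply]
    · filter_upwards [Lp.coeFn_smul c p.2, h2] with x h5 h6
      rw [Prod.smul_snd, h5, Pi.smul_apply, h6]
      ext ij
      simp [classicalGrad, fderiv_const_smul (hφ.differentiable (by simp) x) c]

theorem mem_quasiPeriodicH1Perp_iff {p : L2VecCell n d × L2MatCell n d} :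
    p ∈ quasiPeriodicH1Perp n 0 ↔ p ∈ quasiPeriodicH1 n 0 ∧ cellAvg d (Vec n) p.1 = 0 := by
  have h : ∀ i, ∫ y in cell d, star (planeWave 0 y) * p.1 y i = cellAvg d (Vec n) p.1 i := by
    intro i
    have h1 := (EuclideanSpace.proj i : Vec n →L[ℂ] ℂ).integral_comp_comm (integrable_cell p.1)
    rw [cellAvg_apply]
    refine Eq.trans ?_ h1
    simp [planeWave]
  simp only [quasiPeriodicH1Perp, Set.mem_ofPred_eq, h]
  refine and_congr_right fun _ => ⟨fun h => ?_, fun h i => by rw [h]; rfl⟩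
  ext i
  exact h i

/-- Periodic `H¹` functions of zero average, as a subspace of a Hilbert space. -/
def cellSobolev (n d : ℕ) : Submodule ℂ (WithLp 2 (L2VecCell n d × L2MatCell n d)) :=
  ((smoothPeriodicSubmodule n d).topologicalClosure ⊓
    ((cellAvg d (Vec n)).toLinearMap ∘ₗ LinearMap.fst ℂ _ _).ker).comap
      (WithLp.prodContinuousLinearEquiv 2 ℂ (L2VecCell n d) (L2MatCell n d)).toLinearMap

theorem mem_cellSobolev {x : WithLp 2 (L2VecCell n d × L2MatCell n d)} :
    x ∈ cellSobolev n d ↔ (x.fst, x.snd) ∈ quasiPeriodicH1Perp n 0 := by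
  rw [mem_quasiPeriodicH1Perp_iff]
  rfl

theorem isClosed_cellSobolev :
    IsClosed (cellSobolev n d : Set (WithLp 2 (L2VecCell n d × L2MatCell n d))) := by
  have h : IsClosed (((smoothPeriodicSubmodule n d).topologicalClosure ⊓
      ((cellAvg d (Vec n)).toLinearMap ∘ₗ LinearMap.fst ℂ (L2VecCell n d) (L2MatCell n d)).ker :
      Submodule ℂ (L2VecCell n d × L2MatCell n d)) : Set (L2VecCell n d × L2MatCell n d)) := by
    refine IsClosed.inter (Submodule.isClosed_topologicalClosure _) ?_
    exact isClosed_eq ((cellAvg d (Vec n)).continuous.comp continuous_fst) continuous_const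
  exact h.preimage (WithLp.prodContinuousLinearEquiv 2 ℂ _ _).continuous

theorem memLp_cell {V : Type} [NormedAddCommGroup V] [InnerProductSpace ℂ V]
    {a : Space d → V →L[ℂ] V} (ha : IsPeriodicCoercive a) : MemLp a ⊤ (cellMeasure d) :=
  ha.memLp_top.restrict _

theorem norm_sq_le_of_mem_perp {p : L2VecCell n d × L2MatCell n d}
    (hp : p ∈ quasiPeriodicH1Perp n 0) : ‖p.1‖ ^ 2 ≤ d * ‖p.2‖ ^ 2 := by
  obtain ⟨h1, h2⟩ := mem_quasiPeriodicH1Perp_iff.mp hp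
  have h3 := poincare h1
  rw [h2, map_zero, sub_zero] at h3
  calc ‖p.1‖ ^ 2 ≤ (√d * ‖p.2‖) ^ 2 := by gcongr
    _ = _ := by rw [mul_pow, Real.sq_sqrt (by positivity)]

theorem isCellSolution_iff {a : Space d → Mat n d →L[ℂ] Mat n d} (ha : IsPeriodicCoercive a)
    {rs : Fin n × Fin d} {p : L2VecCell n d × L2MatCell n d} :
    IsCellSolution a 0 rs p ↔ p ∈ quasiPeriodicH1Perp n 0 ∧ ∀ q ∈ quasiPeriodicH1Perp n 0,
      inner ℂ q.2 (mulCLM a (memLp_cell ha) (p.2 + cellConst d (Mat n d) (unitMat rs))) = 0 := by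
  have h : ∀ q : L2VecCell n d × L2MatCell n d,
      ∫ y in cell d, inner ℂ (q.2 y) (a y (correctedField 0 rs p.2 y)) =
        inner ℂ q.2 (mulCLM a (memLp_cell ha) (p.2 + cellConst d (Mat n d) (unitMat rs))) := by
    intro q
    rw [L2.inner_def]
    refine integral_congr_ae ?_
    filter_upwards [coeFn_mulCLM a (memLp_cell ha) (p.2 + cellConst d (Mat n d) (unitMat rs)),
      Lp.coeFn_add p.2 (cellConst d (Mat n d) (unitMat rs)),
      coeFn_cellConst (d := d) (unitMat rs : Mat n d)] with x h1 h2 h3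
    rw [h1, h2, Pi.add_apply, h3]
    simp [correctedField, planeWave, inner_add_right]
  simp only [IsCellSolution, h]

/-- The form involves only gradients; on mean-zero periodic functions the Poincaré inequality makes
it coercive in the full norm. -/
theorem existsUnique_cellSolution {a : Space d → Mat n d →L[ℂ] Mat n d}
    (ha : IsPeriodicCoercive a) (rs : Fin n × Fin d) : ∃! p, IsCellSolution a 0 rs p := by
  obtain ⟨ν, hν, hco⟩ := ha.coercive
  set A := mulCLM a (memLp_cell ha) with hA
  set E := cellConst d (Mat n d) (unitMat rs) with hE
  -- The constant comes from `‖u‖² + ‖∇u‖² ≤ (d + 1) ‖∇u‖²`.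
  have hB : ∀ x ∈ cellSobolev n d, ν / (d + 1) * ‖x‖ ^ 2 ≤
      (inner ℂ x (pairMap (0 : L2VecCell n d →L[ℂ] L2VecCell n d) A x)).re := by
    intro x hx
    have h1 := norm_sq_le_of_mem_perp (mem_cellSobolev.mp hx)
    have h2 := re_inner_mulCLM_ge a (memLp_cell ha) (ae_restrict_of_ae hco) x.snd
    rw [inner_pairMap, WithLp.prod_norm_sq_eq_of_L2, zero_apply, inner_zero_right, zero_add]
    refine le_trans ?_ h2
    rw [div_mul_eq_mul_div, div_le_iff₀ (by positivity)]
    simp only at h1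
    nlinarith
  have hc : 0 < ν / ((d : ℝ) + 1) := by positivity
  obtain ⟨T, hT⟩ := exists_laxMilgram (cellSobolev n d) isClosed_cellSobolev _ hc hB
  -- The constant part `E` of the field is moved to the right-hand side as the datum `-A E`, acting
  -- on gradients only.
  obtain ⟨h1, h2⟩ := hT (WithLp.toLp 2 (0, -A E))
  set x := T (WithLp.toLp 2 (0, -A E)) with hx
  refine ⟨(x.fst, x.snd), (isCellSolution_iff ha).mpr ⟨mem_cellSobolev.mp h1, ?_⟩, ?_⟩
  · intro q hq
    have h3 := h2 (WithLp.toLp 2 q) (mem_cellSobolev.mpr hq)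
    rw [inner_pairMap, WithLp.prod_inner_apply, zero_apply, inner_zero_right, zero_add] at h3
    change inner ℂ q.2 (A x.snd) = inner ℂ q.1 (0 : L2VecCell n d) + inner ℂ q.2 (-A E) at h3
    rw [inner_zero_right, zero_add, inner_neg_right] at h3
    rw [map_add, inner_add_right, ← hA, h3, neg_add_cancel]
  · intro p hp
    obtain ⟨hp1, hp2⟩ := (isCellSolution_iff ha).mp hp
    have h0 : WithLp.toLp 2 p - x = 0 := by
      refine eq_zero_of_coercive hc hB
        (Submodule.sub_mem _ (mem_cellSobolev.mpr hp1) h1) fun y hy => ?_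
      have h3 := hp2 _ (mem_cellSobolev.mp hy)
      rw [map_add, inner_add_right] at h3
      rw [map_sub, inner_sub_right, h2 y hy, inner_pairMap, WithLp.prod_inner_apply, zero_apply,
        inner_zero_right, zero_add]
      change inner ℂ y.snd (A p.2) - (inner ℂ y.fst (0 : L2VecCell n d) + inner ℂ y.snd (-A E)) = 0
      rw [inner_zero_right, zero_add, inner_neg_right, sub_neg_eq_add]
      exact h3
    rw [sub_eq_zero] at h0
    rw [← h0]
    rfl

theorem isCellSolution_cellSolution {a : Space d → Mat n d →L[ℂ] Mat n d}
    (ha : IsPeriodicCoercive a) (rs : Fin n × Fin d) :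
    IsCellSolution a 0 rs (cellSolution a 0 rs) :=
  Classical.epsilon_spec (existsUnique_cellSolution ha rs).exists

/-- The field `∇N + e_r ⊗ e_s` on the cell. -/
def cellField (a : Space d → Mat n d →L[ℂ] Mat n d) (rs : Fin n × Fin d) : L2MatCell n d :=
  (cellSolution a 0 rs).2 + cellConst d (Mat n d) (unitMat rs)

theorem aHom_unitMat {a : Space d → Mat n d →L[ℂ] Mat n d} (ha : IsPeriodicCoercive a)
    (rs : Fin n × Fin d) :
    aHom a 0 (unitMat rs) = cellAvg d (Mat n d) (mulCLM a (memLp_cell ha) (cellField a rs)) := by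
  have h1 : ∀ ij, aHom a 0 (unitMat rs) ij =
      ∫ y in cell d, a y (correctedField 0 rs (cellSolution a 0 rs).2 y) ij := by
    intro ij
    rw [aHom, Matrix.ofLp_toEuclideanCLM]
    simp [unitMat, planeWave]
  ext ij
  rw [h1, cellAvg_apply]
  have h2 := (EuclideanSpace.proj ij : Mat n d →L[ℂ] ℂ).integral_comp_comm
    (integrable_cell (mulCLM a (memLp_cell ha) (cellField a rs)))
  refine Eq.trans ?_ h2
  refine integral_congr_ae ?_
  filter_upwards [coeFn_mulCLM a (memLp_cell ha) (cellField a rs),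
      Lp.coeFn_add (cellSolution a 0 rs).2 (cellConst d (Mat n d) (unitMat rs)),
      coeFn_cellConst (d := d) (unitMat rs : Mat n d)] with x h1 h2 h3
  rw [h1, cellField, h2, Pi.add_apply, h3]
  simp [correctedField, planeWave]

theorem eq_sum_unitMat (M : Mat n d) : M = ∑ rs, M rs • unitMat rs := by
  ext ij
  simp [unitMat, Pi.single_apply]

/-- The mean-zero constraint on test functions is immaterial: subtracting the mean leaves the
gradient unchanged. -/
theorem inner_grad_cellField {a : Space d → Mat n d →L[ℂ] Mat n d} (ha : IsPeriodicCoercive a)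
    (rs : Fin n × Fin d) {q : L2VecCell n d × L2MatCell n d} (hq : q ∈ quasiPeriodicH1 n 0) :
    inner ℂ q.2 (mulCLM a (memLp_cell ha) (cellField a rs)) = 0 := by
  have hmem :
      (q.1 - cellConst d (Vec n) (cellAvg d (Vec n) q.1), q.2) ∈ quasiPeriodicH1Perp n 0 := by
    rw [mem_quasiPeriodicH1Perp_iff]
    constructor
    · have hc : (cellConst d (Vec n) (cellAvg d (Vec n) q.1), (0 : L2MatCell n d)) ∈
          (smoothPeriodicSubmodule n d).topologicalClosure := by
        refine Submodule.le_topologicalClosure _ (mem_smoothPairs_iff.mpr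
          ⟨fun _ => cellAvg d (Vec n) q.1, contDiff_const, fun _ _ => rfl, coeFn_cellConst _, ?_⟩)
        refine (Lp.coeFn_zero _ _ _).trans (Filter.Eventually.of_forall fun x => ?_)
        ext ij
        simp [classicalGrad]
      have := Submodule.sub_mem (smoothPeriodicSubmodule n d).topologicalClosure hq hc
      rwa [Prod.mk_sub_mk, sub_zero] at this
    · rw [map_sub, cellAvg_cellConst, sub_self]
  exact ((isCellSolution_iff ha).mp (isCellSolution_cellSolution ha rs)).2
    (q.1 - cellConst d (Vec n) (cellAvg d (Vec n) q.1), q.2) hmem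

/-- The oscillating part `a (∇N + e_r ⊗ e_s) - aHom (e_r ⊗ e_s)` of the flux. -/
def cellFlux {a : Space d → Mat n d →L[ℂ] Mat n d} (ha : IsPeriodicCoercive a)
    (rs : Fin n × Fin d) : L2MatCell n d :=
  mulCLM a (memLp_cell ha) (cellField a rs) - cellConst d (Mat n d) (aHom a 0 (unitMat rs))

theorem cellAvg_cellFlux {a : Space d → Mat n d →L[ℂ] Mat n d} (ha : IsPeriodicCoercive a)
    (rs : Fin n × Fin d) : cellAvg d (Mat n d) (cellFlux ha rs) = 0 := by
  rw [cellFlux, map_sub, cellAvg_cellConst, aHom_unitMat ha, sub_self]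

/-- Constants are orthogonal to periodic gradients because the latter have mean zero, so subtracting
the mean flux preserves the orthogonality coming from the cell problem. -/
theorem inner_grad_cellFlux {a : Space d → Mat n d →L[ℂ] Mat n d} (ha : IsPeriodicCoercive a)
    (rs : Fin n × Fin d) {q : L2VecCell n d × L2MatCell n d} (hq : q ∈ quasiPeriodicH1 n 0) :
    inner ℂ q.2 (cellFlux ha rs) = 0 := by
  rw [cellFlux, inner_sub_right, inner_grad_cellField ha rs hq, zero_sub, neg_eq_zero,
    ← inner_conj_symm, inner_cellConst, cellAvg_grad_eq_zero hq, inner_zero_right, map_zero]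

/-- With `W = ∑ v_rs (∇N^(rs) + e_r ⊗ e_s)`, the cell problem removes the gradient part of the left
factor, so `⟨v, a^hom v⟩ = ⟨W, a W⟩`. Coercivity of `a` applies to `W`, and the same `ν` survives.
-/
theorem re_inner_aHom_ge {a : Space d → Mat n d →L[ℂ] Mat n d} (ha : IsPeriodicCoercive a)
    {ν : ℝ} (hν : 0 < ν) (hco : ∀ᵐ x : Space d, ∀ v, ν * ‖v‖ ^ 2 ≤ (inner ℂ v (a x v)).re)
    (v : Mat n d) : ν * ‖v‖ ^ 2 ≤ (inner ℂ v (aHom a 0 v)).re := by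
  set A := mulCLM a (memLp_cell ha) with hA
  have hsol := fun rs => ((isCellSolution_iff ha).mp (isCellSolution_cellSolution ha rs)).1
  have hmem := fun rs => (mem_quasiPeriodicH1Perp_iff.mp (hsol rs)).1
  set W : L2MatCell n d := ∑ rs, v rs • cellField a rs with hW
  have hW2 : W = ∑ rs, v rs • (cellSolution a 0 rs).2 + cellConst d (Mat n d) v := by
    conv_rhs => rw [eq_sum_unitMat v]
    simp only [hW, cellField, smul_add, Finset.sum_add_distrib, map_sum, map_smul]
    congr 2
    funext rs
    rw [← eq_sum_unitMat v]
  have h1 : aHom a 0 v = cellAvg d (Mat n d) (A W) := by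
    conv_lhs => rw [eq_sum_unitMat v]
    simp only [hW, map_sum, map_smul, aHom_unitMat ha]
    rfl
  have h2 : inner ℂ (∑ rs, v rs • (cellSolution a 0 rs).2) (A W) = 0 := by
    rw [sum_inner]
    refine Finset.sum_eq_zero fun rs _ => ?_
    rw [inner_smul_left, hW, map_sum, inner_sum]
    refine mul_eq_zero_of_right _ (Finset.sum_eq_zero fun rs' _ => ?_)
    rw [map_smul, inner_smul_right, inner_grad_cellField ha rs' (hmem rs), mul_zero]
  have h3 : inner ℂ v (aHom a 0 v) = inner ℂ W (A W) := by
    have h5 : inner ℂ W (A W) = inner ℂ (∑ rs, v rs • (cellSolution a 0 rs).2 +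
        cellConst d (Mat n d) v) (A W) := by rw [← hW2]
    rw [h5, inner_add_left, h2, zero_add, inner_cellConst, h1]
  -- `v` is the mean of `W`, and averaging over a cell of measure one does not increase the norm.
  have h4 : ‖v‖ ≤ ‖W‖ := by
    have h5 : cellAvg d (Mat n d) W = v := by
      rw [hW2, map_add, cellAvg_cellConst, map_sum]
      rw [Finset.sum_eq_zero, zero_add]
      intro rs _
      rw [map_smul, cellAvg_grad_eq_zero (hmem rs), smul_zero]
    have h6 : inner ℂ (cellConst d (Mat n d) v) W = inner ℂ v v := by
      rw [inner_cellConst, h5]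
    have h7 : ‖v‖ ^ 2 ≤ ‖v‖ * ‖W‖ := by
      have := norm_inner_le_norm (𝕜 := ℂ) (cellConst d (Mat n d) v) W
      rw [h6, norm_cellConst, inner_self_eq_norm_sq_to_K] at this
      simpa using this
    by_cases hv : ‖v‖ = 0
    · rw [hv]; exact norm_nonneg _
    · have : 0 < ‖v‖ := lt_of_le_of_ne (norm_nonneg _) (Ne.symm hv)
      nlinarith
  have h8 := re_inner_mulCLM_ge a (memLp_cell ha) (ae_restrict_of_ae hco) W
  rw [h3]
  refine le_trans ?_ h8
  gcongr

theorem cellMean_apply {s : Space d → Vec n →L[ℂ] Vec n} (hs : IsPeriodicCoercive s) (v : Vec n) :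
    cellMean s v = cellAvg d (Vec n) (mulCLM s (memLp_cell hs) (cellConst d (Vec n) v)) := by
  have h1 : ∀ j : Fin n, cellMean s (EuclideanSpace.single j 1) =
      cellAvg d (Vec n) (mulCLM s (memLp_cell hs)
        (cellConst d (Vec n) (EuclideanSpace.single j 1))) := by
    intro j
    ext i
    rw [cellMean, Matrix.ofLp_toEuclideanCLM, cellAvg_apply]
    have h2 := (EuclideanSpace.proj i : Vec n →L[ℂ] ℂ).integral_comp_comm
      (integrable_cell (mulCLM s (memLp_cell hs)
        (cellConst d (Vec n) (EuclideanSpace.single j 1))))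
    refine Eq.trans ?_ h2
    simp only [PiLp.ofLp_single, Matrix.mulVec_single_one, Matrix.col_apply, Matrix.of_apply]
    refine integral_congr_ae ?_
    filter_upwards [coeFn_mulCLM s (memLp_cell hs)
        (cellConst d (Vec n) (EuclideanSpace.single j 1)),
      coeFn_cellConst (d := d) (EuclideanSpace.single j 1 : Vec n)] with x h3 h4
    rw [h3, h4]
    rfl
  have h2 : v = ∑ j, v j • EuclideanSpace.single j (1 : ℂ) := by
    ext i
    simp [Pi.single_apply]
  rw [h2]
  simp only [map_sum, map_smul, h1]

theorem re_inner_cellMean_ge {s : Space d → Vec n →L[ℂ] Vec n} (hs : IsPeriodicCoercive s) {ν : ℝ}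
    (hco : ∀ᵐ x : Space d, ∀ v, ν * ‖v‖ ^ 2 ≤ (inner ℂ v (s x v)).re) (v : Vec n) :
    ν * ‖v‖ ^ 2 ≤ (inner ℂ v (cellMean s v)).re := by
  rw [cellMean_apply hs, ← inner_cellConst, ← norm_cellConst (d := d) v]
  exact re_inner_mulCLM_ge s (memLp_cell hs) (ae_restrict_of_ae hco) _

theorem isPeriodicCoercive_const {V : Type} [NormedAddCommGroup V] [InnerProductSpace ℂ V]
    {B : V →L[ℂ] V} {ν : ℝ} (hν : 0 < ν) (h : ∀ v, ν * ‖v‖ ^ 2 ≤ (inner ℂ v (B v)).re) :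
    IsPeriodicCoercive fun _ : Space d => B :=
  ⟨memLp_top_const _, fun _ => Filter.Eventually.of_forall fun _ => rfl,
    ν, hν, Filter.Eventually.of_forall fun _ => h⟩

end

section

/-! ### Products of mollified functions with oscillating functions -/

variable {n d : ℕ} {ρ C ε : ℝ} {k : Space d → ℝ}

section OscMul

variable {V : Type} [NormedAddCommGroup V] [InnerProductSpace ℂ V]

theorem aestronglyMeasurable_comp_cellFract (hε : 0 < ε) {E : Type*} [TopologicalSpace E]
    {G : Space d → E} (hG : AEStronglyMeasurable G (cellMeasure d)) :
    AEStronglyMeasurable (fun x : Space d => G (cellFract (ε⁻¹ • x))) volume :=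
  hG.comp_quasiMeasurePreserving (quasiMeasurePreserving_cellFract_smul (inv_ne_zero hε.ne'))

theorem ae_comp_cellFract (hε : 0 < ε) {P : Space d → Prop} (h : ∀ᵐ x ∂cellMeasure d, P x) :
    ∀ᵐ x : Space d, P (cellFract (ε⁻¹ • x)) :=
  (quasiMeasurePreserving_cellFract_smul (inv_ne_zero hε.ne')).ae h

/-- Only square integrability of `G` on the cell is used; this is what permits unbounded correctors.
-/
theorem lintegral_moll_smul_le (hk : OscKernel ρ C ε k)
    (f : Lp ℂ 2 (volume : Measure (Space d))) (G : Lp V 2 (cellMeasure d)) :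
    ∫⁻ x, ‖moll k f x • G (cellFract (ε⁻¹ • x))‖ₑ ^ 2 ≤ ‖f‖ₑ ^ 2 * ‖G‖ₑ ^ 2 := by
  have hG := (Lp.stronglyMeasurable G).enorm.pow_const 2
  rw [← lintegral_enorm_sq f, ← lintegral_enorm_sq G, mul_comm]
  refine le_trans (le_of_eq (lintegral_congr fun x => ?_))
    (hk.lintegral_mul_moll_le hG (Lp.aestronglyMeasurable f))
  rw [enorm_smul, mul_pow, mul_comm]

theorem memLp_moll_smul (hε : 0 < ε) (hk : OscKernel ρ C ε k)
    (f : Lp ℂ 2 (volume : Measure (Space d))) (G : Lp V 2 (cellMeasure d)) :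
    MemLp (fun x => moll k f x • G (cellFract (ε⁻¹ • x))) 2 volume := by
  refine memLp_two_of_lintegral_lt_top ((aestronglyMeasurable_moll hk.contDiff
    hk.hasCompactSupport (locallyIntegrable_lp f)).smul
    (aestronglyMeasurable_comp_cellFract hε (Lp.aestronglyMeasurable G))) ?_
  refine (lintegral_moll_smul_le hk f G).trans_lt (ENNReal.mul_lt_top ?_ ?_) <;>
  exact ENNReal.pow_lt_top enorm_lt_top

theorem norm_toLp_moll_smul_le (hε : 0 < ε) (hk : OscKernel ρ C ε k)
    (f : Lp ℂ 2 (volume : Measure (Space d))) (G : Lp V 2 (cellMeasure d)) :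
    ‖(memLp_moll_smul hε hk f G).toLp _‖ ≤ ‖f‖ * ‖G‖ := by
  refine norm_le_of_enorm_sq_le (by positivity) ?_
  rw [ENNReal.ofReal_mul (norm_nonneg _), ofReal_norm, ofReal_norm, mul_pow]
  exact (lintegral_enorm_sq_toLp (memLp_moll_smul hε hk f G)).trans_le
    (lintegral_moll_smul_le hk f G)

/-- Multiplication of the oscillating function `G (x / ε)` by the mollification of `f`, as a
linear map in `G`. -/
def oscMulLin (hε : 0 < ε) (hk : OscKernel ρ C ε k) (f : Lp ℂ 2 (volume : Measure (Space d))) :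
    Lp V 2 (cellMeasure d) →ₗ[ℂ] Lp V 2 (volume : Measure (Space d)) where
  toFun := fun G => (memLp_moll_smul hε hk f G).toLp _
  map_add' := by
    intro G H
    refine Lp.ext ?_
    filter_upwards [(memLp_moll_smul hε hk f (G + H)).coeFn_toLp,
      (memLp_moll_smul hε hk f G).coeFn_toLp, (memLp_moll_smul hε hk f H).coeFn_toLp,
      Lp.coeFn_add ((memLp_moll_smul hε hk f G).toLp _) ((memLp_moll_smul hε hk f H).toLp _),
      ae_comp_cellFract hε (Lp.coeFn_add G H)] with x h1 h2 h3 h4 h5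
    rw [h1, h4, Pi.add_apply, h2, h3, h5, Pi.add_apply, smul_add]
  map_smul' := by
    intro c G
    refine Lp.ext ?_
    filter_upwards [(memLp_moll_smul hε hk f (c • G)).coeFn_toLp,
      (memLp_moll_smul hε hk f G).coeFn_toLp,
      Lp.coeFn_smul c ((memLp_moll_smul hε hk f G).toLp _),
      ae_comp_cellFract hε (Lp.coeFn_smul c G)] with x h1 h2 h4 h5
    rw [h1, RingHom.id_apply, h4, Pi.smul_apply, h2, h5, Pi.smul_apply, smul_comm]

/-- Multiplication of the oscillating function `G (x / ε)` by the mollification of `f`. -/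
def oscMul (hε : 0 < ε) (hk : OscKernel ρ C ε k) (f : Lp ℂ 2 (volume : Measure (Space d))) :
    Lp V 2 (cellMeasure d) →L[ℂ] Lp V 2 (volume : Measure (Space d)) :=
  (oscMulLin hε hk f).mkContinuous ‖f‖ (norm_toLp_moll_smul_le hε hk f)

theorem coeFn_oscMul (hε : 0 < ε) (hk : OscKernel ρ C ε k)
    (f : Lp ℂ 2 (volume : Measure (Space d))) (G : Lp V 2 (cellMeasure d)) :
    oscMul hε hk f G =ᵐ[volume] fun x => moll k f x • G (cellFract (ε⁻¹ • x)) :=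
  (memLp_moll_smul hε hk f G).coeFn_toLp

theorem norm_oscMul_le (hε : 0 < ε) (hk : OscKernel ρ C ε k)
    (f : Lp ℂ 2 (volume : Measure (Space d))) (G : Lp V 2 (cellMeasure d)) :
    ‖oscMul hε hk f G‖ ≤ ‖f‖ * ‖G‖ :=
  norm_toLp_moll_smul_le hε hk f G

theorem coeFn_oscMul_of_periodic (hε : 0 < ε) (hk : OscKernel ρ C ε k)
    (f : Lp ℂ 2 (volume : Measure (Space d))) {G : Lp V 2 (cellMeasure d)} {φ : Space d → V}
    (hG : G =ᵐ[cellMeasure d] φ) (hφ : IsLatticePeriodic φ) :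
    oscMul hε hk f G =ᵐ[volume] fun x => moll k f x • φ (ε⁻¹ • x) := by
  filter_upwards [coeFn_oscMul hε hk f G, ae_comp_cellFract hε hG] with x h1 h2
  rw [h1, h2, hφ.comp_cellFract]

theorem coeFn_oscMul_cellConst (hε : 0 < ε) (hk : OscKernel ρ C ε k)
    (f : Lp ℂ 2 (volume : Measure (Space d))) (v : V) :
    oscMul hε hk f (cellConst d V v) =ᵐ[volume] fun x => moll k f x • v :=
  coeFn_oscMul_of_periodic hε hk f (coeFn_cellConst v) fun _ _ => rfl

end OscMul

/-! ### Rescaled periodic coefficients -/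

section Coefficient

variable {V : Type} [NormedAddCommGroup V] [InnerProductSpace ℂ V] {a : Space d → V →L[ℂ] V}

theorem ae_comp_smul (hε : 0 < ε) {P : Space d → Prop} (h : ∀ᵐ x : Space d, P x) :
    ∀ᵐ x : Space d, P (ε⁻¹ • x) :=
  (quasiMeasurePreserving_smul (inv_ne_zero hε.ne')).ae h

theorem ae_norm_le_eLpNorm {α E : Type*} [MeasurableSpace α] {μ : Measure α} [NormedAddCommGroup E]
    {f : α → E} (hf : MemLp f ⊤ μ) : ∀ᵐ x ∂μ, ‖f x‖ ≤ (eLpNorm f ⊤ μ).toReal := by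
  filter_upwards [ae_le_eLpNormEssSup (f := f) (μ := μ)] with x hx
  rw [eLpNorm_exponent_top, ← toReal_enorm]
  exact ENNReal.toReal_mono (by simpa using hf.2.ne) hx

theorem IsPeriodicCoercive.memLp_scaled (ha : IsPeriodicCoercive a) (hε : 0 < ε) :
    MemLp (fun x => a (ε⁻¹ • x)) ⊤ (volume : Measure (Space d)) :=
  memLp_top_of_bound (ha.memLp_top.1.comp_quasiMeasurePreserving
    (quasiMeasurePreserving_smul (inv_ne_zero hε.ne'))) _
    (ae_comp_smul hε (ae_norm_le_eLpNorm ha.memLp_top))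

/-- Multiplication by the rescaled coefficient `a (x / ε)`. -/
def scaledMul (ha : IsPeriodicCoercive a) (hε : 0 < ε) :
    Lp V 2 (volume : Measure (Space d)) →L[ℂ] Lp V 2 (volume : Measure (Space d)) :=
  mulCLM _ (ha.memLp_scaled hε)

theorem norm_scaledMul_le (ha : IsPeriodicCoercive a) (hε : 0 < ε)
    (g : Lp V 2 (volume : Measure (Space d))) :
    ‖scaledMul ha hε g‖ ≤ (eLpNorm a ⊤ volume).toReal * ‖g‖ := by
  refine (norm_mulCLM_le _ (ha.memLp_scaled hε) g).trans ?_
  refine mul_le_mul_of_nonneg_right (ENNReal.toReal_mono ha.memLp_top.2.ne ?_) (norm_nonneg _)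
  rw [eLpNorm_exponent_top]
  refine (eLpNormEssSup_le_of_ae_bound (ae_comp_smul hε (ae_norm_le_eLpNorm ha.memLp_top))).trans ?_
  rw [ENNReal.ofReal_toReal ha.memLp_top.2.ne]

theorem re_inner_scaledMul_ge (ha : IsPeriodicCoercive a) (hε : 0 < ε) {ν : ℝ}
    (hco : ∀ᵐ x : Space d, ∀ v, ν * ‖v‖ ^ 2 ≤ (inner ℂ v (a x v)).re)
    (g : Lp V 2 (volume : Measure (Space d))) :
    ν * ‖g‖ ^ 2 ≤ (inner ℂ g (scaledMul ha hε g)).re :=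
  re_inner_mulCLM_ge _ (ha.memLp_scaled hε) (ae_comp_smul hε hco) g

/-- The scalar slow factor commutes with the coefficient and periodicity makes `a (x / ε)` act on
the cell profile, so products with the coefficient can be computed on the cell. -/
theorem scaledMul_oscMul (ha : IsPeriodicCoercive a) (hε : 0 < ε) (hk : OscKernel ρ C ε k)
    (f : Lp ℂ 2 (volume : Measure (Space d))) (G : Lp V 2 (cellMeasure d)) :
    scaledMul ha hε (oscMul hε hk f G) =
      oscMul hε hk f (mulCLM a (memLp_cell ha) G) := by
  refine Lp.ext ?_
  filter_upwards [coeFn_mulCLM _ (ha.memLp_scaled hε) (oscMul hε hk f G), coeFn_oscMul hε hk f G,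
    coeFn_oscMul hε hk f (mulCLM a (memLp_cell ha) G),
    ae_comp_cellFract hε (coeFn_mulCLM a (memLp_cell ha) G),
    ae_comp_smul hε (ae_eq_comp_cellFract ha.periodic)] with x h1 h2 h3 h4 h5
  rw [h3, h4, h5, ← map_smul, ← h2]
  exact h1

end Coefficient

/-! ### Correctors -/

/-- Column extraction and embedding on `L²`. -/
def colL (j : Fin d) (μ : Measure (Space d)) : Lp (Mat n d) 2 μ →L[ℂ] Lp (Vec n) 2 μ :=
  (col j).compLpL 2 μ

def colEmbL (j : Fin d) (μ : Measure (Space d)) : Lp (Vec n) 2 μ →L[ℂ] Lp (Mat n d) 2 μ :=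
  (colEmb j).compLpL 2 μ

theorem coeFn_colL (j : Fin d) (μ : Measure (Space d)) (g : Lp (Mat n d) 2 μ) :
    colL j μ g =ᵐ[μ] fun x => col j (g x) :=
  ContinuousLinearMap.coeFn_compLpL _ g

theorem coeFn_colEmbL (j : Fin d) (μ : Measure (Space d)) (g : Lp (Vec n) 2 μ) :
    colEmbL j μ g =ᵐ[μ] fun x => colEmb j (g x) :=
  ContinuousLinearMap.coeFn_compLpL _ g

theorem norm_colL_le (j : Fin d) (μ : Measure (Space d)) (g : Lp (Mat n d) 2 μ) :
    ‖colL j μ g‖ ≤ ‖g‖ := by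
  refine Lp.norm_le_norm_of_ae_le ?_
  filter_upwards [coeFn_colL j μ g] with x hx
  rw [hx]
  exact norm_col_le _ _

theorem norm_colEmbL_le (j : Fin d) (μ : Measure (Space d)) (g : Lp (Vec n) 2 μ) :
    ‖colEmbL (n := n) j μ g‖ ≤ ‖g‖ := by
  refine Lp.norm_le_norm_of_ae_le ?_
  filter_upwards [coeFn_colEmbL j μ g] with x hx
  rw [hx, norm_colEmb]

/-- The gradient of the corrector `ε f N (x / ε)`. -/
def correctorGrad (hε : 0 < ε) (hk : OscKernel ρ C ε k) (f : Lp ℂ 2 (volume : Measure (Space d)))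
    (q : Fin d → Lp ℂ 2 (volume : Measure (Space d))) (p : L2VecCell n d × L2MatCell n d) :
    L2Mat n d :=
  oscMul hε hk f p.2 + (ε : ℂ) • ∑ j, colEmbL j volume (oscMul hε hk (q j) p.1)

/-- For smooth periodic pairs this is the product rule, the chain-rule factor `ε⁻¹` cancelling `ε`.
Both components depend continuously on `p` and the graph of the gradient is closed, so the closure
is covered. The hypothesis `hq` asks that derivatives of the slow factor be mollifications again,
since only those have `L²` products with an unbounded profile. -/
theorem isWeakGrad_corrector (hε : 0 < ε) (hk : OscKernel ρ C ε k)
    {f : Lp ℂ 2 (volume : Measure (Space d))} {q : Fin d → Lp ℂ 2 (volume : Measure (Space d))}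
    (hq : ∀ j x, fderiv ℝ (moll k f) x (basisVec j) = moll k (q j) x)
    {p : L2VecCell n d × L2MatCell n d} (hp : p ∈ quasiPeriodicH1 n 0) :
    IsWeakGrad ((ε : ℂ) • oscMul hε hk f p.1) (correctorGrad hε hk f q p) := by
  have hcl : IsClosed {p : L2VecCell n d × L2MatCell n d |
      ((ε : ℂ) • oscMul hε hk f p.1, correctorGrad hε hk f q p) ∈ gradGraph n d} := by
    refine isClosed_gradGraph.preimage ?_
    unfold correctorGrad
    fun_prop
  refine closure_minimal (s := smoothQuasiPeriodicPairs n 0) ?_ hcl hp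
  intro p hp
  obtain ⟨φ, hφ, hφp, h1, h2⟩ := mem_smoothPairs_iff.mp hp
  have hK : ContDiff ℝ ∞ (moll k f) :=
    contDiff_moll hk.contDiff hk.hasCompactSupport (locallyIntegrable_lp f)
  have hKe : ContDiff ℝ ∞ fun x => (ε : ℂ) * moll k f x := contDiff_const.mul hK
  have hφe : ContDiff ℝ ∞ fun x : Space d => φ (ε⁻¹ • x) := hφ.comp (contDiff_const_smul _)
  refine isWeakGrad_of_contDiff (ψ := fun x => ((ε : ℂ) * moll k f x) • φ (ε⁻¹ • x))
    ((hKe.smul hφe).of_le (by simp)) ?_ ?_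
  · filter_upwards [Lp.coeFn_smul (ε : ℂ) (oscMul hε hk f p.1),
      coeFn_oscMul_of_periodic hε hk f h1 hφp] with x h3 h4
    rw [h3, Pi.smul_apply, h4, smul_smul]
  · have hgrad : ∀ x, classicalGrad (fun x : Space d => φ (ε⁻¹ • x)) x =
        (ε⁻¹ : ℂ) • classicalGrad φ (ε⁻¹ • x) := by
      intro x
      have hd : HasFDerivAt (fun x : Space d => φ (ε⁻¹ • x)) ((fderiv ℝ φ (ε⁻¹ • x)).comp
          (ε⁻¹ • ContinuousLinearMap.id ℝ (Space d))) x :=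
        ((hφ.differentiable (by simp)) _).hasFDerivAt.comp x
          ((hasFDerivAt_id x).const_smul ε⁻¹)
      ext ij
      simp [classicalGrad, hd.fderiv]
    have hKd : ∀ j x, fderiv ℝ (fun x => (ε : ℂ) * moll k f x) x (basisVec j) =
        ε * moll k (q j) x := by
      intro j x
      rw [fderiv_const_mul (hK.differentiable (by simp) x), ← hq]
      rfl
    have hsum : ∀ᵐ x, (∑ j, colEmbL (n := n) j volume (oscMul hε hk (q j) p.1)) x =
        ∑ j, colEmb j (moll k (q j) x • φ (ε⁻¹ • x)) := by
      filter_upwards [Lp.coeFn_finsetSum Finset.univ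
          fun j => colEmbL (n := n) j volume (oscMul hε hk (q j) p.1),
        ae_all_iff.mpr fun j => coeFn_colEmbL (n := n) j volume (oscMul hε hk (q j) p.1),
        ae_all_iff.mpr fun j => coeFn_oscMul_of_periodic hε hk (q j) h1 hφp] with x h3 h4 h5
      rw [h3, Finset.sum_apply]
      refine Finset.sum_congr rfl fun j _ => ?_
      rw [h4, h5]
    filter_upwards [hsum, coeFn_oscMul_of_periodic hε hk f h2 hφp.classicalGrad,
      Lp.coeFn_smul (ε : ℂ) (∑ j, colEmbL (n := n) j volume (oscMul hε hk (q j) p.1)),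
      Lp.coeFn_add (oscMul hε hk f p.2)
        ((ε : ℂ) • ∑ j, colEmbL j volume (oscMul hε hk (q j) p.1))] with x h3 h4 h5 h6
    rw [correctorGrad, h6, Pi.add_apply, h4, h5, Pi.smul_apply, h3,
      classicalGrad_smul (hKe.differentiable (by simp) x) (hφe.differentiable (by simp) x), hgrad,
      Finset.smul_sum]
    congr 1
    · rw [smul_smul]
      congr 1
      have : (ε : ℂ) ≠ 0 := by exact_mod_cast hε.ne'
      field_simp
    · refine Finset.sum_congr rfl fun j _ => ?_
      rw [hKd, map_smul, smul_smul]

end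

section

/-! ### Divergence-free periodic fields on the whole space -/

variable {n d : ℕ} {ρ C ε : ℝ} {k : Space d → ℝ}

theorem exists_finset_of_hasCompactSupport (hε : 0 < ε) {V : Type*} [Zero V] {ψ : Space d → V}
    (hc : HasCompactSupport ψ) (R : ℝ) : ∃ S : Finset (Fin d → ℤ), ∀ m ∉ S, ∀ y : Space d,
      ‖y‖ < R → ψ (ε • (y + latticePt m)) = 0 := by
  obtain ⟨r, hr⟩ := hc.isCompact.isBounded.subset_closedBall (0 : Space d)
  set B : ℤ := ⌈r / ε + R⌉ with hB
  refine ⟨Finset.Icc (fun _ => -B) (fun _ => B), fun m hm y hy => ?_⟩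
  by_contra h0
  have h1 := hr (subset_tsupport _ h0)
  rw [mem_closedBall_zero_iff, norm_smul, Real.norm_of_nonneg hε.le, ← le_div_iff₀' hε] at h1
  have h2 : ‖(latticePt m : Space d)‖ ≤ B := by
    have h3 : (latticePt m : Space d) = (y + latticePt m) - y := by abel
    rw [h3]
    exact (norm_sub_le _ _).trans ((add_le_add h1 hy.le).trans (Int.le_ceil _))
  refine hm (Finset.mem_Icc.mpr ⟨fun i => ?_, fun i => ?_⟩) <;>
  · have h4 : ‖(latticePt m : Space d) i‖ ≤ B := (PiLp.norm_apply_le _ i).trans h2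
    have h5 : |((m i : ℤ) : ℝ)| ≤ B := h4
    rw [abs_le] at h5
    first
    | exact_mod_cast h5.1
    | exact_mod_cast h5.2

/-- The function `φ y = ∑ ψ (ε (y + m))` turns a test function on the whole space into one for the
cell problem. The finite set `S` serves the whole cell at once. -/
theorem exists_periodization (hε : 0 < ε) {ψ : Space d → Vec n} (hψ : ContDiff ℝ ∞ ψ)
    (hc : HasCompactSupport ψ) : ∃ (φ : Space d → Vec n) (S : Finset (Fin d → ℤ)),
      ContDiff ℝ ∞ φ ∧ IsLatticePeriodic φ ∧
      (∀ y ∈ cell d, classicalGrad φ y =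
        (ε : ℂ) • ∑ m ∈ S, classicalGrad ψ (ε • (y + latticePt m))) ∧
      ∀ m ∉ S, ∀ y ∈ cell d, classicalGrad ψ (ε • (y + latticePt m)) = 0 := by
  set F : (Fin d → ℤ) → Space d → Vec n := fun m y => ψ (ε • (y + latticePt m)) with hF
  set φ : Space d → Vec n := fun y => ∑ᶠ m, F m y with hφ
  have hFs : ∀ m, ContDiff ℝ ∞ (F m) := fun m => hψ.comp (by fun_prop)
  have hFd : ∀ m y, classicalGrad (F m) y = (ε : ℂ) • classicalGrad ψ (ε • (y + latticePt m)) := by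
    intro m y
    have hd : HasFDerivAt (F m) ((fderiv ℝ ψ (ε • (y + latticePt m))).comp
        (ε • ContinuousLinearMap.id ℝ (Space d))) y :=
      ((hψ.differentiable (by simp)) _).hasFDerivAt.comp y
        (((hasFDerivAt_id y).add_const (latticePt m)).const_smul ε)
    ext ij
    simp [classicalGrad, hd.fderiv]
  have hloc : ∀ R : ℝ, ∃ S : Finset (Fin d → ℤ), (∀ m ∉ S, ∀ y, ‖y‖ < R → F m y = 0) ∧
      ∀ y, ‖y‖ < R → φ y = ∑ m ∈ S, F m y := by
    intro R
    obtain ⟨S, hS⟩ := exists_finset_of_hasCompactSupport hε hc R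
    refine ⟨S, hS, fun y hy => finsum_eq_sum_of_support_subset _ fun m hm => ?_⟩
    by_contra hmS
    exact hm (hS m hmS y hy)
  have hnhds : ∀ (R : ℝ) (y : Space d), ‖y‖ < R → ∀ᶠ x in nhds y, ‖x‖ < R := fun R y hy =>
    (continuous_norm.tendsto y).eventually (gt_mem_nhds hy)
  -- An open ball containing the closed ball of radius `√d`, hence a neighbourhood of each point of
  -- the cell, so that the finite sum may be differentiated.
  obtain ⟨S, hS0, hS⟩ := hloc (√d + 1)
  have hcell : ∀ y ∈ cell d, ‖y‖ < √d + 1 := fun y hy =>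
    (norm_le_of_mem_cell hy).trans_lt (lt_add_one _)
  refine ⟨φ, S, ?_, ?_, fun y hy => ?_, fun m hm y hy => ?_⟩
  · refine contDiff_iff_contDiffAt.mpr fun y => ?_
    obtain ⟨T, -, hT⟩ := hloc (‖y‖ + 1)
    have h1 : φ =ᶠ[nhds y] fun x => ∑ m ∈ T, F m x := by
      filter_upwards [hnhds _ y (lt_add_one _)] with x hx
      exact hT x hx
    exact ContDiffAt.congr_of_eventuallyEq
      (ContDiff.sum fun m _ => hFs m).contDiffAt h1
  · intro l y
    have h1 : ∀ m, F m (y + latticePt l) = F (Equiv.addLeft l m) y := by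
      intro m
      have : (y + latticePt l + latticePt m : Space d) = y + latticePt (l + m) := by
        ext i
        simp [latticePt, add_assoc]
      simp only [hF, this, Equiv.coe_addLeft]
    simp only [hφ, h1]
    exact finsum_comp_equiv (Equiv.addLeft l) (f := fun m => F m y)
  · have h1 : φ =ᶠ[nhds y] fun x => ∑ m ∈ S, F m x := by
      filter_upwards [hnhds _ y (hcell y hy)] with x hx
      exact hS x hx
    rw [Finset.smul_sum]
    simp_rw [← hFd]
    ext ij
    simp only [classicalGrad, h1.fderiv_eq, WithLp.ofLp_sum, Finset.sum_apply]
    rw [fderiv_fun_sum fun m _ => (hFs m).differentiable (by simp) y]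
    simp
  · have h1 : F m =ᶠ[nhds y] fun _ => 0 := by
      filter_upwards [hnhds _ y (hcell y hy)] with x hx
      exact hS0 m hm x hx
    have h2 : classicalGrad (F m) y = 0 := by
      ext ij
      simp [classicalGrad, h1.fderiv_eq]
    rw [hFd] at h2
    exact (smul_eq_zero.mp h2).resolve_left (by exact_mod_cast hε.ne')

theorem memLp_cell_of_continuous {V : Type*} [NormedAddCommGroup V]
    {f : Space d → V} (hf : Continuous f) : MemLp f 2 (cellMeasure d) := by
  obtain ⟨M, hM⟩ := (isCompact_closedBall (0 : Space d) √d).exists_bound_of_continuousOn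
    hf.continuousOn
  refine MemLp.of_bound hf.aestronglyMeasurable M ?_
  filter_upwards [ae_restrict_mem measurableSet_cell] with x hx
  exact hM x (mem_closedBall_zero_iff.mpr (norm_le_of_mem_cell hx))

/-- Unfolding: after rescaling, the integral is a sum over cells, in each of which the periodic
field is the same `g`; the sum of the gradients is, up to the factor `ε`, the gradient of the
periodisation of `ψ`, to which `g` is orthogonal. -/
theorem integral_inner_grad_osc_eq_zero (hε : 0 < ε) {g : L2MatCell n d}
    (hg : ∀ q ∈ smoothQuasiPeriodicPairs n 0, inner ℂ q.2 g = 0) {ψ : Space d → Vec n}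
    (hψ : ContDiff ℝ ∞ ψ) (hc : HasCompactSupport ψ)
    (hint : Integrable fun x => inner ℂ (classicalGrad ψ x) (g (cellFract (ε⁻¹ • x)))) :
    ∫ x, inner ℂ (classicalGrad ψ x) (g (cellFract (ε⁻¹ • x))) = 0 := by
  obtain ⟨φ, S, hφ, hφp, hS, hS0⟩ := exists_periodization hε hψ hc
  set H : Space d → ℂ := fun x => inner ℂ (classicalGrad ψ x) (g (cellFract (ε⁻¹ • x))) with hH
  have h1 : ∫ x, H (ε • x) = 0 := by
    have hint' : Integrable fun x => H (ε • x) := hint.comp_smul hε.ne'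
    have h2 : ∀ (m : Fin d → ℤ), ∀ y ∈ cell d, H (ε • (y + latticePt m)) =
        inner ℂ (classicalGrad ψ (ε • (y + latticePt m))) (g y) := by
      intro m y hy
      simp only [hH, inv_smul_smul₀ hε.ne', cellFract_add_latticePt, cellFract_eq_self hy]
    have hcg := continuous_classicalGrad (hφ.of_le (by simp) : ContDiff ℝ 1 φ)
    have hm1 := memLp_cell_of_continuous hφ.continuous
    have hm2 := memLp_cell_of_continuous hcg
    have h3 := hg (hm1.toLp φ, hm2.toLp (classicalGrad φ))
      (mem_smoothPairs_iff.mpr ⟨φ, hφ, hφp, hm1.coeFn_toLp, hm2.coeFn_toLp⟩)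
    have h4 : inner ℂ (hm2.toLp (classicalGrad φ)) g =
        ∫ y in cell d, ε * ∑ m ∈ S, H (ε • (y + latticePt m)) := by
      rw [L2.inner_def]
      refine integral_congr_ae ?_
      filter_upwards [hm2.coeFn_toLp, ae_restrict_mem measurableSet_cell] with y h5 h6
      rw [h5, hS y h6, inner_smul_left, sum_inner, Complex.conj_ofReal]
      congr 1
      exact Finset.sum_congr rfl fun m _ => (h2 m y h6).symm
    rw [h4, integral_const_mul, integral_finsetSum, mul_eq_zero] at h3
    · rw [integral_eq_tsum_cell hint', tsum_eq_sum (s := S)]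
      · exact h3.resolve_left (by exact_mod_cast hε.ne')
      · intro m hm
        refine setIntegral_eq_zero_of_forall_eq_zero fun y hy => ?_
        rw [h2 m y hy, hS0 m hm y hy, inner_zero_left]
    · intro m _
      exact (hint'.comp_add_right (latticePt m)).integrableOn
  rw [Measure.integral_comp_smul, smul_eq_zero] at h1
  refine h1.resolve_left (abs_pos.mpr ?_).ne'
  positivity

theorem contDiff_conj {F : Space d → ℂ} (hF : ContDiff ℝ ∞ F) :
    ContDiff ℝ ∞ (fun x => (starRingEnd ℂ) (F x)) ∧ ∀ x v,
      fderiv ℝ (fun x => (starRingEnd ℂ) (F x)) x v = (starRingEnd ℂ) (fderiv ℝ F x v) := by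
  refine ⟨(Complex.conjCLE.toContinuousLinearMap.contDiff).comp hF, fun x v => ?_⟩
  have h : HasFDerivAt (fun x => (starRingEnd ℂ) (F x))
      (Complex.conjCLE.toContinuousLinearMap.comp (fderiv ℝ F x)) x :=
    (Complex.conjCLE.toContinuousLinearMap.hasFDerivAt (x := F x)).comp x
      (hF.differentiable (by simp) x).hasFDerivAt
  rw [h.fderiv]
  rfl

/-- The oscillating field without slow factor is orthogonal to the gradient of the test function
`conj (k * f) ψ`; the product rule splits this into the two sides. The conjugate compensates for
conjugate-linearity in the first argument. -/
theorem inner_oscMul_flux_of_contDiff (hε : 0 < ε) (hk : OscKernel ρ C ε k)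
    {f : Lp ℂ 2 (volume : Measure (Space d))} {q : Fin d → Lp ℂ 2 (volume : Measure (Space d))}
    (hq : ∀ j x, fderiv ℝ (moll k f) x (basisVec j) = moll k (q j) x) {g : L2MatCell n d}
    (hg : ∀ q ∈ smoothQuasiPeriodicPairs n 0, inner ℂ q.2 g = 0) {v : L2Vec n d} {W : L2Mat n d}
    {ψ : Space d → Vec n} (hψ : ContDiff ℝ ∞ ψ) (hc : HasCompactSupport ψ)
    (hv : v =ᵐ[volume] ψ) (hW : W =ᵐ[volume] classicalGrad ψ) :
    inner ℂ W (oscMul hε hk f g) =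
      -∑ j, inner ℂ v (oscMul hε hk (q j) (colL j (cellMeasure d) g)) := by
  have hK : ContDiff ℝ ∞ (moll k f) :=
    contDiff_moll hk.contDiff hk.hasCompactSupport (locallyIntegrable_lp f)
  obtain ⟨hKc, hKd'⟩ := contDiff_conj hK
  have hKd : ∀ j x, fderiv ℝ (fun x => (starRingEnd ℂ) (moll k f x)) x (basisVec j) =
      (starRingEnd ℂ) (moll k (q j) x) := fun j x => by rw [hKd', hq]
  have hi1 := L2.integrable_inner (𝕜 := ℂ) W (oscMul hε hk f g)
  have hi2 := fun j => L2.integrable_inner (𝕜 := ℂ) v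
    (oscMul hε hk (q j) (colL j (cellMeasure d) g))
  have hae : (fun x => inner ℂ (W x) (oscMul hε hk f g x) +
      ∑ j, inner ℂ (v x) (oscMul hε hk (q j) (colL j (cellMeasure d) g) x)) =ᵐ[volume]
      fun x => inner ℂ (classicalGrad (fun x => (starRingEnd ℂ) (moll k f x) • ψ x) x)
        (g (cellFract (ε⁻¹ • x))) := by
    filter_upwards [hv, hW, coeFn_oscMul hε hk f g,
      ae_all_iff.mpr fun j => coeFn_oscMul hε hk (q j) (colL j (cellMeasure d) g),
      ae_comp_cellFract hε (ae_all_iff.mpr fun j => coeFn_colL j (cellMeasure d) g)]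
      with x h1 h2 h3 h4 h5
    rw [classicalGrad_smul (hKc.differentiable (by simp) x) (hψ.differentiable (by simp) x),
      inner_add_left, sum_inner, inner_smul_left, h1, h2, h3, inner_smul_right]
    congr 1
    · rw [Complex.conj_conj]
    · refine Finset.sum_congr rfl fun j _ => ?_
      rw [hKd, inner_smul_left, inner_colEmb, h4, h5, inner_smul_right, Complex.conj_conj]
  have hi3 : Integrable fun x => inner ℂ (W x) (oscMul hε hk f g x) +
      ∑ j, inner ℂ (v x) (oscMul hε hk (q j) (colL j (cellMeasure d) g) x) :=
    hi1.add (integrable_finsetSum _ fun j _ => hi2 j)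
  have hF : ContDiff ℝ ∞ fun x => (starRingEnd ℂ) (moll k f x) • ψ x := hKc.smul hψ
  have hFc : HasCompactSupport fun x => (starRingEnd ℂ) (moll k f x) • ψ x :=
    hc.mono fun x hx h => hx (by simp only [h, smul_zero])
  have h0 := integral_inner_grad_osc_eq_zero hε hg hF hFc (hi3.congr hae)
  rw [← integral_congr_ae hae, integral_add hi1 (integrable_finsetSum _ fun j _ => hi2 j),
    integral_finsetSum _ fun j _ => hi2 j] at h0
  simp only [← L2.inner_def] at h0
  exact eq_neg_of_add_eq_zero_left h0

/-- The derivative of `z` is traded for a derivative of the slow factor, leaving a pairing with `z`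
itself, to which the averaging estimate for mean-free profiles applies. The general case follows by
density of test functions. -/
theorem inner_oscMul_flux (hε : 0 < ε) (hk : OscKernel ρ C ε k)
    {f : Lp ℂ 2 (volume : Measure (Space d))} {q : Fin d → Lp ℂ 2 (volume : Measure (Space d))}
    (hq : ∀ j x, fderiv ℝ (moll k f) x (basisVec j) = moll k (q j) x) {g : L2MatCell n d}
    (hg : ∀ q ∈ smoothQuasiPeriodicPairs n 0, inner ℂ q.2 g = 0) {z : L2Vec n d} {Z : L2Mat n d}
    (hz : IsWeakGrad z Z) :
    inner ℂ Z (oscMul hε hk f g) =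
      -∑ j, inner ℂ z (oscMul hε hk (q j) (colL j (cellMeasure d) g)) := by
  have hcl : IsClosed {p : L2Vec n d × L2Mat n d | inner ℂ p.2 (oscMul hε hk f g) =
      -∑ j, inner ℂ p.1 (oscMul hε hk (q j) (colL j (cellMeasure d) g))} :=
    isClosed_eq (by fun_prop) (by fun_prop)
  refine closure_minimal (s := testPairs n d) ?_ hcl (gradGraph_subset_closure_testPairs hz)
  rintro p ⟨ψ, hψ, hc, hv, hW⟩
  exact inner_oscMul_flux_of_contDiff hε hk hq hg hψ hc hv hW

end

section

/-! ### Averaging estimate for mean-free oscillating functions -/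

variable {n d : ℕ} {ρ C ε : ℝ} {k : Space d → ℝ}

theorem lintegral_weight_mul_mul_sq_le {α : Type*} [MeasurableSpace α] {μ : Measure α}
    {w f g : α → ENNReal} (hw : AEMeasurable w μ) (hf : AEMeasurable f μ) (hg : AEMeasurable g μ) :
    (∫⁻ x, w x * (f x * g x) ∂μ) ^ 2 ≤ (∫⁻ x, w x * f x ^ 2 ∂μ) * ∫⁻ x, w x * g x ^ 2 ∂μ := by
  have hac := withDensity_absolutelyContinuous μ w
  have h := lintegral_mul_sq_le (hf.mono_ac hac) (hg.mono_ac hac)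
  have h1 := lintegral_withDensity_eq_lintegral_mul₀ hw (hf.mul hg)
  have h2 := lintegral_withDensity_eq_lintegral_mul₀ hw (hf.pow_const 2)
  have h3 := lintegral_withDensity_eq_lintegral_mul₀ hw (hg.pow_const 2)
  simp only [Pi.mul_apply] at h1 h2 h3
  rwa [h1, h2, h3] at h

theorem aemeasurable_kernel (hk : OscKernel ρ C ε k) :
    AEMeasurable (fun p : Space d × Space d => ‖k (p.1 - p.2)‖ₑ) (volume.prod volume) := by
  have hkm : Measurable k := hk.contDiff.continuous.measurable
  fun_prop

theorem lintegral_kernel_fst (hk : OscKernel ρ C ε k)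
    {F : Space d → ENNReal} (hF : AEMeasurable F volume) :
    ∫⁻ p, ‖k (p.1 - p.2)‖ₑ * F p.1 ∂(volume.prod volume) = ∫⁻ x, F x := by
  have hkm : Measurable k := hk.contDiff.continuous.measurable
  have hm : AEMeasurable (fun p : Space d × Space d => ‖k (p.1 - p.2)‖ₑ * F p.1)
      (volume.prod volume) := (aemeasurable_kernel hk).mul hF.comp_fst
  rw [lintegral_prod _ hm]
  refine lintegral_congr fun x => ?_
  simp only
  rw [lintegral_mul_const _ (by fun_prop), lintegral_sub_left_eq_self (fun y => ‖k y‖ₑ) x,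
    hk.lintegral_enorm, one_mul]

theorem lintegral_kernel_snd (hk : OscKernel ρ C ε k)
    {F : Space d → ENNReal} (hF : AEMeasurable F volume) :
    ∫⁻ p, ‖k (p.1 - p.2)‖ₑ * F p.2 ∂(volume.prod volume) = ∫⁻ x, F x := by
  have hkm : Measurable k := hk.contDiff.continuous.measurable
  have hm : AEMeasurable (fun p : Space d × Space d => ‖k (p.1 - p.2)‖ₑ * F p.2)
      (volume.prod volume) := (aemeasurable_kernel hk).mul hF.comp_snd
  rw [lintegral_prod_symm _ hm]
  refine lintegral_congr fun y => ?_
  simp only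
  rw [lintegral_mul_const _ (by fun_prop), lintegral_sub_right_eq_self (fun x => ‖k x‖ₑ) y,
    hk.lintegral_enorm, one_mul]

theorem lintegral_kernel_sub_le (hk : OscKernel ρ C ε k) {z : L2Vec n d} {D : ENNReal}
    (hD : ∀ t : Space d, ‖t‖ ≤ ρ * ε → ‖translate t z - z‖ₑ ^ 2 ≤ D) :
    ∫⁻ p, ‖k (p.1 - p.2)‖ₑ * ‖z p.1 - z p.2‖ₑ ^ 2 ∂(volume.prod volume) ≤ D := by
  have hkm : Measurable k := hk.contDiff.continuous.measurable
  have hz := Lp.stronglyMeasurable z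
  have hm : Measurable fun p : Space d × Space d => ‖k p.2‖ₑ * ‖z (p.1 + p.2) - z p.1‖ₑ ^ 2 := by
    have h1 : StronglyMeasurable fun p : Space d × Space d => z (p.1 + p.2) - z p.1 :=
      (hz.comp_measurable (by fun_prop)).sub (hz.comp_measurable measurable_fst)
    exact (hkm.comp measurable_snd).enorm.mul (h1.enorm.pow_const 2)
  have hm2 : AEMeasurable (fun p : Space d × Space d =>
      ‖k (p.1 - p.2)‖ₑ * ‖z p.1 - z p.2‖ₑ ^ 2) (volume.prod volume) := by
    have h1 : StronglyMeasurable fun p : Space d × Space d => z p.1 - z p.2 :=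
      (hz.comp_measurable measurable_fst).sub (hz.comp_measurable measurable_snd)
    exact (aemeasurable_kernel hk).mul (h1.enorm.pow_const 2).aemeasurable
  rw [lintegral_prod_symm _ hm2]
  calc _ = ∫⁻ y, ∫⁻ t, ‖k t‖ₑ * ‖z (y + t) - z y‖ₑ ^ 2 := by
        refine lintegral_congr fun y => ?_
        rw [← lintegral_add_left_eq_self _ y]
        simp
    _ = ∫⁻ t, ∫⁻ y, ‖k t‖ₑ * ‖z (y + t) - z y‖ₑ ^ 2 :=
        lintegral_lintegral_swap hm.aemeasurable
    _ ≤ ∫⁻ t, ‖k t‖ₑ * D := by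
        refine lintegral_mono fun t => ?_
        by_cases ht : ‖t‖ ≤ ρ * ε
        · have h1 : Measurable fun y => ‖z (y + t) - z y‖ₑ ^ 2 :=
            ((hz.comp_measurable (measurable_add_const t)).sub hz).enorm.pow_const 2
          rw [lintegral_const_mul _ h1, lintegral_translate_sub]
          exact mul_le_mul' le_rfl (hD t ht)
        · simp [hk.support t (not_le.mp ht)]
    _ = D := by rw [lintegral_mul_const _ hkm.enorm, hk.lintegral_enorm, one_mul]

/-- Cauchy–Schwarz for the measure `k (x - y) dx dy`. The factor `|q (y)|² |h (x / ε)|²` is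
integrated first in `x`, where the kernel identity produces the norm of `h` on the cell. -/
theorem lintegral_kernel_inner_le (hε : 0 < ε) (hk : OscKernel ρ C ε k)
    (q : Lp ℂ 2 (volume : Measure (Space d))) (h : L2VecCell n d) {B : Space d × Space d → Vec n}
    (hB : AEStronglyMeasurable B (volume.prod volume)) :
    (∫⁻ p, ‖k (p.1 - p.2) • (q p.2 * inner ℂ (B p) (h (cellFract (ε⁻¹ • p.1))))‖ₑ
      ∂(volume.prod volume)) ^ 2 ≤ (‖q‖ₑ ^ 2 * ‖h‖ₑ ^ 2) *
        ∫⁻ p, ‖k (p.1 - p.2)‖ₑ * ‖B p‖ₑ ^ 2 ∂(volume.prod volume) := by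
  have hH := aestronglyMeasurable_comp_cellFract hε (Lp.aestronglyMeasurable h)
  have hq := Lp.aestronglyMeasurable q
  have hk' := aemeasurable_kernel hk
  have hqH : AEMeasurable (fun p : Space d × Space d => ‖q p.2‖ₑ * ‖h (cellFract (ε⁻¹ • p.1))‖ₑ)
      (volume.prod volume) := hq.comp_snd.enorm.mul hH.comp_fst.enorm
  have h1 : ∫⁻ p, ‖k (p.1 - p.2)‖ₑ * (‖q p.2‖ₑ * ‖h (cellFract (ε⁻¹ • p.1))‖ₑ) ^ 2
      ∂(volume.prod volume) = ‖q‖ₑ ^ 2 * ‖h‖ₑ ^ 2 := by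
    have hm : AEMeasurable (fun p : Space d × Space d => ‖k (p.1 - p.2)‖ₑ *
        (‖q p.2‖ₑ * ‖h (cellFract (ε⁻¹ • p.1))‖ₑ) ^ 2) (volume.prod volume) :=
      hk'.mul (hqH.pow_const 2)
    rw [lintegral_prod_symm _ hm, ← lintegral_enorm_sq q,
      ← lintegral_enorm_sq h, ← lintegral_mul_const'' _ (hq.enorm.pow_const 2)]
    refine lintegral_congr fun y => ?_
    rw [← hk.lintegral _ ((Lp.stronglyMeasurable h).enorm.pow_const 2) y,
      ← lintegral_const_mul' _ _ (by finiteness)]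
    refine lintegral_congr fun x => ?_
    rw [hk.enorm_eq]
    ring
  rw [← h1]
  refine le_trans ?_ (lintegral_weight_mul_mul_sq_le hk' hqH hB.enorm)
  gcongr with p
  rw [enorm_smul]
  gcongr
  rw [enorm_mul, mul_assoc]
  gcongr
  rw [mul_comm]
  rw [← enorm_norm (B p), ← enorm_norm (h _), ← enorm_mul]
  refine enorm_le_iff_norm_le.mpr ?_
  rw [Real.norm_of_nonneg (by positivity)]
  exact norm_inner_le_norm _ _

theorem integrable_kernel_inner (hε : 0 < ε) (hk : OscKernel ρ C ε k)
    (q : Lp ℂ 2 (volume : Measure (Space d))) (h : L2VecCell n d) {B : Space d × Space d → Vec n}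
    (hB : AEStronglyMeasurable B (volume.prod volume))
    (hfin : ∫⁻ p, ‖k (p.1 - p.2)‖ₑ * ‖B p‖ₑ ^ 2 ∂(volume.prod volume) < ⊤) :
    Integrable (fun p : Space d × Space d =>
      k (p.1 - p.2) • (q p.2 * inner ℂ (B p) (h (cellFract (ε⁻¹ • p.1))))) (volume.prod volume) := by
  have hH := aestronglyMeasurable_comp_cellFract hε (Lp.aestronglyMeasurable h)
  have hkm : Continuous k := hk.contDiff.continuous
  refine ⟨?_, ?_⟩
  · have h1 : Continuous fun p : Space d × Space d => k (p.1 - p.2) := by fun_prop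
    exact h1.aestronglyMeasurable.smul
      ((Lp.aestronglyMeasurable q).comp_snd.mul (hB.inner hH.comp_fst))
  · have h1 := lintegral_kernel_inner_le hε hk q h hB
    have h2 : (‖q‖ₑ ^ 2 * ‖h‖ₑ ^ 2) *
        ∫⁻ p, ‖k (p.1 - p.2)‖ₑ * ‖B p‖ₑ ^ 2 ∂(volume.prod volume) < ⊤ :=
      ENNReal.mul_lt_top (ENNReal.mul_lt_top (ENNReal.pow_lt_top enorm_lt_top)
        (ENNReal.pow_lt_top enorm_lt_top)) hfin
    exact (ENNReal.pow_lt_top_iff.mp (h1.trans_lt h2)).resolve_right (by norm_num)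

/-- A mean-free oscillating function is small against functions with a weak gradient. -/
theorem norm_inner_oscMul_le (hε : 0 < ε) (hk : OscKernel ρ C ε k)
    (q : Lp ℂ 2 (volume : Measure (Space d))) (h : L2VecCell n d) (hρ : 0 < ρ)
        (h0 : cellAvg d (Vec n) h = 0) {z : L2Vec n d}
    {Z : L2Mat n d} (hz : IsWeakGrad z Z) :
    ‖inner ℂ z (oscMul hε hk q h)‖ ≤ ρ * ε * ‖q‖ * ‖h‖ * ‖Z‖ := by
  have hzm := Lp.aestronglyMeasurable z
  have hzt : ∫⁻ x, ‖z x‖ₑ ^ 2 < ⊤ := by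
    rw [lintegral_enorm_sq]
    exact ENNReal.pow_lt_top enorm_lt_top
  have hI1 := integrable_kernel_inner hε hk q h hzm.comp_fst (by
    rw [lintegral_kernel_fst hk (hzm.enorm.pow_const 2)]
    exact hzt)
  have hI2 := integrable_kernel_inner hε hk q h hzm.comp_snd (by
    rw [lintegral_kernel_snd hk (hzm.enorm.pow_const 2)]
    exact hzt)
  -- The mollification is unfolded so that the kernel links the point `x` of the oscillation to the
  -- point `y` of `q`.
  have e1 : inner ℂ z (oscMul hε hk q h) = ∫ p : Space d × Space d,
      k (p.1 - p.2) • (q p.2 * inner ℂ (z p.1) (h (cellFract (ε⁻¹ • p.1))))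
        ∂(volume.prod volume) := by
    rw [integral_prod _ hI1, L2.inner_def]
    refine integral_congr_ae ?_
    filter_upwards [coeFn_oscMul hε hk q h] with x hx
    rw [hx, inner_smul_right, moll, ← integral_mul_const]
    simp only [Complex.real_smul, mul_assoc]
  -- With `z` evaluated at `y`, the `x`-integral is the kernel average of `h (x / ε)`, which is
  -- exactly the mean of `h` and so vanishes. Subtracting this puts a difference of values of `z` in
  -- place of `z`.
  have e2 : ∫ p : Space d × Space d,
      k (p.1 - p.2) • (q p.2 * inner ℂ (z p.2) (h (cellFract (ε⁻¹ • p.1))))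
        ∂(volume.prod volume) = 0 := by
    rw [integral_prod_symm _ hI2]
    refine integral_eq_zero_of_ae (Filter.Eventually.of_forall fun y => ?_)
    have h1 := hk.integral_smul (Lp.aestronglyMeasurable h) y
    rw [← cellAvg_apply, h0] at h1
    have h2 : Integrable fun x => k (x - y) • h (cellFract (ε⁻¹ • x)) := by
      refine ⟨((hk.contDiff.continuous.comp (by fun_prop)).aestronglyMeasurable).smul
        (aestronglyMeasurable_comp_cellFract hε (Lp.aestronglyMeasurable h)), ?_⟩
      have h3 := hk.lintegral _ (Lp.stronglyMeasurable h).enorm y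
      have h4 := (integrable_cell h).2
      rw [HasFiniteIntegral, ← h3] at h4
      refine lt_of_le_of_lt (le_of_eq (lintegral_congr fun x => ?_)) h4
      rw [enorm_smul, hk.enorm_eq]
    have h5 := integral_inner (𝕜 := ℂ) h2 (z y)
    rw [h1, inner_zero_right] at h5
    have h6 : ∀ x, k (x - y) • (q y * inner ℂ (z y) (h (cellFract (ε⁻¹ • x)))) =
        q y * inner ℂ (z y) (k (x - y) • h (cellFract (ε⁻¹ • x))) := by
      intro x
      rw [inner_smul_right_eq_smul, mul_smul_comm]
    simp_rw [h6]
    rw [integral_const_mul, h5, mul_zero]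
    rfl
  have hB : AEStronglyMeasurable (fun p : Space d × Space d => z p.1 - z p.2)
      (volume.prod volume) := hzm.comp_fst.sub hzm.comp_snd
  have e3 : inner ℂ z (oscMul hε hk q h) = ∫ p : Space d × Space d,
      k (p.1 - p.2) • (q p.2 * inner ℂ (z p.1 - z p.2) (h (cellFract (ε⁻¹ • p.1))))
        ∂(volume.prod volume) := by
    rw [e1, ← sub_zero (integral _ _), ← e2, ← integral_sub hI1 hI2]
    refine integral_congr_ae (Filter.Eventually.of_forall fun p => ?_)
    simp only [inner_sub_left, mul_sub, smul_sub]
  have hρε : 0 ≤ ρ * ε := by positivity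
  refine norm_le_of_enorm_sq_le (by positivity) ?_
  have h7 := lintegral_kernel_inner_le hε hk q h hB
  have h8 := lintegral_kernel_sub_le hk (z := z) (D := ENNReal.ofReal (ρ * ε * ‖Z‖) ^ 2)
    (fun t ht => by
      refine pow_le_pow_left' ?_ 2
      rw [← ofReal_norm]
      refine ENNReal.ofReal_le_ofReal ((norm_translate_sub_le hz t).trans ?_)
      gcongr)
  rw [e3]
  calc _ ≤ _ := pow_le_pow_left' (enorm_integral_le_lintegral_enorm _) 2
    _ ≤ _ := h7
    _ ≤ _ := mul_le_mul' le_rfl h8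
    _ = _ := by
      rw [← ofReal_norm q, ← ofReal_norm h, ← mul_pow, ← mul_pow,
        ← ENNReal.ofReal_mul (norm_nonneg _), ← ENNReal.ofReal_mul (by positivity)]
      congr 2
      ring

end

section

/-! ### Translation regularity for translation-invariant problems -/

variable {n d : ℕ} {ρ C ε : ℝ} {k : Space d → ℝ}

theorem translate_neg_translate {V : Type} [NormedAddCommGroup V] [InnerProductSpace ℂ V]
    (h : Space d) (u : Lp V 2 (volume : Measure (Space d))) :
    translate h (translate (-h) u) = u := by
  refine Lp.ext ?_
  filter_upwards [coeFn_translate h (translate (-h) u),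
    (measurePreserving_add_right volume h).quasiMeasurePreserving.ae_eq_comp
      (coeFn_translate (-h) u)] with x h1 h2
  simp only [Function.comp_apply] at h2
  rw [h1, h2, add_neg_cancel_right]

theorem inner_translate {V : Type} [NormedAddCommGroup V] [InnerProductSpace ℂ V]
    (h : Space d) (u v : Lp V 2 (volume : Measure (Space d))) :
    inner ℂ u (translate h v) = inner ℂ (translate (-h) u) v := by
  conv_lhs => rw [← translate_neg_translate h u]
  exact LinearIsometry.inner_map_map _ _ _

theorem IsWeakGrad.sub {u v : L2Vec n d} {g w : L2Mat n d} (h1 : IsWeakGrad u g)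
    (h2 : IsWeakGrad v w) : IsWeakGrad (u - v) (g - w) :=
  (gradGraph n d).sub_mem (x := (u, g)) (y := (v, w)) h1 h2

theorem IsWeakGrad.sum {ι : Type*} {s : Finset ι} {u : ι → L2Vec n d} {g : ι → L2Mat n d}
    (h : ∀ i ∈ s, IsWeakGrad (u i) (g i)) : IsWeakGrad (∑ i ∈ s, u i) (∑ i ∈ s, g i) := by
  have h1 := (gradGraph n d).sum_mem (t := s) (f := fun i => (u i, g i)) h
  rwa [← prod_mk_sum] at h1

theorem IsWeakGrad.translate {u : L2Vec n d} {g : L2Mat n d} (hug : IsWeakGrad u g)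
    (h : Space d) : IsWeakGrad (translate h u) (translate h g) := by
  intro φ hφ hc i j
  have hφ' : ContDiff ℝ ∞ fun x => φ (x + -h) := hφ.comp (by fun_prop)
  have hc' : HasCompactSupport fun x => φ (x + -h) :=
    hc.comp_homeomorph (Homeomorph.addRight (-h))
  have h1 := hug _ hφ' hc' i j
  rw [← integral_add_right_eq_self (μ := volume) _ h,
    ← integral_add_right_eq_self (μ := volume) (fun x => φ (x + -h) • g x (i, j)) h] at h1
  refine Eq.trans ?_ (h1.trans ?_)
  · refine integral_congr_ae ?_
    filter_upwards [coeFn_translate h u] with x hx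
    rw [hx, fderiv_comp_add_right (𝕜 := ℝ), add_neg_cancel_right]
  · congr 1
    refine integral_congr_ae ?_
    filter_upwards [coeFn_translate h g] with x hx
    rw [hx, add_neg_cancel_right]

theorem mulCLM_const_translate {V : Type} [NormedAddCommGroup V] [InnerProductSpace ℂ V]
    (B : V →L[ℂ] V) (hB : MemLp (fun _ : Space d => B) ⊤ volume) (h : Space d)
    (u : Lp V 2 (volume : Measure (Space d))) :
    mulCLM _ hB (translate h u) = translate h (mulCLM _ hB u) := by
  refine Lp.ext ?_
  filter_upwards [coeFn_mulCLM _ hB (translate h u), coeFn_translate h u,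
    coeFn_translate h (mulCLM _ hB u),
    (measurePreserving_add_right volume h).quasiMeasurePreserving.ae_eq_comp
      (coeFn_mulCLM _ hB u)] with x h1 h2 h3 h4
  simp only [Function.comp_apply] at h4
  rw [h1, h2, h3, h4]

/-- The difference-quotient method: since `A` and `S` commute with translations, testing with the
second difference of `u` gives the energy of the first difference on the left. On the right stands a
translation difference of `δ`, at most `|h| ‖Δ‖` by the translation estimate, and one factor `‖Δ‖`
cancels. -/
theorem IsWeakSolution.norm_translate_sub_le {A : L2Mat n d →L[ℂ] L2Mat n d}
    {S : L2Vec n d →L[ℂ] L2Vec n d} {c : ℝ} (hc : 0 < c)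
    (hA : ∀ g, c * ‖g‖ ^ 2 ≤ (inner ℂ g (A g)).re) (hS : ∀ u, c * ‖u‖ ^ 2 ≤ (inner ℂ u (S u)).re)
    (hAt : ∀ h g, A (translate h g) = translate h (A g))
    (hSt : ∀ h u, S (translate h u) = translate h (S u)) {f u : L2Vec n d} {g : L2Mat n d}
    (hsol : IsWeakSolution A S f u g) (h : Space d) :
    ‖FibreHom.translate h g - g‖ ≤ c⁻¹ * ‖f‖ * ‖h‖ := by
  set δ := FibreHom.translate h u - u with hδ
  set Δ := FibreHom.translate h g - g with hΔ
  have hw : IsWeakGrad δ Δ := (hsol.1.translate h).sub hsol.1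
  have h1 := hsol.2 δ Δ hw
  have h2 := hsol.2 _ _ (hw.translate (-h))
  rw [← inner_translate, ← inner_translate, ← hAt, ← hSt] at h2
  have h3 : inner ℂ Δ (A Δ) + inner ℂ δ (S δ) = inner ℂ (FibreHom.translate (-h) δ - δ) f := by
    have h4 : A Δ = A (FibreHom.translate h g) - A g := map_sub A _ _
    have h5 : S δ = S (FibreHom.translate h u) - S u := map_sub S _ _
    rw [inner_sub_left (FibreHom.translate (-h) δ) δ f, ← h1, ← h2, h4, h5, inner_sub_right Δ,
      inner_sub_right δ]
    ring
  have h4 : c * ‖Δ‖ ^ 2 ≤ ‖h‖ * ‖Δ‖ * ‖f‖ := by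
    have h5 := congrArg Complex.re h3
    rw [Complex.add_re] at h5
    have h6 := hA Δ
    have h7 := (hS δ).trans' (by positivity : (0 : ℝ) ≤ c * ‖δ‖ ^ 2)
    calc c * ‖Δ‖ ^ 2 ≤ (inner ℂ (FibreHom.translate (-h) δ - δ) f).re := by linarith
      _ ≤ ‖inner ℂ (FibreHom.translate (-h) δ - δ) f‖ := Complex.re_le_norm _
      _ ≤ ‖FibreHom.translate (-h) δ - δ‖ * ‖f‖ := norm_inner_le_norm _ _
      _ ≤ _ := by
        have := FibreHom.norm_translate_sub_le hw (-h)
        rw [norm_neg] at this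
        gcongr
  by_cases h0 : ‖Δ‖ = 0
  · rw [h0]
    positivity
  · have h8 : 0 < ‖Δ‖ := lt_of_le_of_ne (norm_nonneg _) (Ne.symm h0)
    rw [mul_assoc, inv_mul_eq_div, le_div_iff₀' hc]
    refine le_of_mul_le_mul_right ?_ h8
    linarith

theorem IsWeakSolution.norm_le {A : L2Mat n d →L[ℂ] L2Mat n d}
    {S : L2Vec n d →L[ℂ] L2Vec n d} {c : ℝ} (hc : 0 < c)
    (hA : ∀ g, c * ‖g‖ ^ 2 ≤ (inner ℂ g (A g)).re) (hS : ∀ u, c * ‖u‖ ^ 2 ≤ (inner ℂ u (S u)).re)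
    {f u : L2Vec n d} {g : L2Mat n d} (hsol : IsWeakSolution A S f u g) :
    ‖u‖ ≤ c⁻¹ * ‖f‖ ∧ ‖g‖ ≤ c⁻¹ * ‖f‖ := by
  have h1 := congrArg Complex.re (hsol.2 u g hsol.1)
  rw [Complex.add_re] at h1
  have h2 : (inner ℂ u f).re ≤ ‖u‖ * ‖f‖ :=
    (Complex.re_le_norm _).trans (norm_inner_le_norm _ _)
  have h3 : c * ‖g‖ ^ 2 + c * ‖u‖ ^ 2 ≤ ‖u‖ * ‖f‖ := by linarith [hA g, hS u]
  have h4 : ‖u‖ ≤ c⁻¹ * ‖f‖ := by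
    rw [inv_mul_eq_div, le_div_iff₀' hc]
    by_cases h0 : ‖u‖ = 0
    · rw [h0, mul_zero]
      exact norm_nonneg _
    · have h5 : 0 < ‖u‖ := lt_of_le_of_ne (norm_nonneg _) (Ne.symm h0)
      refine le_of_mul_le_mul_right ?_ h5
      nlinarith [sq_nonneg ‖g‖, mul_nonneg hc.le (sq_nonneg ‖g‖)]
  refine ⟨h4, ?_⟩
  refine (sq_le_sq₀ (norm_nonneg _) (by positivity)).mp ?_
  calc ‖g‖ ^ 2 ≤ c⁻¹ * (‖u‖ * ‖f‖) := by
        rw [inv_mul_eq_div, le_div_iff₀' hc]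
        nlinarith [mul_nonneg hc.le (sq_nonneg ‖u‖)]
    _ ≤ c⁻¹ * ((c⁻¹ * ‖f‖) * ‖f‖) := by gcongr
    _ = _ := by ring

/-! ### Smoothing of functions with translation regularity -/

section Smoothing

variable {V : Type} [NormedAddCommGroup V] [NormedSpace ℂ V] [CompleteSpace V]

/-- Mollification on `L²`. -/
def mollL (hk : OscKernel ρ C ε k) (f : Lp V 2 (volume : Measure (Space d))) :
    Lp V 2 (volume : Measure (Space d)) :=
  (memLp_moll hk (Lp.memLp f)).toLp _

theorem coeFn_mollL (hk : OscKernel ρ C ε k) (f : Lp V 2 (volume : Measure (Space d))) :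
    mollL hk f =ᵐ[volume] moll k f :=
  (memLp_moll hk (Lp.memLp f)).coeFn_toLp

theorem norm_mollL_le (hk : OscKernel ρ C ε k) (f : Lp V 2 (volume : Measure (Space d))) :
    ‖mollL hk f‖ ≤ ‖f‖ := by
  refine norm_le_of_enorm_sq_le (norm_nonneg _) ?_
  have h := hk.lintegral_mul_moll_le (F := fun _ => 1) measurable_const (Lp.aestronglyMeasurable f)
  simp only [one_mul, lintegral_const, measure_univ] at h
  rw [ofReal_norm, ← lintegral_enorm_sq f]
  exact (lintegral_enorm_sq_toLp (memLp_moll hk (Lp.memLp f))).trans_le h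

theorem moll_congr_ae {V : Type*} [NormedAddCommGroup V] [NormedSpace ℝ V]
    {k : Space d → ℝ} {f g : Space d → V} (h : f =ᵐ[volume] g) :
    moll k f = moll k g := by
  funext x
  refine integral_congr_ae ?_
  filter_upwards [h] with y hy
  rw [hy]

theorem mollL_sub (hk : OscKernel ρ C ε k) (f g : Lp V 2 (volume : Measure (Space d))) :
    mollL hk (f - g) = mollL hk f - mollL hk g := by
  refine Lp.ext ?_
  filter_upwards [coeFn_mollL hk (f - g), coeFn_mollL hk f, coeFn_mollL hk g,
    Lp.coeFn_sub (mollL hk f) (mollL hk g)] with x h1 h2 h3 h4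
  rw [h1, h4, Pi.sub_apply, h2, h3, moll_congr_ae (Lp.coeFn_sub f g), moll, moll, moll,
    ← integral_sub (integrable_moll hk.contDiff.continuous hk.hasCompactSupport
      (locallyIntegrable_lp f) x) (integrable_moll hk.contDiff.continuous hk.hasCompactSupport
      (locallyIntegrable_lp g) x)]
  simp only [Pi.sub_apply, smul_sub]

theorem norm_mollL_sub_le (hρε : 0 ≤ ρ * ε) (hk : OscKernel ρ C ε k)
    {f : Lp V 2 (volume : Measure (Space d))}
    {L : ℝ} (hL0 : 0 ≤ L) (hL : ∀ h, ‖translate h f - f‖ ≤ L * ‖h‖) :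
    ‖mollL hk f - f‖ ≤ L * (ρ * ε) :=
  norm_moll_sub_le hk f (by positivity) fun h hh =>
    (hL h).trans (mul_le_mul_of_nonneg_left hh hL0)

theorem norm_mollL_mollL_sub_le (hρε : 0 ≤ ρ * ε) (hk : OscKernel ρ C ε k)
    {f : Lp V 2 (volume : Measure (Space d))}
    {L : ℝ} (hL0 : 0 ≤ L) (hL : ∀ h, ‖translate h f - f‖ ≤ L * ‖h‖) :
    ‖mollL hk (mollL hk f) - f‖ ≤ 2 * (L * (ρ * ε)) := by
  have h1 := norm_mollL_sub_le hρε hk hL0 hL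
  have h2 : ‖mollL hk (mollL hk f) - mollL hk f‖ ≤ L * (ρ * ε) := by
    rw [← mollL_sub]
    exact (norm_mollL_le hk _).trans h1
  calc _ = ‖(mollL hk (mollL hk f) - mollL hk f) + (mollL hk f - f)‖ := by rw [sub_add_sub_cancel]
    _ ≤ _ := (norm_add_le _ _).trans (by linarith)

end Smoothing

theorem fderiv_kernel_eq_zero (hk : OscKernel ρ C ε k) {x : Space d} (hx : ρ * ε < ‖x‖)
    (v : Space d) : fderiv ℝ k x v = 0 := by
  have h : k =ᶠ[nhds x] fun _ => 0 := by
    filter_upwards [(continuous_norm.tendsto x).eventually (lt_mem_nhds hx)] with y hy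
    exact hk.support y hy
  rw [h.fderiv_eq]
  simp

/-- Smoothing twice makes each derivative a mollification again: one kernel absorbs the derivative
and the other remains, with `q j = (∂_j k) * f`. Translation regularity bounds `q j` uniformly in
`ε` without forming second derivatives of the solution. -/
theorem exists_deriv_moll_mollL (hε : 0 < ε) (hρ : 0 < ρ) (hC : 0 < C) (hk : OscKernel ρ C ε k)
    {f : Lp ℂ 2 (volume : Measure (Space d))} {L : ℝ} (hL0 : 0 ≤ L)
    (hL : ∀ h, ‖translate h f - f‖ ≤ L * ‖h‖) :
    ∃ q : Fin d → Lp ℂ 2 (volume : Measure (Space d)),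
      (∀ j x, fderiv ℝ (moll k (mollL hk f)) x (basisVec j) = moll k (q j) x) ∧
      ∀ j, ‖q j‖ ≤ C * ρ * L := by
  have hf := locallyIntegrable_lp f
  have hkd : ∀ j : Fin d, Continuous fun x => fderiv ℝ k x (basisVec j) :=
    fun j => continuous_partial hk.contDiff j
  have hkc : ∀ j : Fin d, HasCompactSupport fun x => fderiv ℝ k x (basisVec j) :=
    fun j => hk.hasCompactSupport.fderiv_apply ℝ _
  have hsm := contDiff_moll hk.contDiff hk.hasCompactSupport hf
  have hfd : ∀ j x, fderiv ℝ (moll k f) x (basisVec j) =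
      moll (fun y => fderiv ℝ k y (basisVec j)) f x := fun j x =>
    fderiv_moll hk.contDiff hk.hasCompactSupport hf x _
  have hcont : ∀ j : Fin d, Continuous (moll (fun y => fderiv ℝ k y (basisVec j)) f) := by
    intro j
    rw [← funext (hfd j)]
    exact (hsm.continuous_fderiv (by simp)).clm_apply continuous_const
  have hbd : ∀ j : Fin d, ∫⁻ x, ‖moll (fun y => fderiv ℝ k y (basisVec j)) f x‖ₑ ^ 2 ≤
      ENNReal.ofReal (C * ρ * L) ^ 2 := by
    intro j
    have h1 := lintegral_moll_sub_le (hkd j) (hkc j)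
      (fun x hx => fderiv_kernel_eq_zero hk hx (basisVec j)) hf
      (D := ENNReal.ofReal (L * (ρ * ε)) ^ 2) (fun h hh => by
        rw [lintegral_translate_sub]
        refine pow_le_pow_left' ?_ 2
        rw [← ofReal_norm]
        exact ENNReal.ofReal_le_ofReal ((hL h).trans (mul_le_mul_of_nonneg_left hh hL0)))
    -- The kernel `∂_j k` has mean zero, so its convolution with `f` sees only differences of `f`:
    -- the bound is `(C / ε) (L ρ ε) = C ρ L`.
    simp only [hk.integral_partial, zero_smul, sub_zero] at h1
    refine h1.trans ?_
    calc _ ≤ ENNReal.ofReal (C / ε) ^ 2 * ENNReal.ofReal (L * (ρ * ε)) ^ 2 :=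
          mul_le_mul' (pow_le_pow_left' (hk.lintegral_partial j) 2) le_rfl
      _ = _ := by
        rw [← mul_pow, ← ENNReal.ofReal_mul (by positivity)]
        congr 2
        field_simp
  have hq : ∀ j : Fin d, MemLp (moll (fun y => fderiv ℝ k y (basisVec j)) f) 2 volume := fun j =>
    memLp_two_of_lintegral_lt_top (hcont j).aestronglyMeasurable
      ((hbd j).trans_lt (ENNReal.pow_lt_top ENNReal.ofReal_lt_top))
  refine ⟨fun j => (hq j).toLp _, fun j x => ?_, fun j => ?_⟩
  · rw [moll_congr_ae (coeFn_mollL hk f), moll_congr_ae (hq j).coeFn_toLp,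
      fderiv_moll hk.contDiff hk.hasCompactSupport hsm.continuous.locallyIntegrable]
    refine moll_fderiv_eq hk.contDiff hk.hasCompactSupport (fun φ hφ hφc => ?_) x
    have h5 := integral_smul_fderiv_eq_neg_fderiv_smul_of_integrable
      (μ := (volume : Measure (Space d))) (f := φ) (g := moll k f) (v := basisVec j) (𝕜 := ℝ)
      (((continuous_partial hφ j).smul hsm.continuous).integrable_of_hasCompactSupport
        ((hφc.fderiv_apply ℝ (basisVec j)).smul_right))
      ((hφ.continuous.smul ((hsm.continuous_fderiv (by simp)).clm_apply
        continuous_const)).integrable_of_hasCompactSupport hφc.smul_right)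
      ((hφ.continuous.smul hsm.continuous).integrable_of_hasCompactSupport hφc.smul_right)
      (fun x _ => (hφ.differentiable (by simp)) x) (fun x _ => (hsm.differentiable (by simp)) x)
    simp_rw [hfd] at h5
    rw [h5, neg_neg]
  · refine norm_le_of_enorm_sq_le (by positivity) ?_
    exact (lintegral_enorm_sq_toLp (hq j)).trans_le (hbd j)

/-! ### Components -/

section Component

variable {ι : Type} [Fintype ι]

/-- Components of `L²` functions. -/
def coordL (i : ι) : Lp (EuclideanSpace ℂ ι) 2 (volume : Measure (Space d)) →L[ℂ]
    Lp ℂ 2 (volume : Measure (Space d)) :=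
  (EuclideanSpace.proj i : EuclideanSpace ℂ ι →L[ℂ] ℂ).compLpL 2 volume

theorem coeFn_coordL (i : ι) (u : Lp (EuclideanSpace ℂ ι) 2 (volume : Measure (Space d))) :
    coordL i u =ᵐ[volume] fun x => u x i :=
  ContinuousLinearMap.coeFn_compLpL _ u

theorem norm_coordL_le (i : ι) (u : Lp (EuclideanSpace ℂ ι) 2 (volume : Measure (Space d))) :
    ‖coordL i u‖ ≤ ‖u‖ := by
  refine Lp.norm_le_norm_of_ae_le ?_
  filter_upwards [coeFn_coordL i u] with x hx
  rw [hx]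
  exact PiLp.norm_apply_le _ i

theorem coordL_translate (i : ι) (h : Space d)
    (u : Lp (EuclideanSpace ℂ ι) 2 (volume : Measure (Space d))) :
    coordL i (translate h u) = translate h (coordL i u) := by
  refine Lp.ext ?_
  filter_upwards [coeFn_coordL i (translate h u), coeFn_translate h u,
    coeFn_translate h (coordL i u),
    (measurePreserving_add_right volume h).quasiMeasurePreserving.ae_eq_comp
      (coeFn_coordL i u)] with x h1 h2 h3 h4
  simp only [Function.comp_apply] at h4
  rw [h1, h2, h3, h4]

theorem norm_translate_coordL_sub_le (i : ι) (h : Space d)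
    (u : Lp (EuclideanSpace ℂ ι) 2 (volume : Measure (Space d))) :
    ‖translate h (coordL i u) - coordL i u‖ ≤ ‖translate h u - u‖ := by
  rw [← coordL_translate, ← map_sub]
  exact norm_coordL_le _ _

/-- With constant profiles the sum is the field whose components are the mollified `F i`, so the
error is estimated component by component. -/
theorem norm_sum_oscMul_sub_le [DecidableEq ι] (hε : 0 < ε) (hk : OscKernel ρ C ε k)
    (u : Lp (EuclideanSpace ℂ ι) 2 (volume : Measure (Space d)))
    (F : ι → Lp ℂ 2 (volume : Measure (Space d))) {D : ℝ}
    (hD : ∀ i, ‖mollL hk (F i) - coordL i u‖ ≤ D) :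
    ‖∑ i, oscMul hε hk (F i) (cellConst d (EuclideanSpace ℂ ι) (EuclideanSpace.single i 1)) - u‖ ≤
      Fintype.card ι * D := by
  set e : ι → Lp ℂ 2 (volume : Measure (Space d)) →L[ℂ]
      Lp (EuclideanSpace ℂ ι) 2 (volume : Measure (Space d)) := fun i =>
    (ContinuousLinearMap.toSpanSingleton ℂ (EuclideanSpace.single i (1 : ℂ))).compLpL 2 volume
    with he
  have he1 : ∀ i v, e i v =ᵐ[volume] fun x => v x • EuclideanSpace.single i (1 : ℂ) := fun i v =>
    ContinuousLinearMap.coeFn_compLpL _ v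
  have he2 : ∀ i v, ‖e i v‖ ≤ ‖v‖ := by
    intro i v
    refine Lp.norm_le_norm_of_ae_le ?_
    filter_upwards [he1 i v] with x hx
    rw [hx, norm_smul]
    simp
  have h1 : u = ∑ i, e i (coordL i u) := by
    refine Lp.ext ?_
    filter_upwards [Lp.coeFn_finsetSum Finset.univ fun i => e i (coordL i u),
      ae_all_iff.mpr fun i => he1 i (coordL i u), ae_all_iff.mpr fun i => coeFn_coordL i u]
      with x h2 h3 h4
    rw [h2, Finset.sum_apply]
    simp only [h3, h4]
    ext i
    simp [Pi.single_apply]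
  have h2 : ∀ i, oscMul hε hk (F i)
      (cellConst d (EuclideanSpace ℂ ι) (EuclideanSpace.single i 1)) = e i (mollL hk (F i)) := by
    intro i
    refine Lp.ext ?_
    filter_upwards [coeFn_oscMul_cellConst hε hk (F i) (EuclideanSpace.single i (1 : ℂ)),
      he1 i (mollL hk (F i)), coeFn_mollL hk (F i)] with x h3 h4 h5
    rw [h3, h4, h5]
  conv_lhs => rw [h1]
  simp only [h2]
  rw [← Finset.sum_sub_distrib]
  calc _ ≤ ∑ _i : ι, D := by
        refine norm_sum_le_of_le _ fun i _ => ?_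
        rw [← map_sub]
        exact (he2 i _).trans (hD i)
    _ = _ := by simp

end Component

end

section

/-! ### The two-scale error estimate -/

variable {n d : ℕ} {ρ C ε : ℝ} {k : Space d → ℝ}

/-- Multiplication by a constant coefficient. -/
def constMul {V : Type} [NormedAddCommGroup V] [InnerProductSpace ℂ V] (d : ℕ) (B : V →L[ℂ] V) :
    Lp V 2 (volume : Measure (Space d)) →L[ℂ] Lp V 2 (volume : Measure (Space d)) :=
  mulCLM (fun _ => B) (memLp_top_const B)

theorem constMul_oscMul {V : Type} [NormedAddCommGroup V] [InnerProductSpace ℂ V] (B : V →L[ℂ] V)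
    (hε : 0 < ε) (hk : OscKernel ρ C ε k) (f : Lp ℂ 2 (volume : Measure (Space d))) (v : V) :
    constMul d B (oscMul hε hk f (cellConst d V v)) = oscMul hε hk f (cellConst d V (B v)) := by
  refine Lp.ext ?_
  filter_upwards [coeFn_mulCLM (fun _ => B) (memLp_top_const B)
      (oscMul hε hk f (cellConst d V v)), coeFn_oscMul_cellConst hε hk f v,
    coeFn_oscMul_cellConst hε hk f (B v)] with x h1 h2 h3
  rw [h3, ← map_smul, ← h2]
  exact h1

theorem cellAvg_colL (j : Fin d) (g : L2MatCell n d) :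
    cellAvg d (Vec n) (colL j (cellMeasure d) g) = col j (cellAvg d (Mat n d) g) := by
  rw [cellAvg_apply, cellAvg_apply, integral_congr_ae (coeFn_colL j (cellMeasure d) g)]
  exact (col j).integral_comp_comm (integrable_cell g)

theorem norm_inner_cellFlux_le {a : Space d → Mat n d →L[ℂ] Mat n d} (ha : IsPeriodicCoercive a)
    (hε : 0 < ε) (hρ : 0 < ρ) (hk : OscKernel ρ C ε k) {f : Lp ℂ 2 (volume : Measure (Space d))}
    {q : Fin d → Lp ℂ 2 (volume : Measure (Space d))}
    (hq : ∀ j x, fderiv ℝ (moll k f) x (basisVec j) = moll k (q j) x) {Q : ℝ}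
    (hQ : ∀ j, ‖q j‖ ≤ Q) (rs : Fin n × Fin d) {z : L2Vec n d} {Z : L2Mat n d}
    (hz : IsWeakGrad z Z) :
    ‖inner ℂ Z (oscMul hε hk f (cellFlux ha rs))‖ ≤
      d * (ρ * ε * Q * ‖cellFlux ha rs‖ * ‖Z‖) := by
  rw [inner_oscMul_flux hε hk hq (fun p hp => inner_grad_cellFlux ha rs (subset_closure hp)) hz,
    norm_neg]
  calc _ ≤ ∑ _j : Fin d, ρ * ε * Q * ‖cellFlux ha rs‖ * ‖Z‖ := by
        refine norm_sum_le_of_le _ fun j _ => ?_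
        refine (norm_inner_oscMul_le hε hk (q j) _ hρ ?_ hz).trans ?_
        · rw [cellAvg_colL, cellAvg_cellFlux, map_zero]
        · have h1 := norm_colL_le j (cellMeasure d) (cellFlux ha rs)
          have h2 := hQ j
          have h3 := (norm_nonneg (q j)).trans h2
          gcongr
    _ = _ := by simp

/-- The oscillating part of `s v`, for constant `v`. -/
def cellDefect {s : Space d → Vec n →L[ℂ] Vec n} (hs : IsPeriodicCoercive s) (v : Vec n) :
    L2VecCell n d :=
  mulCLM s (memLp_cell hs) (cellConst d (Vec n) v) - cellConst d (Vec n) (cellMean s v)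

theorem cellAvg_cellDefect {s : Space d → Vec n →L[ℂ] Vec n} (hs : IsPeriodicCoercive s)
    (v : Vec n) : cellAvg d (Vec n) (cellDefect hs v) = 0 := by
  rw [cellDefect, map_sub, cellAvg_cellConst, cellMean_apply hs, sub_self]

section Identity

variable {a : Space d → Mat n d →L[ℂ] Mat n d} {s : Space d → Vec n →L[ℂ] Vec n}

/-- On smoothed fields, `a_ε (∇N + E) - a^hom E` is exactly the oscillating flux. What remains is
the error of replacing `p` by its smoothing and the part of the corrector gradient in which the slow
factor is differentiated. -/
theorem flux_sub_eq (ha : IsPeriodicCoercive a) (hε : 0 < ε) (hk : OscKernel ρ C ε k)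
    (F : Fin n × Fin d → Lp ℂ 2 (volume : Measure (Space d)))
    (q : Fin n × Fin d → Fin d → Lp ℂ 2 (volume : Measure (Space d))) (p : L2Mat n d) :
    constMul d (aHom a 0) p - scaledMul ha hε p - scaledMul ha hε
        (∑ rs, correctorGrad hε hk (F rs) (q rs) (cellSolution a 0 rs)) =
      (scaledMul ha hε (∑ rs, oscMul hε hk (F rs) (cellConst d (Mat n d) (unitMat rs)) - p) -
        constMul d (aHom a 0)
          (∑ rs, oscMul hε hk (F rs) (cellConst d (Mat n d) (unitMat rs)) - p)) -
      ∑ rs, oscMul hε hk (F rs) (cellFlux ha rs) -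
      (ε : ℂ) • scaledMul ha hε (∑ rs, ∑ j, colEmbL j volume
        (oscMul hε hk (q rs j) (cellSolution a 0 rs).1)) := by
  have h1 : ∀ rs, oscMul hε hk (F rs) (cellFlux ha rs) =
      scaledMul ha hε (oscMul hε hk (F rs) (cellSolution a 0 rs).2) +
      scaledMul ha hε (oscMul hε hk (F rs) (cellConst d (Mat n d) (unitMat rs))) -
      constMul d (aHom a 0) (oscMul hε hk (F rs) (cellConst d (Mat n d) (unitMat rs))) := by
    intro rs
    rw [scaledMul_oscMul, scaledMul_oscMul, constMul_oscMul, ← map_add, ← map_add, ← map_sub]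
    rfl
  simp only [h1, correctorGrad, Finset.sum_add_distrib, Finset.sum_sub_distrib, map_add, map_sub,
    ← Finset.smul_sum, map_smul, ← map_sum]
  abel

/-- The zeroth-order term requires no corrector: its oscillation has mean zero and is already paired
with `z` rather than with its gradient. -/
theorem potential_sub_eq (hs : IsPeriodicCoercive s) (hε : 0 < ε) (hk : OscKernel ρ C ε k)
    (F : Fin n → Lp ℂ 2 (volume : Measure (Space d))) (u : L2Vec n d) :
    constMul d (cellMean s) u - scaledMul hs hε u =
      (scaledMul hs hε (∑ r, oscMul hε hk (F r)
          (cellConst d (Vec n) (EuclideanSpace.single r 1)) - u) -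
        constMul d (cellMean s) (∑ r, oscMul hε hk (F r)
          (cellConst d (Vec n) (EuclideanSpace.single r 1)) - u)) -
      ∑ r, oscMul hε hk (F r) (cellDefect hs (EuclideanSpace.single r 1)) := by
  have h1 : ∀ r, oscMul hε hk (F r) (cellDefect hs (EuclideanSpace.single r 1)) =
      scaledMul hs hε (oscMul hε hk (F r) (cellConst d (Vec n) (EuclideanSpace.single r 1))) -
      constMul d (cellMean s)
        (oscMul hε hk (F r) (cellConst d (Vec n) (EuclideanSpace.single r 1))) := by
    intro r
    rw [scaledMul_oscMul, constMul_oscMul, ← map_sub]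
    rfl
  simp only [h1, Finset.sum_sub_distrib, map_sub, ← map_sum]
  abel

end Identity

end

/-! ### Residual bounds and the energy argument -/

section

variable {n d : ℕ} {ρ C ε : ℝ} {k : Space d → ℝ}
  {a : Space d → Mat n d →L[ℂ] Mat n d} {s : Space d → Vec n →L[ℂ] Vec n}

/-- The three summands match the three parts of `flux_sub_eq`: the smoothing error, the mean-free
flux estimated by duality with `z`, and the term with explicit factor `ε`. Only the second uses that
`Z` is a gradient. -/
theorem norm_flux_sub_le (ha : IsPeriodicCoercive a) (hε : 0 < ε) (hρ : 0 < ρ)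
    (hk : OscKernel ρ C ε k) {p : L2Mat n d} {L Q : ℝ} (hL0 : 0 ≤ L)
    (hL : ∀ h, ‖translate h p - p‖ ≤ L * ‖h‖)
    {q : Fin n × Fin d → Fin d → Lp ℂ 2 (volume : Measure (Space d))}
    (hq : ∀ rs j x, fderiv ℝ (moll k (mollL hk (coordL rs p))) x (basisVec j) = moll k (q rs j) x)
    (hQ : ∀ rs j, ‖q rs j‖ ≤ Q) {z : L2Vec n d} {Z : L2Mat n d} (hz : IsWeakGrad z Z) :
    ‖inner ℂ Z (constMul d (aHom a 0) p - scaledMul ha hε p - scaledMul ha hε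
        (∑ rs, correctorGrad hε hk (mollL hk (coordL rs p)) (q rs) (cellSolution a 0 rs)))‖ ≤
      (((eLpNorm a ⊤ volume).toReal + ‖constMul d (aHom a 0)‖) * ((n * d) * (2 * (L * (ρ * ε)))) +
        (∑ rs, d * (ρ * ε * Q * ‖cellFlux ha rs‖)) +
        ε * ((eLpNorm a ⊤ volume).toReal * ∑ rs, d * (Q * ‖(cellSolution a 0 rs).1‖))) * ‖Z‖ := by
  set M := (eLpNorm a ⊤ volume).toReal with hM
  set F : Fin n × Fin d → Lp ℂ 2 (volume : Measure (Space d)) :=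
    fun rs => mollL hk (coordL rs p) with hF
  have h1 : ‖∑ rs, oscMul hε hk (F rs) (cellConst d (Mat n d) (unitMat rs)) - p‖ ≤
      (n * d) * (2 * (L * (ρ * ε))) := by
    have h := norm_sum_oscMul_sub_le hε hk p F (D := 2 * (L * (ρ * ε))) fun rs =>
      norm_mollL_mollL_sub_le (by positivity) hk hL0 fun h =>
        (norm_translate_coordL_sub_le rs h p).trans (hL h)
    simpa [unitMat] using h
  set v := ∑ rs, oscMul hε hk (F rs) (cellConst d (Mat n d) (unitMat rs)) - p with hv
  have h2 : ‖∑ rs, ∑ j, colEmbL (n := n) j volume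
      (oscMul hε hk (q rs j) (cellSolution a 0 rs).1)‖ ≤
      ∑ rs : Fin n × Fin d, d * (Q * ‖(cellSolution a 0 rs).1‖) := by
    refine norm_sum_le_of_le _ fun rs _ => ?_
    calc _ ≤ ∑ _j : Fin d, Q * ‖(cellSolution a 0 rs).1‖ := by
          refine norm_sum_le_of_le _ fun j _ => (norm_colEmbL_le j _ _).trans ?_
          refine (norm_oscMul_le hε hk _ _).trans ?_
          exact mul_le_mul_of_nonneg_right (hQ rs j) (norm_nonneg _)
      _ = _ := by simp
  rw [flux_sub_eq ha hε hk F q p, ← hv, inner_sub_right, inner_sub_right, inner_sum, add_mul,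
    add_mul]
  refine (norm_sub_le _ _).trans (add_le_add ((norm_sub_le _ _).trans (add_le_add ?_ ?_)) ?_)
  · refine (norm_inner_le_norm _ _).trans ?_
    rw [mul_comm]
    refine mul_le_mul_of_nonneg_right ?_ (norm_nonneg _)
    refine (norm_sub_le _ _).trans ?_
    rw [add_mul]
    refine add_le_add ((norm_scaledMul_le ha hε v).trans ?_)
      (((constMul d (aHom a 0)).le_opNorm v).trans ?_)
    · exact mul_le_mul_of_nonneg_left h1 ENNReal.toReal_nonneg
    · exact mul_le_mul_of_nonneg_left h1 (norm_nonneg _)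
  · rw [Finset.sum_mul]
    refine norm_sum_le_of_le _ fun rs _ => ?_
    refine (norm_inner_cellFlux_le ha hε hρ hk (hq rs) (hQ rs) rs hz).trans (le_of_eq ?_)
    ring
  · refine (norm_inner_le_norm _ _).trans ?_
    rw [mul_comm]
    refine mul_le_mul_of_nonneg_right ?_ (norm_nonneg _)
    rw [norm_smul, Complex.norm_real, Real.norm_of_nonneg hε.le]
    refine mul_le_mul_of_nonneg_left ((norm_scaledMul_le ha hε _).trans ?_) hε.le
    exact mul_le_mul_of_nonneg_left h2 ENNReal.toReal_nonneg

/-- A single mollification suffices, as the slow factor is not differentiated; its error is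
controlled by the gradient `p` of `u`. -/
theorem norm_potential_sub_le (hs : IsPeriodicCoercive s) (hε : 0 < ε) (hρ : 0 < ρ)
    (hk : OscKernel ρ C ε k) {u : L2Vec n d} {p : L2Mat n d} (hup : IsWeakGrad u p)
    {z : L2Vec n d} {Z : L2Mat n d} (hz : IsWeakGrad z Z) :
    ‖inner ℂ z (constMul d (cellMean s) u - scaledMul hs hε u)‖ ≤
      ((eLpNorm s ⊤ volume).toReal + ‖constMul d (cellMean s)‖) * (n * (‖p‖ * (ρ * ε))) * ‖z‖ +
      (∑ r, ρ * ε * ‖u‖ * ‖cellDefect hs (EuclideanSpace.single r 1)‖) * ‖Z‖ := by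
  have h1 : ‖∑ r, oscMul hε hk (coordL r u)
      (cellConst d (Vec n) (EuclideanSpace.single r 1)) - u‖ ≤ n * (‖p‖ * (ρ * ε)) := by
    have h := norm_sum_oscMul_sub_le hε hk u (fun r => coordL r u) (D := ‖p‖ * (ρ * ε)) fun r =>
      norm_mollL_sub_le (by positivity) hk (norm_nonneg _) fun h =>
        (norm_translate_coordL_sub_le r h u).trans
          ((norm_translate_sub_le hup h).trans_eq (mul_comm _ _))
    simpa using h
  rw [potential_sub_eq hs hε hk (fun r => coordL r u) u, inner_sub_right, inner_sum]
  set v := ∑ r, oscMul hε hk (coordL r u)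
      (cellConst d (Vec n) (EuclideanSpace.single r 1)) - u with hv
  refine (norm_sub_le _ _).trans (add_le_add ?_ ?_)
  · refine (norm_inner_le_norm _ _).trans ?_
    rw [mul_comm]
    refine mul_le_mul_of_nonneg_right ?_ (norm_nonneg _)
    refine (norm_sub_le _ _).trans ?_
    rw [add_mul]
    refine add_le_add ((norm_scaledMul_le hs hε v).trans ?_)
      (((constMul d (cellMean s)).le_opNorm v).trans ?_)
    · exact mul_le_mul_of_nonneg_left h1 ENNReal.toReal_nonneg
    · exact mul_le_mul_of_nonneg_left h1 (norm_nonneg _)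
  · rw [Finset.sum_mul]
    refine norm_sum_le_of_le _ fun r _ => ?_
    refine (norm_inner_oscMul_le hε hk _ _ hρ (cellAvg_cellDefect hs _) hz).trans ?_
    have := norm_coordL_le r u
    gcongr

set_option maxHeartbeats 1000000 in
/-- First-order correctors for solutions of the homogenised problem. -/
theorem exists_corrector (ha : IsPeriodicCoercive a) (hs : IsPeriodicCoercive s) {c : ℝ}
    (hc : 0 < c) (hA : ∀ v, c * ‖v‖ ^ 2 ≤ (inner ℂ v (aHom a 0 v)).re)
    (hS : ∀ v, c * ‖v‖ ^ 2 ≤ (inner ℂ v (cellMean s v)).re) :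
    ∃ M : ℝ, 0 ≤ M ∧ ∀ (ε : ℝ) (hε : 0 < ε) (f u : L2Vec n d) (p : L2Mat n d),
      IsWeakSolution (constMul d (aHom a 0)) (constMul d (cellMean s)) f u p →
      ∃ w W, IsWeakGrad w W ∧ ‖w‖ ≤ M * ε * ‖f‖ ∧ ∀ z Z, IsWeakGrad z Z →
        ‖inner ℂ Z (constMul d (aHom a 0) p - scaledMul ha hε p - scaledMul ha hε W) +
          inner ℂ z (constMul d (cellMean s) u - scaledMul hs hε u)‖ ≤
          M * ε * ‖f‖ * (‖z‖ + ‖Z‖) := by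
  obtain ⟨ρ, C, hρ, hC, hker⟩ := exists_oscKernel d
  set Ma := (eLpNorm a ⊤ volume).toReal with hMa
  set Ms := (eLpNorm s ⊤ volume).toReal with hMs
  have hMa0 : 0 ≤ Ma := ENNReal.toReal_nonneg
  have hMs0 : 0 ≤ Ms := ENNReal.toReal_nonneg
  set B := ‖constMul d (aHom a 0)‖ with hB
  set D := ‖constMul d (cellMean s)‖ with hD
  have hB0 : 0 ≤ B := norm_nonneg _
  have hD0 : 0 ≤ D := norm_nonneg _
  -- The `mᵢ` are the coefficients of `ε ‖f‖` in the residual bounds once the Lipschitz constant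
  -- `c⁻¹ ‖f‖` of the translates of `p` and the resulting bound `C ρ c⁻¹ ‖f‖` on the `q rs j` are
  -- inserted: `m₁`, `m₂`, `m₃` come from the flux, `m₄`, `m₅` from the zeroth-order term, and `m₆`
  -- from the size of the corrector itself.
  set m₁ := (Ma + B) * ((n * d) * (2 * (c⁻¹ * ρ))) with hm₁
  set m₂ := ∑ rs, d * (ρ * (C * ρ * c⁻¹) * ‖cellFlux ha rs‖) with hm₂
  set m₃ := Ma * ∑ rs, d * ((C * ρ * c⁻¹) * ‖(cellSolution a 0 rs).1‖) with hm₃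
  set m₄ := (Ms + D) * (n * (c⁻¹ * ρ)) with hm₄
  set m₅ := ∑ r, ρ * c⁻¹ * ‖cellDefect hs (EuclideanSpace.single r 1)‖ with hm₅
  set m₆ := ∑ rs, c⁻¹ * ‖(cellSolution a 0 rs).1‖ with hm₆
  have h₁ : 0 ≤ m₁ := by positivity
  have h₂ : 0 ≤ m₂ := Finset.sum_nonneg fun _ _ => by positivity
  have h₃ : 0 ≤ m₃ := mul_nonneg hMa0 (Finset.sum_nonneg fun _ _ => by positivity)
  have h₄ : 0 ≤ m₄ := by positivity
  have h₅ : 0 ≤ m₅ := Finset.sum_nonneg fun _ _ => by positivity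
  have h₆ : 0 ≤ m₆ := Finset.sum_nonneg fun _ _ => by positivity
  refine ⟨m₁ + m₂ + m₃ + m₄ + m₅ + m₆, by positivity, fun ε hε f u p hsol => ?_⟩
  obtain ⟨k, hk⟩ := hker ε hε
  have hA' : ∀ g, c * ‖g‖ ^ 2 ≤ (inner ℂ g (constMul d (aHom a 0) g)).re :=
    re_inner_mulCLM_ge _ _ (Filter.Eventually.of_forall fun _ => hA)
  have hS' : ∀ g, c * ‖g‖ ^ 2 ≤ (inner ℂ g (constMul d (cellMean s) g)).re :=
    re_inner_mulCLM_ge _ _ (Filter.Eventually.of_forall fun _ => hS)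
  obtain ⟨hu, hp⟩ := hsol.norm_le hc hA' hS'
  have hL0 : 0 ≤ c⁻¹ * ‖f‖ := by positivity
  have hL := hsol.norm_translate_sub_le hc hA' hS' (mulCLM_const_translate _ _)
    (mulCLM_const_translate _ _)
  choose q hq hQ using fun rs => exists_deriv_moll_mollL hε hρ hC hk hL0 fun h =>
    (norm_translate_coordL_sub_le rs h p).trans (hL h)
  -- The corrector is `ε ∑ p_rs N^(rs)(x / ε)` with the components of `p` mollified twice: once by
  -- `mollL`, once inside `oscMul`.
  refine ⟨∑ rs, (ε : ℂ) • oscMul hε hk (mollL hk (coordL rs p)) (cellSolution a 0 rs).1,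
    ∑ rs, correctorGrad hε hk (mollL hk (coordL rs p)) (q rs) (cellSolution a 0 rs),
    IsWeakGrad.sum fun rs _ => isWeakGrad_corrector hε hk (hq rs)
      (mem_quasiPeriodicH1Perp_iff.mp (isCellSolution_cellSolution ha rs).1).1, ?_,
    fun z Z hz => ?_⟩
  · have h7 : ‖∑ rs, (ε : ℂ) • oscMul hε hk (mollL hk (coordL rs p)) (cellSolution a 0 rs).1‖ ≤
        ∑ rs : Fin n × Fin d, (c⁻¹ * ‖(cellSolution a 0 rs).1‖) * (ε * ‖f‖) := by
      refine norm_sum_le_of_le _ fun rs _ => ?_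
      rw [norm_smul, Complex.norm_real, Real.norm_of_nonneg hε.le]
      calc _ ≤ ε * ((c⁻¹ * ‖f‖) * ‖(cellSolution a 0 rs).1‖) := by
            refine mul_le_mul_of_nonneg_left ((norm_oscMul_le hε hk _ _).trans ?_) hε.le
            exact mul_le_mul_of_nonneg_right ((norm_mollL_le hk _).trans
              ((norm_coordL_le rs p).trans hp)) (norm_nonneg _)
        _ = _ := by ring
    rw [← Finset.sum_mul, ← hm₆] at h7
    refine h7.trans ?_
    rw [mul_assoc]
    refine mul_le_mul_of_nonneg_right ?_ (by positivity)
    linarith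
  · have h8 := norm_flux_sub_le ha hε hρ hk hL0 (Q := C * ρ * (c⁻¹ * ‖f‖)) hL hq hQ hz
    have h9 := norm_potential_sub_le hs hε hρ hk hsol.1 hz
    have e1 : (∑ rs, d * (ρ * ε * (C * ρ * (c⁻¹ * ‖f‖)) * ‖cellFlux ha rs‖)) =
        m₂ * (ε * ‖f‖) := by
      rw [hm₂, Finset.sum_mul]
      exact Finset.sum_congr rfl fun _ _ => by ring
    have e2 : ∑ rs, d * ((C * ρ * (c⁻¹ * ‖f‖)) * ‖(cellSolution a 0 rs).1‖) =
        (∑ rs, d * ((C * ρ * c⁻¹) * ‖(cellSolution a 0 rs).1‖)) * ‖f‖ := by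
      rw [Finset.sum_mul]
      exact Finset.sum_congr rfl fun _ _ => by ring
    have e3 : ∑ r, ρ * ε * ‖u‖ * ‖cellDefect hs (EuclideanSpace.single r 1)‖ ≤
        m₅ * (ε * ‖f‖) := by
      rw [hm₅, Finset.sum_mul]
      refine Finset.sum_le_sum fun r _ => ?_
      calc _ ≤ ρ * ε * (c⁻¹ * ‖f‖) * ‖cellDefect hs (EuclideanSpace.single r 1)‖ := by gcongr
        _ = _ := by ring
    have e4 : (Ms + D) * (n * (‖p‖ * (ρ * ε))) ≤ m₄ * (ε * ‖f‖) := by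
      calc _ ≤ (Ms + D) * (n * ((c⁻¹ * ‖f‖) * (ρ * ε))) := by gcongr
        _ = _ := by ring
    rw [← hMa, ← hB, e1, e2] at h8
    rw [← hMs, ← hD] at h9
    have e5 : ε * (Ma * ((∑ rs, d * ((C * ρ * c⁻¹) * ‖(cellSolution a 0 rs).1‖)) * ‖f‖)) =
        m₃ * (ε * ‖f‖) := by rw [hm₃]; ring
    have e6 : (Ma + B) * (n * d * (2 * (c⁻¹ * ‖f‖ * (ρ * ε)))) = m₁ * (ε * ‖f‖) := by
      rw [hm₁]; ring
    rw [e5, e6, ← add_mul, ← add_mul] at h8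
    set T := ε * ‖f‖ with hT
    have hT0 : 0 ≤ T := by positivity
    calc _ ≤ (m₁ + m₂ + m₃) * T * ‖Z‖ + (m₄ * T * ‖z‖ + m₅ * T * ‖Z‖) := by
          refine (norm_add_le _ _).trans (add_le_add h8 (h9.trans (add_le_add ?_ ?_)))
          · exact mul_le_mul_of_nonneg_right e4 (norm_nonneg _)
          · exact mul_le_mul_of_nonneg_right e3 (norm_nonneg _)
      _ = ((m₁ + m₂ + m₃ + m₅) * ‖Z‖ + m₄ * ‖z‖) * T := by ring
      _ ≤ ((m₁ + m₂ + m₃ + m₄ + m₅ + m₆) * ‖Z‖ + (m₁ + m₂ + m₃ + m₄ + m₅ + m₆) * ‖z‖) * T := by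
          refine mul_le_mul_of_nonneg_right (add_le_add
            (mul_le_mul_of_nonneg_right ?_ (norm_nonneg _))
            (mul_le_mul_of_nonneg_right ?_ (norm_nonneg _))) hT0
          · linarith
          · linarith
      _ = _ := by rw [hT]; ring

/-- An energy estimate gives the error in terms of the residual. -/
theorem norm_sub_le_of_corrector {A A₀ : L2Mat n d →L[ℂ] L2Mat n d}
    {S S₀ : L2Vec n d →L[ℂ] L2Vec n d} {c δ σ : ℝ} (hc : 0 < c) (hδ : 0 ≤ δ) (hσ : 0 ≤ σ)
    (hA : ∀ g, c * ‖g‖ ^ 2 ≤ (inner ℂ g (A g)).re) (hS : ∀ u, c * ‖u‖ ^ 2 ≤ (inner ℂ u (S u)).re)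
    (hSσ : ∀ u, ‖S u‖ ≤ σ * ‖u‖) {f u u₀ w : L2Vec n d} {g p W : L2Mat n d}
    (hu : IsWeakSolution A S f u g) (hu₀ : IsWeakSolution A₀ S₀ f u₀ p) (hw : IsWeakGrad w W)
    (hwδ : ‖w‖ ≤ δ)
    (hres : ∀ z Z, IsWeakGrad z Z →
      ‖inner ℂ Z (A₀ p - A p - A W) + inner ℂ z (S₀ u₀ - S u₀)‖ ≤ δ * (‖z‖ + ‖Z‖)) :
    ‖u - u₀‖ ≤ (2 * (1 + σ) / c + 1) * δ := by
  obtain ⟨z, hz⟩ : ∃ z, z = u - u₀ - w := ⟨_, rfl⟩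
  obtain ⟨Z, hZ⟩ : ∃ Z, Z = g - p - W := ⟨_, rfl⟩
  have hzZ : IsWeakGrad z Z := by
    rw [hz, hZ]
    exact (hu.1.sub hu₀.1).sub hw
  have h1 := hu.2 z Z hzZ
  have h2 := hu₀.2 z Z hzZ
  have e1 : A Z = A g - A p - A W := by rw [hZ, map_sub, map_sub]
  have e2 : S z = S u - S u₀ - S w := by rw [hz, map_sub, map_sub]
  -- Both equations are tested with the error `z = u - u₀ - w`; their right-hand sides cancel. The
  -- residual in `hres` omits the zeroth-order term of the corrector, hence the separate `S w`,
  -- which is responsible for `σ`.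
  have h3 : inner ℂ Z (A Z) + inner ℂ z (S z) =
      (inner ℂ Z (A₀ p - A p - A W) + inner ℂ z (S₀ u₀ - S u₀)) - inner ℂ z (S w) := by
    rw [e1, e2]
    simp only [inner_sub_right]
    linear_combination h1 - h2
  have h4 : c * (‖Z‖ ^ 2 + ‖z‖ ^ 2) ≤ (1 + σ) * δ * (‖z‖ + ‖Z‖) := by
    have h5 := congrArg Complex.re h3
    rw [Complex.add_re] at h5
    have h6 : ((inner ℂ Z (A₀ p - A p - A W) + inner ℂ z (S₀ u₀ - S u₀)) - inner ℂ z (S w)).re ≤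
        δ * (‖z‖ + ‖Z‖) + ‖z‖ * (σ * δ) := by
      refine (Complex.re_le_norm _).trans ((norm_sub_le _ _).trans (add_le_add (hres z Z hzZ) ?_))
      refine (norm_inner_le_norm _ _).trans (mul_le_mul_of_nonneg_left ?_ (norm_nonneg _))
      exact (hSσ w).trans (mul_le_mul_of_nonneg_left hwδ hσ)
    have h7 : 0 ≤ σ * δ * ‖Z‖ := by positivity
    nlinarith [hA Z, hS z]
  have h8 : ‖z‖ ≤ 2 * (1 + σ) / c * δ := by
    set x := ‖z‖ + ‖Z‖ with hx
    have hx0 : 0 ≤ x := by positivity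
    have hzx : ‖z‖ ≤ x := le_add_of_nonneg_right (norm_nonneg _)
    -- The factor `2` comes from `(‖z‖ + ‖Z‖)² ≤ 2 (‖z‖² + ‖Z‖²)`.
    have h9 : c * x ^ 2 ≤ 2 * ((1 + σ) * δ) * x := by
      nlinarith [mul_nonneg hc.le (sq_nonneg (‖z‖ - ‖Z‖))]
    have h10 : c * x ≤ 2 * ((1 + σ) * δ) := by
      rcases hx0.eq_or_lt with h0 | h0
      · rw [← h0, mul_zero]
        positivity
      · refine le_of_mul_le_mul_right ?_ h0
        linarith
    refine hzx.trans ?_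
    rw [div_mul_eq_mul_div, le_div_iff₀ hc]
    linarith
  calc ‖u - u₀‖ = ‖z + w‖ := by rw [hz, sub_add_cancel]
    _ ≤ 2 * (1 + σ) / c * δ + δ := (norm_add_le _ _).trans (add_le_add h8 hwδ)
    _ = _ := by ring

end

end FibreHom

end

/-! ### The main theorem: solution operators and the operator-norm estimate -/

theorem theorem4p1 (n d : ℕ)
    (a : FibreHom.Space d → FibreHom.Mat n d →L[ℂ] FibreHom.Mat n d)
    (s : FibreHom.Space d → FibreHom.Vec n →L[ℂ] FibreHom.Vec n)
    (ha : FibreHom.IsPeriodicCoercive a) (hs : FibreHom.IsPeriodicCoercive s) :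
    (∀ rs : Fin n × Fin d, ∃! p, FibreHom.IsCellSolution a 0 rs p) ∧
    FibreHom.IsPeriodicCoercive (fun _ : FibreHom.Space d => FibreHom.aHom a 0) ∧
    FibreHom.IsPeriodicCoercive (fun _ : FibreHom.Space d => FibreHom.cellMean s) ∧
    ∃ R₀ : FibreHom.L2Vec n d →L[ℂ] FibreHom.L2Vec n d,
      FibreHom.IsBoundedInverse
        (FibreHom.ellipticOp (fun _ => FibreHom.aHom a 0) (fun _ => FibreHom.cellMean s)) R₀ ∧
      ∃ κ : ℝ, 0 < κ ∧ ∀ ε : ℝ, 0 < ε →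
        ∃ R : FibreHom.L2Vec n d →L[ℂ] FibreHom.L2Vec n d,
          FibreHom.IsBoundedInverse
            (FibreHom.ellipticOp (fun x => a (ε⁻¹ • x)) (fun x => s (ε⁻¹ • x))) R ∧
          ‖R - R₀‖ ≤ κ * ε := by
  obtain ⟨ν₁, hν₁, hco₁⟩ := ha.coercive
  obtain ⟨ν₂, hν₂, hco₂⟩ := hs.coercive
  have hA₁ := FibreHom.re_inner_aHom_ge ha hν₁ hco₁
  have hS₂ := FibreHom.re_inner_cellMean_ge hs hco₂
  -- One constant serves the homogenised problem and all oscillating problems, as homogenisation and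
  -- rescaling preserve the lower bounds.
  have hc : 0 < min ν₁ ν₂ := lt_min hν₁ hν₂
  have hcle : ∀ {ν : ℝ}, min ν₁ ν₂ ≤ ν → ∀ {x y : ℝ}, ν * x ^ 2 ≤ y → min ν₁ ν₂ * x ^ 2 ≤ y :=
    fun h _ _ hxy => (mul_le_mul_of_nonneg_right h (sq_nonneg _)).trans hxy
  have hA := fun v => hcle (min_le_left ν₁ ν₂) (hA₁ v)
  have hS := fun v => hcle (min_le_right ν₁ ν₂) (hS₂ v)
  refine ⟨FibreHom.existsUnique_cellSolution ha, FibreHom.isPeriodicCoercive_const hν₁ hA₁,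
    FibreHom.isPeriodicCoercive_const hν₂ hS₂, ?_⟩
  obtain ⟨R₀, h₀, h₀'⟩ := FibreHom.exists_solution_operator
    (FibreHom.constMul d (FibreHom.aHom a 0)) (FibreHom.constMul d (FibreHom.cellMean s)) hc
    (FibreHom.re_inner_mulCLM_ge _ _ (Filter.Eventually.of_forall fun _ => hA))
    (FibreHom.re_inner_mulCLM_ge _ _ (Filter.Eventually.of_forall fun _ => hS))
  obtain ⟨M, hM, hcor⟩ := FibreHom.exists_corrector ha hs hc hA hS
  have hσ : 0 ≤ (eLpNorm s ⊤ MeasureTheory.volume).toReal := ENNReal.toReal_nonneg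
  refine ⟨R₀, FibreHom.isBoundedInverse_of_weakSolution _ _ h₀ h₀',
    -- The factor in front of `M` is the energy constant with `σ` the essential supremum of `s`; the
    -- final `+ 1` only makes `κ` positive, since `M` may vanish.
    (2 * (1 + (eLpNorm s ⊤ MeasureTheory.volume).toReal) / min ν₁ ν₂ + 1) * M + 1,
    by positivity, fun ε hε => ?_⟩
  have hAε := fun g => hcle (min_le_left ν₁ ν₂) (FibreHom.re_inner_scaledMul_ge ha hε hco₁ g)
  have hSε := fun g => hcle (min_le_right ν₁ ν₂) (FibreHom.re_inner_scaledMul_ge hs hε hco₂ g)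
  obtain ⟨R, h, h'⟩ := FibreHom.exists_solution_operator (FibreHom.scaledMul ha hε)
    (FibreHom.scaledMul hs hε) hc hAε hSε
  refine ⟨R, FibreHom.isBoundedInverse_of_weakSolution (ha.memLp_scaled hε) (hs.memLp_scaled hε)
    h h', ?_⟩
  refine ContinuousLinearMap.opNorm_le_bound _ (by positivity) fun f => ?_
  obtain ⟨g, hg⟩ := h f
  obtain ⟨p, hp⟩ := h₀ f
  obtain ⟨w, W, hw, hwM, hres⟩ := hcor ε hε f (R₀ f) p hp
  have hmain := FibreHom.norm_sub_le_of_corrector hc (by positivity) hσ hAε hSε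
    (FibreHom.norm_scaledMul_le hs hε) hg hp hw hwM hres
  refine hmain.trans ?_
  have hpos : 0 ≤ ε * ‖f‖ := by positivity
  rw [add_mul _ (1 : ℝ) ε, one_mul, add_mul _ ε, mul_assoc M, ← mul_assoc _ M, mul_assoc (_ * M)]
  exact le_add_of_nonneg_right hpos
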